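/- Conventions. Let $\Bbbk$ be a field. Paths of a quiver are composed from left to right. For a finite quiver $Q$, let $J_Q\subset \Bbbk Q$ be the ideal of the path algebra generated by the arrows; an ideal $I$ is admissible if $J_Q^m\subseteq I\subseteq J_Q^2$ for some $m\ge 2$. For a finite dimensional algebra $\Lambda$, $\mathrm{mod}\,\Lambda$ denotes the finitely generated right $\Lambda$-modules (so $\mathrm{mod}\,\Lambda^{op}$ is the category of finitely generated left $\Lambda$-modules), and $\Omega(M)$ is the kernel of the projective cover $P(M)\to M$. For a class $\mathcal C$ of modules, $\mathrm{add}\,\mathcal C$ consists of all modules isomorphic to finite (possibly empty) direct sums of direct summands of modules in $\mathcal C$, and $\mathrm{add}\,V=\mathrm{add}\{V\}$. Let $K_0(\Lambda)$ be the abelian group generated by the symbols $[M]$, $M\in\mathrm{mod}\,\Lambda$, modulo $[M]-[M']-[M'']$ whenever $M\cong M'\oplus M''$ and $[P]$ for $P$ projective; let $\bar\Omega$ be the endomorphism $[M]\mapsto[\Omega(M)]$, and let $\langle \mathrm{add}\, M\rangle$ be the subgroup generated by the classes of the indecomposable summands of $M$. The Igusa–Todorov function $\phi(M)$ is the least $k\ge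 0$ such that $\bar\Omega$ is injective on $\bar\Omega^m\langle\mathrm{add}\,M\rangle$ for all $m\ge k$, and $\phi\dim(\mathcal D)=\sup_{M\in\mathcal D}\phi(M)$. A subcategory $\mathcal D\subseteq \mathrm{mod}\,\Lambda$ is a $0$-Igusa–Todorov subcategory if $\mathcal D=\mathrm{add}\,\mathcal D$, $\Omega(\mathcal D)\subseteq \mathcal D$ and $\phi\dim(\mathcal D)=0$. For $n\ge 0$, $\Lambda$ is $(n,V,\mathcal D)$-LIT if $\mathcal D$ is a $0$-Igusa–Todorov subcategory, $V\in\mathrm{mod}\,\Lambda$, and every $M\in\mathrm{mod}\,\Lambda$ admits an exact sequence $$0\to V_1\oplus D_1\to V_0\oplus D_0\to \Omega^n(M)\to 0$$ with $V_0,V_1\in\mathrm{add}\,V$ and $D_0,D_1\in\mathcal D$. It is $n$-LIT if it is $(n,V,\mathcal D)$-LIT for some $V,\mathcal D$, and $n$-Igusa–Todorov if it is $(n,V,\{0\})$-LIT for some $V$. Proposition 3.6. Let $A=\Bbbk Q_A/I_A$ and $B=\Bbbk Q_B/I_B$ be finite dimensional algebras, with $Q_A,Q_B$ finite quivers and $I_A,I_B$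 admissible ideals, and let $C=\Bbbk Q_C/I_C$ be a finite dimensional algebra, $Q_C$ a finite quiver, such that - (H1) the vertex set of $Q_C$ is the disjoint union of the vertex sets of $Q_A$ and $Q_B$; - (H2) the arrows of $Q_C$ are the arrows of $Q_A$, the arrows of $Q_B$, a family of arrows $\alpha_j$ ($j\in J$) each going from a vertex of $Q_A$ to a vertex of $Q_B$, and a family of arrows $\beta_k$ ($k\in K$) each going from a vertex of $Q_B$ to a vertex of $Q_A$; - (H3, with equality) $I_C=\langle I_A,\ I_B,\ \alpha\alpha_j,\ \beta\beta_k,\ \alpha_j\beta_k,\ \beta_k\alpha_j\rangle$, where $\alpha$ runs over the arrows of $Q_A$, $\beta$ over the arrows of $Q_B$, $j\in J$ and $k\in K$. Let $n\ge 0$. If $A^{op}$ and $B^{op}$ are $n$-Igusa–Todorov, then $C^{op}$ is $(n+1)$-Igusa–Todorov. If $A^{op}$ and $B^{op}$ are $n$-LIT, then $C^{op}$ is $(n+1)$-LIT. -/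

import Mathlib

universe u

open CategoryTheory

noncomputable section

/-! ### Path algebras and bound quiver algebras -/

/-- The type of all paths of a quiver (including the trivial path at each vertex). -/
abbrev QuiverPath (V : Type u) [Quiver.{u} V] : Type u :=
  Σ a b : V, Quiver.Path a b

/-- The underlying vector space of the path algebra: the `k`-vector space with basis the paths. -/
def PathAlgebra (k : Type u) [Field k] (V : Type u) [Quiver.{u} V] : Type u :=
  QuiverPath V →₀ k

namespace PathAlgebra

variable {k : Type u} [Field k] {V : Type u} [Quiver.{u} V]

instance : AddCommGroup (PathAlgebra k V) :=
  inferInstanceAs (AddCommGroup (QuiverPath V →₀ k))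

instance : Module k (PathAlgebra k V) :=
  inferInstanceAs (Module k (QuiverPath V →₀ k))

/-- The basis element attached to a path. -/
def ofPath {a b : V} (p : Quiver.Path a b) : PathAlgebra k V :=
  Finsupp.single (⟨a, b, p⟩ : QuiverPath V) (1 : k)

/-- The basis element attached to an arrow. -/
def ofArrow {a b : V} (e : a ⟶ b) : PathAlgebra k V := ofPath e.toPath

open Classical in
/-- The product of two paths: the concatenation "first `p`, then `q`" if `p` ends where `q`
starts, and zero otherwise. -/
def mulPath (p q : QuiverPath V) : PathAlgebra k V :=
  if h : q.1 = p.2.1 then ofPath (p.2.2.comp (q.2.2.cast h rfl)) else 0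

/-- The bilinear extension of the product of paths. -/
def mulLin : PathAlgebra k V →ₗ[k] PathAlgebra k V →ₗ[k] PathAlgebra k V :=
  Finsupp.linearCombination k fun p : QuiverPath V =>
    (Finsupp.linearCombination k fun q : QuiverPath V => (mulPath p q : PathAlgebra k V) :
      PathAlgebra k V →ₗ[k] PathAlgebra k V)

instance : Mul (PathAlgebra k V) := ⟨fun x y => mulLin x y⟩

theorem mul_def (x y : PathAlgebra k V) : x * y = mulLin x y := rfl

/-- The identity of the path algebra is the sum of the trivial paths. -/
instance [Fintype V] : One (PathAlgebra k V) := ⟨∑ a : V, ofPath (Quiver.Path.nil : Quiver.Path a a)⟩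

theorem one_def [Fintype V] :
    (1 : PathAlgebra k V) = ∑ a : V, ofPath (Quiver.Path.nil : Quiver.Path a a) := rfl

theorem mulLin_ofPath_ofPath {a b c d : V} (p : Quiver.Path a b) (q : Quiver.Path c d) :
    mulLin (ofPath p : PathAlgebra k V) (ofPath q) = mulPath ⟨a, b, p⟩ ⟨c, d, q⟩ := by
  have h : mulLin (ofPath p : PathAlgebra k V) =
      (1 : k) • (Finsupp.linearCombination k fun r : QuiverPath V =>
        (mulPath ⟨a, b, p⟩ r : PathAlgebra k V)) :=
    Finsupp.linearCombination_single k (1 : k) (⟨a, b, p⟩ : QuiverPath V)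
  rw [h, one_smul]
  exact (Finsupp.linearCombination_single k (1 : k) (⟨c, d, q⟩ : QuiverPath V)).trans (one_smul _ _)

theorem ofPath_mul_ofPath {a b c : V} (p : Quiver.Path a b) (q : Quiver.Path b c) :
    (ofPath p * ofPath q : PathAlgebra k V) = ofPath (p.comp q) := by
  rw [mul_def, mulLin_ofPath_ofPath]
  simp [mulPath]

theorem ofPath_mul_ofPath_of_ne {a b c d : V} (p : Quiver.Path a b) (q : Quiver.Path c d)
    (h : c ≠ b) : (ofPath p * ofPath q : PathAlgebra k V) = 0 := by
  rw [mul_def, mulLin_ofPath_ofPath]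
  simp [mulPath, h]

/-- An additive, homogeneous property that holds for paths holds for all elements. -/
theorem induction_paths {motive : PathAlgebra k V → Prop} (x : PathAlgebra k V)
    (zero : motive 0) (add : ∀ x y, motive x → motive y → motive (x + y))
    (path : ∀ (c : k) (a b : V) (p : Quiver.Path a b), motive (c • ofPath p)) : motive x := by
  refine Finsupp.induction_linear x zero add ?_
  rintro ⟨a, b, p⟩ c
  have := path c a b p
  rwa [show (c • ofPath p : PathAlgebra k V) = Finsupp.single (⟨a, b, p⟩ : QuiverPath V) c by
    simp [ofPath]; exact (Finsupp.smul_single _ _ _).trans (by simp)] at this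

theorem path_assoc {a b c d e f : V} (p : Quiver.Path a b) (q : Quiver.Path c d)
    (r : Quiver.Path e f) :
    (ofPath p * ofPath q * ofPath r : PathAlgebra k V) = ofPath p * (ofPath q * ofPath r) := by
  have hz : ∀ x : PathAlgebra k V, 0 * x = 0 := fun x => by simp [mul_def]
  have hz' : ∀ x : PathAlgebra k V, x * 0 = 0 := fun x => by simp [mul_def]
  by_cases h : c = b
  · subst h
    by_cases h' : e = d
    · subst h'
      simp only [ofPath_mul_ofPath, Quiver.Path.comp_assoc]
    · rw [ofPath_mul_ofPath, ofPath_mul_ofPath_of_ne _ _ h', ofPath_mul_ofPath_of_ne _ _ h', hz']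
  · by_cases h' : e = d
    · subst h'
      rw [ofPath_mul_ofPath, ofPath_mul_ofPath_of_ne _ _ h, ofPath_mul_ofPath_of_ne _ _ h, hz]
    · rw [ofPath_mul_ofPath_of_ne _ _ h, ofPath_mul_ofPath_of_ne _ _ h', hz, hz']

instance : NonUnitalRing (PathAlgebra k V) :=
  { (inferInstance : AddCommGroup (PathAlgebra k V)),
    (inferInstance : Mul (PathAlgebra k V)) with
    left_distrib := fun x y z => by simp [mul_def]
    right_distrib := fun x y z => by simp [mul_def]
    zero_mul := fun x => by simp [mul_def]
    mul_zero := fun x => by simp [mul_def]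
    mul_assoc := fun x y z => by
      induction x using induction_paths with
      | zero => simp [mul_def]
      | add x x' hx hx' => simp only [mul_def, map_add, LinearMap.add_apply] at *; rw [hx, hx']
      | path c a b p =>
        induction y using induction_paths with
        | zero => simp [mul_def]
        | add y y' hy hy' => simp only [mul_def, map_add, LinearMap.add_apply] at *; rw [hy, hy']
        | path c' a' b' p' =>
          induction z using induction_paths with
          | zero => simp [mul_def]
          | add z z' hz hz' => simp only [mul_def, map_add] at *; rw [hz, hz']
          | path c'' a'' b'' p'' =>
            have := path_assoc (k := k) p p' p''
            simp only [mul_def] at this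
            simp only [mul_def, map_smul, LinearMap.smul_apply, this] }

instance [Fintype V] : Ring (PathAlgebra k V) :=
  { (inferInstance : NonUnitalRing (PathAlgebra k V)),
    (inferInstance : One (PathAlgebra k V)) with
    one_mul := fun x => by
      induction x using induction_paths with
      | zero => simp
      | add x x' hx hx' => rw [mul_add, hx, hx']
      | path c a b p =>
        have h : (1 : PathAlgebra k V) * ofPath p = ofPath p := by
          rw [one_def, Finset.sum_mul, Finset.sum_eq_single a]
          · rw [ofPath_mul_ofPath, Quiver.Path.nil_comp]
          · intro b _ hb
            exact ofPath_mul_ofPath_of_ne _ _ (Ne.symm hb)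
          · simp
        rw [mul_def] at h ⊢
        rw [map_smul, h]
    mul_one := fun x => by
      induction x using induction_paths with
      | zero => simp
      | add x x' hx hx' => rw [add_mul, hx, hx']
      | path c a b p =>
        have h : ofPath p * (1 : PathAlgebra k V) = ofPath p := by
          rw [one_def, Finset.mul_sum, Finset.sum_eq_single b]
          · rw [ofPath_mul_ofPath, Quiver.Path.comp_nil]
          · intro b _ hb
            exact ofPath_mul_ofPath_of_ne _ _ hb
          · simp
        rw [mul_def] at h ⊢
        rw [map_smul, LinearMap.smul_apply, h] }

instance [Fintype V] : Algebra k (PathAlgebra k V) :=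
  Algebra.ofModule (fun c x y => by simp [mul_def]) (fun c x y => by simp [mul_def])

/-- The `m`-th power of the ideal generated by the arrows: the ideal generated by (in fact, the
linear span of) all paths of length at least `m`. -/
def arrowIdealPow (k : Type u) [Field k] (V : Type u) [Quiver.{u} V] (m : ℕ) :
    TwoSidedIdeal (PathAlgebra k V) :=
  TwoSidedIdeal.span {x | ∃ (a b : V) (p : Quiver.Path a b), m ≤ p.length ∧ x = ofPath p}

/-- Admissible ideals of a path algebra: `J ^ m ⊆ I ⊆ J ^ 2` for some `m ≥ 2`, where `J` is the
ideal generated by the arrows. -/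
def IsAdmissible (I : TwoSidedIdeal (PathAlgebra k V)) : Prop :=
  I ≤ arrowIdealPow k V 2 ∧ ∃ m : ℕ, 2 ≤ m ∧ arrowIdealPow k V m ≤ I

/-- The linear map of path algebras induced by a morphism of quivers. -/
def map {W : Type u} [Quiver.{u} W] (F : V ⥤q W) : PathAlgebra k V →ₗ[k] PathAlgebra k W :=
  Finsupp.linearCombination k fun p : QuiverPath V => (ofPath (F.mapPath p.2.2) : PathAlgebra k W)

end PathAlgebra

/-- The bound quiver algebra `kQ / I`. -/
abbrev BoundQuiverAlgebra {k : Type u} [Field k] {V : Type u} [Quiver.{u} V] [Fintype V]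
    (I : TwoSidedIdeal (PathAlgebra k V)) : Type u :=
  I.ringCon.Quotient

instance BoundQuiverAlgebra.isArtinianRing {k : Type u} [Field k] {V : Type u} [Quiver.{u} V]
    [Fintype V] (I : TwoSidedIdeal (PathAlgebra k V)) [Module.Finite k (BoundQuiverAlgebra I)] :
    IsArtinianRing (BoundQuiverAlgebra I) :=
  IsArtinianRing.of_finite k _

/-! ### Gluing two quivers -/

/-- The vertices of the quiver obtained from two quivers `Q_A`, `Q_B` (with vertex sets `VA`, `VB`)
by adding a family of arrows from `Q_A` to `Q_B` and a family of arrows from `Q_B` to `Q_A`: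
the disjoint union of the two vertex sets. Here `J a b` is the set of added arrows from
`a ∈ VA` to `b ∈ VB`, and `K b a` is the set of added arrows from `b ∈ VB` to `a ∈ VA`. -/
def GluedQuiver {VA VB : Type u} (_J : VA → VB → Type u) (_K : VB → VA → Type u) : Type u :=
  VA ⊕ VB

namespace GluedQuiver

variable {VA VB : Type u} [Quiver.{u} VA] [Quiver.{u} VB]
  {J : VA → VB → Type u} {K : VB → VA → Type u}

instance [Fintype VA] [Fintype VB] : Fintype (GluedQuiver J K) :=
  inferInstanceAs (Fintype (VA ⊕ VB))

/-- A vertex of `Q_A`, as a vertex of the glued quiver. -/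
def inA (J : VA → VB → Type u) (K : VB → VA → Type u) (a : VA) : GluedQuiver J K := Sum.inl a

/-- A vertex of `Q_B`, as a vertex of the glued quiver. -/
def inB (J : VA → VB → Type u) (K : VB → VA → Type u) (b : VB) : GluedQuiver J K := Sum.inr b

/-- The arrows of the glued quiver: those of `Q_A`, those of `Q_B`, and the added ones. -/
instance : Quiver.{u} (GluedQuiver J K) where
  Hom
    | Sum.inl a, Sum.inl a' => a ⟶ a'
    | Sum.inl a, Sum.inr b => J a b
    | Sum.inr b, Sum.inl a => K b a
    | Sum.inr b, Sum.inr b' => b ⟶ b'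

/-- The inclusion of the quiver `Q_A` into the glued quiver. -/
def inclA (J : VA → VB → Type u) (K : VB → VA → Type u) : VA ⥤q GluedQuiver J K where
  obj := inA J K
  map e := e

/-- The inclusion of the quiver `Q_B` into the glued quiver. -/
def inclB (J : VA → VB → Type u) (K : VB → VA → Type u) : VB ⥤q GluedQuiver J K where
  obj := inB J K
  map e := e

/-- An added arrow from `Q_A` to `Q_B`, as an arrow of the glued quiver. -/
def arrowAB (K : VB → VA → Type u) {a : VA} {b : VB} (j : J a b) : inA J K a ⟶ inB J K b := j

/-- An added arrow from `Q_B` to `Q_A`, as an arrow of the glued quiver. -/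
def arrowBA (J : VA → VB → Type u) {b : VB} {a : VA} (l : K b a) : inB J K b ⟶ inA J K a := l

open PathAlgebra in
/-- The ideal `⟨I_A, I_B, α α_j, β β_k, α_j β_k, β_k α_j⟩` of the path algebra of the glued quiver,
where `α`, `β` run through the arrows of `Q_A`, `Q_B`, and the `α_j`, `β_k` are the added arrows
from `Q_A` to `Q_B` and from `Q_B` to `Q_A`. (Products of arrows which do not compose vanish.) -/
def gluedIdeal {k : Type u} [Field k] (J : VA → VB → Type u) (K : VB → VA → Type u)
    (IA : TwoSidedIdeal (PathAlgebra k VA)) (IB : TwoSidedIdeal (PathAlgebra k VB)) :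
    TwoSidedIdeal (PathAlgebra k (GluedQuiver J K)) :=
  TwoSidedIdeal.span
    ({x | ∃ y ∈ IA, x = PathAlgebra.map (inclA J K) y} ∪
     {x | ∃ y ∈ IB, x = PathAlgebra.map (inclB J K) y} ∪
     {x | ∃ (a a' : VA) (b : VB) (e : a ⟶ a') (j : J a' b),
        x = ofArrow ((inclA J K).map e) * ofArrow (arrowAB K j)} ∪
     {x | ∃ (b b' : VB) (a : VA) (e : b ⟶ b') (l : K b' a),
        x = ofArrow ((inclB J K).map e) * ofArrow (arrowBA J l)} ∪
     {x | ∃ (a a' : VA) (b : VB) (j : J a b) (l : K b a'),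
        x = ofArrow (arrowAB K j) * ofArrow (arrowBA J l)} ∪
     {x | ∃ (b b' : VB) (a : VA) (l : K b a) (j : J a b'),
        x = ofArrow (arrowBA J l) * ofArrow (arrowAB K j)})

end GluedQuiver

/-! ### Finitely generated modules, syzygies and Igusa-Todorov functions

All notions below are stated for left modules over a ring `R`. A right module over the opposite
algebra of `R` is the same thing as a left `R`-module, so that these are the notions for the
category `mod Rᵒᵖ` of finitely generated right modules over the opposite algebra of `R`. -/

namespace IgusaTodorov

variable {R : Type u} [Ring R]

/-- Projective covers: surjections from a projective module with superfluous kernel. -/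
def IsProjectiveCover {P M : Type u} [AddCommGroup P] [Module R P] [AddCommGroup M] [Module R M]
    (f : P →ₗ[R] M) : Prop :=
  Module.Projective R P ∧ Function.Surjective f ∧
    ∀ L : Submodule R P, L ⊔ LinearMap.ker f = ⊤ → L = ⊤

/-- Over a left Artinian ring, finitely generated modules have projective covers. -/
theorem exists_projectiveCover [IsArtinianRing R] (M : FGModuleCat.{u} R) :
    ∃ (P : FGModuleCat.{u} R) (f : P →ₗ[R] M), IsProjectiveCover f := by
  classical
  let S : Set ℕ∞ := {l | ∃ (P : FGModuleCat.{u} R) (f : P →ₗ[R] M),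
    Module.Projective R P ∧ Function.Surjective f ∧ Module.length R P = l}
  have hS : S.Nonempty := by
    obtain ⟨n, f, hf⟩ := Module.Finite.exists_fin' R M
    exact ⟨_, FGModuleCat.of R (Fin n → R), f, inferInstanceAs (Module.Projective R (Fin n → R)),
      hf, rfl⟩
  obtain ⟨P, f, hP, hf, hl⟩ := WellFounded.min_mem (wellFounded_lt (α := ℕ∞)) S hS
  refine ⟨P, f, hP, hf, fun L hL => ?_⟩
  -- lift `f` through `L`
  have hfL : Function.Surjective (f.comp L.subtype) := by
    intro m
    obtain ⟨p, rfl⟩ := hf m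
    have hp : p ∈ L ⊔ LinearMap.ker f := hL ▸ Submodule.mem_top
    obtain ⟨x, hx, y, hy, rfl⟩ := Submodule.mem_sup.mp hp
    exact ⟨⟨x, hx⟩, by simpa using hy⟩
  obtain ⟨g, hg⟩ := Module.projective_lifting_property (f.comp L.subtype) f hfL
  let h : Module.End R P := L.subtype.comp g
  have hh : f.comp h = f := hg
  have hpow : ∀ n : ℕ, f.comp (h ^ n) = f := by
    intro n
    induction n with
    | zero => rfl
    | succ n ih => rw [pow_succ, Module.End.mul_eq_comp, ← LinearMap.comp_assoc, ih, hh]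
  obtain ⟨N, hN⟩ := Filter.eventually_atTop.mp h.eventually_isCompl_ker_pow_range_pow
  have hc := hN (N + 1) (Nat.le_succ N)
  set T := LinearMap.range (h ^ (N + 1)) with hT
  have hTproj : Module.Projective R T := by
    refine Module.Projective.of_split T.subtype (T.projectionOnto _ hc.symm) ?_
    ext x
    simp
  have hTL : T ≤ L := by
    rintro _ ⟨x, rfl⟩
    rw [pow_succ', Module.End.mul_apply]
    exact (g _).2
  have hTsurj : Function.Surjective (f.comp T.subtype) := by
    intro m
    obtain ⟨p, rfl⟩ := hf m
    exact ⟨⟨(h ^ (N + 1)) p, p, rfl⟩, LinearMap.congr_fun (hpow (N + 1)) p⟩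
  have hTtop : T = ⊤ := by
    by_contra hne
    have hlt : Module.length R T < Module.length R P := Submodule.length_lt hne
    rw [hl] at hlt
    refine WellFounded.not_lt_min (wellFounded_lt (α := ℕ∞)) S ?_ hlt
    exact ⟨FGModuleCat.of R T, f.comp T.subtype, hTproj, hTsurj, rfl⟩
  exact top_le_iff.mp (hTtop ▸ hTL)

section Syzygy

variable [IsArtinianRing R]

/-- The projective cover `P(M)` of a finitely generated module (unique up to isomorphism). -/
def projCover (M : FGModuleCat.{u} R) : FGModuleCat.{u} R := (exists_projectiveCover M).choose

/-- The projection `P(M) → M`. -/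
def projCoverMap (M : FGModuleCat.{u} R) : projCover M →ₗ[R] M :=
  (exists_projectiveCover M).choose_spec.choose

theorem projCoverMap_spec (M : FGModuleCat.{u} R) : IsProjectiveCover (projCoverMap M) :=
  (exists_projectiveCover M).choose_spec.choose_spec

/-- The syzygy `Ω(M)`: the kernel of the projective cover `P(M) → M`. -/
def syzygy (M : FGModuleCat.{u} R) : FGModuleCat.{u} R :=
  FGModuleCat.of R (LinearMap.ker (projCoverMap M))

end Syzygy

/-- The defining relations of `K₀`: `[M] - [M'] - [M'']` if `M ≅ M' ⊕ M''`, and `[P]` if `P` is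
projective. -/
def K0Relations (R : Type u) [Ring R] : Set (FreeAbelianGroup (FGModuleCat.{u} R)) :=
  {x | ∃ M M' M'' : FGModuleCat.{u} R, Nonempty (M ≃ₗ[R] (M' × M'')) ∧
      x = FreeAbelianGroup.of M - FreeAbelianGroup.of M' - FreeAbelianGroup.of M''} ∪
  {x | ∃ P : FGModuleCat.{u} R, Module.Projective R P ∧ x = FreeAbelianGroup.of P}

/-- The abelian group generated by the symbols `[M]`, `M` a finitely generated module, modulo
the relations above. -/
abbrev K0 (R : Type u) [Ring R] : Type (u + 1) :=
  FreeAbelianGroup (FGModuleCat.{u} R) ⧸ AddSubgroup.closure (K0Relations R)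

/-- The class `[M]` in `K₀`. -/
def cls (M : FGModuleCat.{u} R) : K0 R := QuotientAddGroup.mk (FreeAbelianGroup.of M)

theorem cls_eq_add {M M' M'' : FGModuleCat.{u} R} (e : M ≃ₗ[R] (M' × M'')) :
    cls M = cls M' + cls M'' := by
  have h : (QuotientAddGroup.mk (FreeAbelianGroup.of M - FreeAbelianGroup.of M'
      - FreeAbelianGroup.of M'') : K0 R) = 0 :=
    (QuotientAddGroup.eq_zero_iff _).mpr
      (AddSubgroup.subset_closure (Or.inl ⟨M, M', M'', ⟨e⟩, rfl⟩))
  have h' : cls M - cls M' - cls M'' = 0 := h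
  rw [sub_sub, sub_eq_zero] at h'
  exact h'

theorem cls_eq_zero {P : FGModuleCat.{u} R} (h : Module.Projective R P) : cls P = 0 :=
  (QuotientAddGroup.eq_zero_iff _).mpr (AddSubgroup.subset_closure (Or.inr ⟨P, h, rfl⟩))

/-- Two finitely generated kernels of projective presentations of the same module have the same
class in `K₀` (a form of the lemma of Schanuel). -/
theorem cls_ker_eq {P Q K L : FGModuleCat.{u} R} {M : Type u} [AddCommGroup M] [Module R M]
    (hP : Module.Projective R P) (hQ : Module.Projective R Q)
    (f : P →ₗ[R] M) (g : Q →ₗ[R] M) (hf : Function.Surjective f) (hg : Function.Surjective g)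
    (eK : K ≃ₗ[R] LinearMap.ker f) (eL : L ≃ₗ[R] LinearMap.ker g) : cls K = cls L := by
  -- `ker (f, -g)` is isomorphic to both `K ⊕ Q` and `L ⊕ P`
  obtain ⟨s, hs⟩ := Module.projective_lifting_property f g hf
  obtain ⟨t, ht⟩ := Module.projective_lifting_property g f hg
  have hs' : ∀ x, f (s x) = g x := LinearMap.congr_fun hs
  have ht' : ∀ x, g (t x) = f x := LinearMap.congr_fun ht
  let W : Submodule R (P × Q) := LinearMap.ker (f.coprod (-g))
  have hW : ∀ x : P × Q, x ∈ W ↔ f x.1 = g x.2 := fun x => by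
    simp [W, ← sub_eq_add_neg, sub_eq_zero]
  let e₁ : (LinearMap.ker f × Q) ≃ₗ[R] W :=
    { toFun := fun x => ⟨(x.1.1 + s x.2, x.2), by
        rw [hW]; simp [hs']⟩
      map_add' := fun x y => by
        ext <;> simp; abel
      map_smul' := fun c x => by
        ext <;> simp
      invFun := fun w => (⟨w.1.1 - s w.1.2, by
        have := (hW w.1).mp w.2
        simp [hs', this]⟩, w.1.2)
      left_inv := fun x => by ext <;> simp
      right_inv := fun w => by ext <;> simp }
  let e₂ : (LinearMap.ker g × P) ≃ₗ[R] W :=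
    { toFun := fun x => ⟨(x.2, x.1.1 + t x.2), by
        rw [hW]; simp [ht']⟩
      map_add' := fun x y => by
        ext <;> simp; abel
      map_smul' := fun c x => by
        ext <;> simp
      invFun := fun w => (⟨w.1.2 - t w.1.1, by
        have := (hW w.1).mp w.2
        simp [ht', this]⟩, w.1.1)
      left_inv := fun x => by ext <;> simp
      right_inv := fun w => by ext <;> simp }
  let d : (K × Q) ≃ₗ[R] (L × P) :=
    (eK.prodCongr (LinearEquiv.refl R Q)).trans
      (e₁.trans (e₂.symm.trans (eL.symm.prodCongr (LinearEquiv.refl R P))))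
  have h₁ : cls (FGModuleCat.of R (K × Q)) = cls K + cls Q := cls_eq_add (LinearEquiv.refl R _)
  have h₂ : cls (FGModuleCat.of R (K × Q)) = cls L + cls P := cls_eq_add d
  rw [cls_eq_zero hP, add_zero] at h₂
  rw [cls_eq_zero hQ, add_zero] at h₁
  rw [← h₁, h₂]

section Phi

variable [IsArtinianRing R]

/-- The homomorphism on the free group induced by `M ↦ [Ω(M)]`. -/
def syzygyLift (R : Type u) [Ring R] [IsArtinianRing R] :
    FreeAbelianGroup (FGModuleCat.{u} R) →+ K0 R :=
  FreeAbelianGroup.lift fun M => cls (syzygy M)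

theorem syzygyLift_eq_zero (x : FreeAbelianGroup (FGModuleCat.{u} R))
    (hx : x ∈ AddSubgroup.closure (K0Relations R)) : syzygyLift R x = 0 := by
  refine (AddSubgroup.closure_le (syzygyLift R).ker).mpr ?_ hx
  rintro x (⟨M, M', M'', ⟨e⟩, rfl⟩ | ⟨P, hP, rfl⟩)
  · have h : cls (syzygy M) = cls (syzygy M') + cls (syzygy M'') := by
      have hM := projCoverMap_spec M
      have hM' := projCoverMap_spec M'
      have hM'' := projCoverMap_spec M''
      have := hM'.1
      have := hM''.1
      let c : (projCover M' × projCover M'') →ₗ[R] (M' × M'') :=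
        (projCoverMap M').prodMap (projCoverMap M'')
      have hc : ∀ x, x ∈ LinearMap.ker c ↔
          x.1 ∈ LinearMap.ker (projCoverMap M') ∧ x.2 ∈ LinearMap.ker (projCoverMap M'') :=
        fun x => by simp [c]
      let d : (LinearMap.ker (projCoverMap M') × LinearMap.ker (projCoverMap M''))
          ≃ₗ[R] LinearMap.ker c :=
        { toFun := fun x => ⟨(x.1.1, x.2.1), (hc _).mpr ⟨x.1.2, x.2.2⟩⟩
          map_add' := fun x y => rfl
          map_smul' := fun a x => rfl
          invFun := fun w => (⟨w.1.1, ((hc _).mp w.2).1⟩, ⟨w.1.2, ((hc _).mp w.2).2⟩)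
          left_inv := fun x => rfl
          right_inv := fun w => rfl }
      have hker : LinearMap.ker (e.toLinearMap.comp (projCoverMap M)) =
          LinearMap.ker (projCoverMap M) := by
        ext x; simp
      rw [← cls_eq_add (M := FGModuleCat.of R (syzygy M' × syzygy M'')) (LinearEquiv.refl R _)]
      refine cls_ker_eq (P := projCover M)
        (Q := FGModuleCat.of R (projCover M' × projCover M'')) hM.1
        (inferInstanceAs (Module.Projective R (projCover M' × projCover M'')))
        (e.toLinearMap.comp (projCoverMap M)) c (e.surjective.comp hM.2.1)
        (Function.Surjective.prodMap hM'.2.1 hM''.2.1)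
        (LinearEquiv.ofEq _ _ hker.symm) d
    simp [syzygyLift, AddMonoidHom.mem_ker, h]
  · have h : cls (syzygy P) = 0 := by
      have hz : cls (FGModuleCat.of R (LinearMap.ker (LinearMap.id : P →ₗ[R] P))) = 0 := by
        refine cls_eq_zero ?_
        have : Subsingleton (LinearMap.ker (LinearMap.id : P →ₗ[R] P)) := by
          rw [LinearMap.ker_id]; infer_instance
        exact Module.Projective.of_free
      rw [← hz]
      exact cls_ker_eq (P := projCover P) (Q := P) (projCoverMap_spec P).1 hP (projCoverMap P)
        LinearMap.id (projCoverMap_spec P).2.1 Function.surjective_id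
        (LinearEquiv.refl R _) (LinearEquiv.refl R _)
    simp [syzygyLift, AddMonoidHom.mem_ker, h]

/-- The endomorphism of `K₀` induced by `Ω`: it sends `[M]` to `[Ω(M)]`. -/
def omegaBar (R : Type u) [Ring R] [IsArtinianRing R] : K0 R →+ K0 R :=
  QuotientAddGroup.lift _ (syzygyLift R) syzygyLift_eq_zero

/-- `N` is (isomorphic to) a direct summand of `M`. -/
def IsSummand (N M : FGModuleCat.{u} R) : Prop :=
  ∃ N' : FGModuleCat.{u} R, Nonempty (M ≃ₗ[R] (N × N'))

/-- Indecomposable modules. -/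
def IsIndecomposable (N : FGModuleCat.{u} R) : Prop :=
  Nontrivial N ∧ ∀ X Y : FGModuleCat.{u} R, Nonempty (N ≃ₗ[R] (X × Y)) →
    Subsingleton X ∨ Subsingleton Y

/-- `⟨add M⟩`: the subgroup of `K₀` generated by the classes of the indecomposable direct
summands of `M`. -/
def addSubgroupOf (M : FGModuleCat.{u} R) : AddSubgroup (K0 R) :=
  AddSubgroup.closure {x | ∃ N, IsIndecomposable N ∧ IsSummand N M ∧ x = cls N}

/-- The least `k` such that `f` is injective on `f ^ m (X)` for all `m ≥ k` (and `⊤` if there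
is no such `k`, which does not happen for the finitely generated subgroups `⟨add M⟩`). -/
def fittingIndex {G : Type*} [AddCommGroup G] (f : G →+ G) (X : AddSubgroup G) : ℕ∞ :=
  ⨅ (k : ℕ) (_ : ∀ m : ℕ, k ≤ m → Set.InjOn f (f^[m] '' (X : Set G))), (k : ℕ∞)

/-- The Igusa-Todorov function `φ`. -/
def phi (M : FGModuleCat.{u} R) : ℕ∞ := fittingIndex (omegaBar R) (addSubgroupOf M)

/-- The `φ`-dimension of a subcategory. -/
def phiDim (D : Set (FGModuleCat.{u} R)) : ℕ∞ := ⨆ M ∈ D, phi M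

/-- `add C`: all modules isomorphic to a finite direct sum of direct summands of modules in `C`. -/
def addClosure (C : Set (FGModuleCat.{u} R)) : Set (FGModuleCat.{u} R) :=
  {M | ∃ (r : ℕ) (N : Fin r → FGModuleCat.{u} R), (∀ i, ∃ X ∈ C, IsSummand (N i) X) ∧
    Nonempty (M ≃ₗ[R] (∀ i, N i))}

/-- `0`-Igusa-Todorov subcategories. -/
structure IsZeroIT (D : Set (FGModuleCat.{u} R)) : Prop where
  add_eq : D = addClosure D
  syzygy_mem : ∀ M ∈ D, syzygy M ∈ D
  phiDim_eq : phiDim D = 0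

/-- The subcategory `C` is `(n, V, D)`-Lat-Igusa-Todorov: `D` is a `0`-Igusa-Todorov subcategory
and each `M` in `C` admits an exact sequence `0 → V₁ ⊕ D₁ → V₀ ⊕ D₀ → Ωⁿ(M) → 0` with `V₀`, `V₁`
in `add V` and `D₀`, `D₁` in `D`. -/
def IsLITWith (n : ℕ) (V : FGModuleCat.{u} R) (D C : Set (FGModuleCat.{u} R)) : Prop :=
  IsZeroIT D ∧ ∀ M ∈ C, ∃ V₁ ∈ addClosure {V}, ∃ V₀ ∈ addClosure {V}, ∃ D₁ ∈ D, ∃ D₀ ∈ D,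
    ∃ (f : (V₁ × D₁) →ₗ[R] (V₀ × D₀)) (g : (V₀ × D₀) →ₗ[R] (syzygy^[n] M : FGModuleCat.{u} R)),
      Function.Injective f ∧ Function.Exact f g ∧ Function.Surjective g

end Phi

/-- The opposite algebra of `R` is `n`-LIT: for some `V` and `D`, the category of all finitely
generated right modules over the opposite algebra (that is, of all finitely generated left
`R`-modules) is `(n, V, D)`-LIT. -/
def IsLITOp (n : ℕ) (R : Type u) [Ring R] [IsArtinianRing R] : Prop :=
  ∃ (V : FGModuleCat.{u} R) (D : Set (FGModuleCat.{u} R)), IsLITWith n V D Set.univ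

/-- The opposite algebra of `R` is `n`-Igusa-Todorov: the case where `D` consists of the zero
modules only. -/
def IsIgusaTodorovOp (n : ℕ) (R : Type u) [Ring R] [IsArtinianRing R] : Prop :=
  ∃ V : FGModuleCat.{u} R, IsLITWith n V {M | Subsingleton M} Set.univ

end IgusaTodorov

end

/-! Put R = A × B and let E be the ideal of C generated by the added arrows. By the relations, an
arrow of Q_A or Q_B vanishes when multiplied on the left of an added arrow, and so does a product of
two added arrows. Hence C = R ⊕ E with E² = 0; as a right R-module E is the direct sum of the
modules ε R ≅ e R, one for each added arrow ε, with e the idempotent of its target; and R acts on ε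
from the left through the character of its source. `SquareZeroData` axiomatises this situation and
`squareZeroData` shows that C is an instance.

All modules are left modules. The induced module C ⊗ X is X ⊕ ⨁ ε ⊗ e X, and its second part is a
semisimple C-module. Two facts follow.

(1) Induction is exact and preserves projective covers, so it commutes with Ω, and X is recovered as
the quotient of C ⊗ X by E. It therefore carries the required exact sequences from R to C. On K₀ it
is injective and commutes with Ω̄, so it also carries 0-Igusa–Todorov subcategories to
0-Igusa–Todorov subcategories (`indClass_isZeroIT`).

(2) Every submodule of an induced module is the direct sum of an induced and a semisimple module
(`exists_equiv_ind_prod`). Projective modules are retracts of induced ones, so each Ω(M) is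
isomorphic to (C ⊗ X) ⊕ S with S semisimple. This is the one extra syzygy in the statement:
Ω^(n+1)(M) ≅ (C ⊗ Ω^n(X)) ⊕ Ω^n(S). The first summand is handled by the n-LIT property of R, the
second lies in add Ω^n(C/J), where J is the Jacobson radical.

That R is n-LIT when A and B are holds because R-modules split into their two factors
(`IsLITWith.of_factors`). The Igusa–Todorov statement is the case where D consists of zero modules,
since both constructions of the new D turn zero classes into the zero class.

The directness of the sum C = R ⊕ E is proved by mapping C to an explicit ring on R ⊕ R^I, where I
is the set of added arrows (`toExt`), and exhibiting a left inverse (`ofExt`). -/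

noncomputable section

namespace IgusaTodorov

/-! ### Projective covers and syzygies -/

section Cover

variable {R : Type u} [Ring R]

/-- Projective covers of a module are unique up to isomorphism. -/
theorem IsProjectiveCover.exists_equiv {P Q M : Type u} [AddCommGroup P] [Module R P]
    [AddCommGroup Q] [Module R Q] [AddCommGroup M] [Module R M] {f : P →ₗ[R] M} {g : Q →ₗ[R] M}
    (hf : IsProjectiveCover f) (hg : IsProjectiveCover g) :
    ∃ e : P ≃ₗ[R] Q, g.comp e.toLinearMap = f := by
  have := hf.1
  have := hg.1
  obtain ⟨s, hs⟩ := Module.projective_lifting_property g f hg.2.1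
  have hs' : ∀ x, g (s x) = f x := LinearMap.congr_fun hs
  have hsurj : Function.Surjective s := by
    rw [← LinearMap.range_eq_top]
    -- The range of s and ker g together span Q, and ker g is superfluous.
    refine hg.2.2 _ (eq_top_iff.mpr fun q _ => ?_)
    obtain ⟨p, hp⟩ := hf.2.1 (g q)
    refine Submodule.mem_sup.mpr ⟨s p, ⟨p, rfl⟩, q - s p, ?_, by abel⟩
    simp [hs', hp]
  -- Since Q is projective, s has a section t. The superfluity of ker f makes t surjective as well,
  -- so s is injective.
  obtain ⟨t, ht⟩ := Module.projective_lifting_property s LinearMap.id hsurj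
  have ht' : ∀ x, s (t x) = x := LinearMap.congr_fun ht
  have htsurj : Function.Surjective t := by
    rw [← LinearMap.range_eq_top]
    refine hf.2.2 _ (eq_top_iff.mpr fun p _ => ?_)
    refine Submodule.mem_sup.mpr ⟨t (s p), ⟨s p, rfl⟩, p - t (s p), ?_, by abel⟩
    rw [LinearMap.mem_ker, map_sub, ← hs', ← hs', ht', sub_self]
  have hinj : Function.Injective s := by
    intro x y hxy
    obtain ⟨x, rfl⟩ := htsurj x
    obtain ⟨y, rfl⟩ := htsurj y
    rw [ht', ht'] at hxy
    rw [hxy]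
  exact ⟨LinearEquiv.ofBijective s ⟨hinj, hsurj⟩, hs⟩

theorem IsProjectiveCover.nonempty_ker_equiv {P Q M : Type u} [AddCommGroup P] [Module R P]
    [AddCommGroup Q] [Module R Q] [AddCommGroup M] [Module R M] {f : P →ₗ[R] M} {g : Q →ₗ[R] M}
    (hf : IsProjectiveCover f) (hg : IsProjectiveCover g) :
    Nonempty (LinearMap.ker f ≃ₗ[R] LinearMap.ker g) := by
  obtain ⟨e, rfl⟩ := hf.exists_equiv hg
  refine ⟨e.ofSubmodules _ _ ?_⟩
  ext x
  constructor
  · rintro ⟨y, hy, rfl⟩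
    exact hy
  · intro hx
    exact ⟨e.symm x, by simpa using hx, by simp⟩

theorem IsProjectiveCover.comp_equiv {P M N : Type u} [AddCommGroup P] [Module R P]
    [AddCommGroup M] [Module R M] [AddCommGroup N] [Module R N] {f : P →ₗ[R] M}
    (hf : IsProjectiveCover f) (e : M ≃ₗ[R] N) : IsProjectiveCover (e.toLinearMap.comp f) := by
  refine ⟨hf.1, e.surjective.comp hf.2.1, fun L hL => hf.2.2 L ?_⟩
  rwa [LinearEquiv.ker_comp] at hL

/-- The preimage of L along i spans P together with K, so it is all of P; then L contains the image
of K, which is thus redundant in the sum. -/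
theorem superfluous_map {P Q : Type u} [AddCommGroup P] [Module R P] [AddCommGroup Q] [Module R Q]
    (i : P →ₗ[R] Q) {K : Submodule R P} (hK : ∀ L, L ⊔ K = ⊤ → L = ⊤)
    (L : Submodule R Q) (hL : L ⊔ K.map i = ⊤) : L = ⊤ := by
  have h : L.comap i = ⊤ := by
    refine hK _ (eq_top_iff.mpr fun x _ => ?_)
    have hx : i x ∈ L ⊔ K.map i := hL ▸ Submodule.mem_top
    obtain ⟨l, hl, _, ⟨y, hy, rfl⟩, hxy⟩ := Submodule.mem_sup.mp hx
    refine Submodule.mem_sup.mpr ⟨x - y, ?_, y, hy, by abel⟩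
    rw [Submodule.mem_comap, map_sub, ← hxy, add_sub_cancel_right]
    exact hl
  have h' : K.map i ≤ L := by
    rintro _ ⟨y, -, rfl⟩
    have : y ∈ L.comap i := h ▸ Submodule.mem_top
    exact this
  rwa [sup_eq_left.mpr h'] at hL

/-- The kernel is the sum of the images of ker f and ker g in P × Q. Each is superfluous by
`superfluous_map`, and they are discarded one after the other. -/
theorem IsProjectiveCover.prodMap {P Q M N : Type u} [AddCommGroup P] [Module R P]
    [AddCommGroup Q] [Module R Q] [AddCommGroup M] [Module R M] [AddCommGroup N] [Module R N]
    {f : P →ₗ[R] M} {g : Q →ₗ[R] N} (hf : IsProjectiveCover f) (hg : IsProjectiveCover g) :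
    IsProjectiveCover (f.prodMap g) := by
  have := hf.1
  have := hg.1
  refine ⟨inferInstance, hf.2.1.prodMap hg.2.1, fun L hL => ?_⟩
  refine superfluous_map (LinearMap.inl R P Q) hf.2.2 L
    (superfluous_map (LinearMap.inr R P Q) hg.2.2 _ ?_)
  rw [eq_top_iff, ← hL, sup_assoc]
  refine sup_le_sup le_rfl ?_
  rintro ⟨x, y⟩ hxy
  have h := (show f x = 0 ∧ g y = 0 by simpa using hxy)
  refine Submodule.mem_sup.mpr ⟨(x, 0), ⟨x, h.1, rfl⟩, (0, y), ⟨y, h.2, rfl⟩, by simp⟩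

variable [IsArtinianRing R]

/-- The module `projCover M` is an arbitrary choice. By uniqueness of covers, Ω(M) can be computed
from whichever cover is at hand. -/
theorem IsProjectiveCover.nonempty_syzygy_equiv {P : Type u} [AddCommGroup P] [Module R P]
    {M : FGModuleCat.{u} R} {f : P →ₗ[R] M} (hf : IsProjectiveCover f) :
    Nonempty (syzygy M ≃ₗ[R] LinearMap.ker f) :=
  (projCoverMap_spec M).nonempty_ker_equiv hf

theorem syzygy_congr {M N : FGModuleCat.{u} R} (e : M ≃ₗ[R] N) :
    Nonempty (syzygy M ≃ₗ[R] syzygy N) := by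
  obtain ⟨d⟩ := ((projCoverMap_spec M).comp_equiv e).nonempty_syzygy_equiv (M := N)
  rw [LinearEquiv.ker_comp] at d
  exact ⟨d.symm⟩

theorem syzygy_prod (M N : FGModuleCat.{u} R) :
    Nonempty (syzygy (FGModuleCat.of R (M × N)) ≃ₗ[R] (syzygy M × syzygy N)) := by
  obtain ⟨d⟩ := ((projCoverMap_spec M).prodMap (projCoverMap_spec N)).nonempty_syzygy_equiv
    (M := FGModuleCat.of R (M × N))
  let c : LinearMap.ker ((projCoverMap M).prodMap (projCoverMap N)) ≃ₗ[R]
      (LinearMap.ker (projCoverMap M) × LinearMap.ker (projCoverMap N)) :=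
    { toFun := fun x => (⟨x.1.1, by have := x.2; simp at this; exact this.1⟩,
        ⟨x.1.2, by have := x.2; simp at this; exact this.2⟩)
      map_add' := fun _ _ => rfl
      map_smul' := fun _ _ => rfl
      invFun := fun x => ⟨(x.1.1, x.2.1), by
        have h1 := x.1.2
        have h2 := x.2.2
        simp only [LinearMap.mem_ker] at h1 h2
        simp⟩
      left_inv := fun _ => rfl
      right_inv := fun _ => rfl }
  exact ⟨d.trans c⟩

theorem syzygy_subsingleton (M : FGModuleCat.{u} R) [Subsingleton M] :
    Subsingleton (syzygy M) := by
  obtain ⟨d⟩ := IsProjectiveCover.nonempty_syzygy_equiv (M := M) (f := LinearMap.id)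
    ⟨Module.Projective.of_free, Function.surjective_id, fun L hL => Subsingleton.elim _ _⟩
  exact d.toEquiv.subsingleton

theorem iterate_syzygy_congr (n : ℕ) {M N : FGModuleCat.{u} R} (e : M ≃ₗ[R] N) :
    Nonempty ((syzygy^[n] M : FGModuleCat.{u} R) ≃ₗ[R] (syzygy^[n] N : FGModuleCat.{u} R)) := by
  induction n generalizing M N with
  | zero => exact ⟨e⟩
  | succ n ih =>
    obtain ⟨d⟩ := syzygy_congr e
    exact ih d

theorem iterate_syzygy_prod (n : ℕ) (M N : FGModuleCat.{u} R) :
    Nonempty ((syzygy^[n] (FGModuleCat.of R (M × N)) : FGModuleCat.{u} R) ≃ₗ[R]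
      ((syzygy^[n] M : FGModuleCat.{u} R) × (syzygy^[n] N : FGModuleCat.{u} R))) := by
  induction n generalizing M N with
  | zero => exact ⟨LinearEquiv.refl _ _⟩
  | succ n ih =>
    obtain ⟨d⟩ := syzygy_prod M N
    obtain ⟨d'⟩ := iterate_syzygy_congr n (N := FGModuleCat.of R (syzygy M × syzygy N)) d
    obtain ⟨d''⟩ := ih (syzygy M) (syzygy N)
    exact ⟨d'.trans d''⟩

theorem iterate_syzygy_subsingleton (n : ℕ) (M : FGModuleCat.{u} R) [Subsingleton M] :
    Subsingleton (syzygy^[n] M : FGModuleCat.{u} R) := by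
  induction n generalizing M with
  | zero => assumption
  | succ n ih =>
    have := syzygy_subsingleton M
    exact ih (syzygy M)

end Cover

/-! ### Direct summands and additive closures -/

section Add

variable {R : Type u} [Ring R]

theorem IsSummand.refl (M : FGModuleCat.{u} R) : IsSummand M M :=
  ⟨FGModuleCat.of R PUnit, ⟨LinearEquiv.prodUnique.symm⟩⟩

theorem IsSummand.of_equiv {M N : FGModuleCat.{u} R} (e : M ≃ₗ[R] N) : IsSummand M N :=
  ⟨FGModuleCat.of R PUnit, ⟨e.symm.trans LinearEquiv.prodUnique.symm⟩⟩

theorem IsSummand.fst (M N : FGModuleCat.{u} R) : IsSummand M (FGModuleCat.of R (M × N)) :=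
  ⟨N, ⟨LinearEquiv.refl _ _⟩⟩

theorem IsSummand.snd (M N : FGModuleCat.{u} R) : IsSummand N (FGModuleCat.of R (M × N)) :=
  ⟨M, ⟨LinearEquiv.prodComm _ _ _⟩⟩

theorem IsSummand.trans {L M N : FGModuleCat.{u} R} (h : IsSummand L M) (h' : IsSummand M N) :
    IsSummand L N := by
  obtain ⟨X, ⟨e⟩⟩ := h
  obtain ⟨Y, ⟨d⟩⟩ := h'
  exact ⟨FGModuleCat.of R (X × Y), ⟨d.trans ((e.prodCongr (LinearEquiv.refl R Y)).trans
    (LinearEquiv.prodAssoc R L X Y))⟩⟩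

/-- A retract is a direct summand. -/
theorem IsSummand.of_retract [IsNoetherianRing R] {N M : FGModuleCat.{u} R} (i : N →ₗ[R] M)
    (p : M →ₗ[R] N) (h : ∀ x, p (i x) = x) : IsSummand N M := by
  refine ⟨FGModuleCat.of R (LinearMap.ker p), ⟨?_⟩⟩
  exact
    { toFun := fun x => (p x, ⟨x - i (p x), by simp [h]⟩)
      map_add' := fun x y => by
        ext <;> simp
        abel
      map_smul' := fun c x => by
        ext <;> simp [smul_sub]
      invFun := fun y => i y.1 + y.2
      left_inv := fun x => by simp
      right_inv := fun y => by
        ext <;> simp [h] }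

theorem IsSummand.exists_retract {N M : FGModuleCat.{u} R} (h : IsSummand N M) :
    ∃ (i : N →ₗ[R] M) (p : M →ₗ[R] N), ∀ x, p (i x) = x := by
  obtain ⟨X, ⟨e⟩⟩ := h
  exact ⟨e.symm.toLinearMap.comp (LinearMap.inl R N X), (LinearMap.fst R N X).comp e.toLinearMap,
    fun x => by simp⟩

variable {C : Set (FGModuleCat.{u} R)}

theorem addClosure_of_subsingleton (M : FGModuleCat.{u} R) [Subsingleton M] :
    M ∈ addClosure C :=
  ⟨0, fun i => i.elim0, fun i => i.elim0, ⟨LinearEquiv.ofSubsingleton _ _⟩⟩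

theorem addClosure_congr {M N : FGModuleCat.{u} R} (e : M ≃ₗ[R] N) (h : M ∈ addClosure C) :
    N ∈ addClosure C := by
  obtain ⟨r, X, hX, ⟨d⟩⟩ := h
  exact ⟨r, X, hX, ⟨e.symm.trans d⟩⟩

/-- The module `∀ i, Fin.cons X Y i` is the direct sum of `X` and the product of the `Y i`. -/
def finConsEquiv {r : ℕ} (X : FGModuleCat.{u} R) (Y : Fin r → FGModuleCat.{u} R) :
    (∀ i : Fin (r + 1), (Fin.cons X Y : Fin (r + 1) → FGModuleCat.{u} R) i) ≃ₗ[R]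
      (X × ∀ i, Y i) where
  toFun f := (f 0, fun i => f i.succ)
  map_add' _ _ := rfl
  map_smul' _ _ := rfl
  invFun p := fun i => Fin.cases (motive := fun i =>
    ((Fin.cons X Y : Fin (r + 1) → FGModuleCat.{u} R) i : Type u)) p.1 p.2 i
  left_inv f := by
    ext i
    refine Fin.cases ?_ (fun j => ?_) i <;> rfl
  right_inv p := rfl

theorem addClosure_cons {M N X : FGModuleCat.{u} R} (hX : ∃ Y ∈ C, IsSummand X Y)
    (hN : N ∈ addClosure C) (e : M ≃ₗ[R] (X × N)) : M ∈ addClosure C := by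
  obtain ⟨r, Y, hY, ⟨d⟩⟩ := hN
  exact ⟨r + 1, Fin.cons X Y, fun i => Fin.cases hX hY i,
    ⟨e.trans (((LinearEquiv.refl R X).prodCongr d).trans (finConsEquiv X Y).symm)⟩⟩

theorem addClosure_of_isSummand {M X : FGModuleCat.{u} R} (hX : X ∈ C) (h : IsSummand M X) :
    M ∈ addClosure C :=
  addClosure_cons ⟨X, hX, h⟩ (addClosure_of_subsingleton (FGModuleCat.of R PUnit))
    LinearEquiv.prodUnique.symm

/-- Induction principle for additive closures. -/
theorem addClosure_induction {motive : FGModuleCat.{u} R → Prop}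
    (zero : ∀ M : FGModuleCat.{u} R, Subsingleton M → motive M)
    (congr : ∀ M N : FGModuleCat.{u} R, (M ≃ₗ[R] N) → motive M → motive N)
    (cons : ∀ X N : FGModuleCat.{u} R, (∃ Y ∈ C, IsSummand X Y) → N ∈ addClosure C → motive N →
      motive (FGModuleCat.of R (X × N)))
    {M : FGModuleCat.{u} R} (hM : M ∈ addClosure C) : motive M := by
  obtain ⟨r, N, hN, ⟨e⟩⟩ := hM
  induction r generalizing M with
  | zero =>
    exact zero M e.toEquiv.subsingleton
  | succ r ih =>
    let d : (∀ i, N i) ≃ₗ[R] (N 0 × ∀ i : Fin r, N i.succ) :=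
      { toFun := fun f => (f 0, fun i => f i.succ)
        map_add' := fun _ _ => rfl
        map_smul' := fun _ _ => rfl
        invFun := fun p i => Fin.cases (motive := fun i => (N i : Type u)) p.1 p.2 i
        left_inv := fun f => by
          ext i
          refine Fin.cases ?_ (fun j => ?_) i <;> rfl
        right_inv := fun p => rfl }
    refine congr _ M (d.symm.trans e.symm) (cons (N 0)
      (FGModuleCat.of R (∀ i : Fin r, N i.succ)) (hN 0) ?_ ?_)
    · exact ⟨r, fun i => N i.succ, fun i => hN i.succ, ⟨LinearEquiv.refl _ _⟩⟩
    · exact ih (fun i => N i.succ) (fun i => hN i.succ) (LinearEquiv.refl _ _)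

theorem addClosure_prod {M N : FGModuleCat.{u} R} (hM : M ∈ addClosure C)
    (hN : N ∈ addClosure C) : FGModuleCat.of R (M × N) ∈ addClosure C := by
  refine addClosure_induction (C := C)
    (motive := fun M => FGModuleCat.of R (M × N) ∈ addClosure C) ?_ ?_ ?_ hM
  · intro M hM
    have : Unique M := ⟨⟨0⟩, fun _ => Subsingleton.elim _ _⟩
    exact addClosure_congr (M := N) LinearEquiv.uniqueProd.symm hN
  · intro M M' e h
    exact addClosure_congr (M := FGModuleCat.of R (M × N)) (e.prodCongr (LinearEquiv.refl R N)) h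
  · intro X M hX _ h
    exact addClosure_cons hX h (LinearEquiv.prodAssoc R X M N)

theorem addClosure_mono {C' : Set (FGModuleCat.{u} R)}
    (h : ∀ X ∈ C, ∃ Y ∈ C', IsSummand X Y) : addClosure C ⊆ addClosure C' := by
  rintro M ⟨r, N, hN, e⟩
  refine ⟨r, N, fun i => ?_, e⟩
  obtain ⟨X, hX, hNX⟩ := hN i
  obtain ⟨Y, hY, hXY⟩ := h X hX
  exact ⟨Y, hY, hNX.trans hXY⟩

/-- A class of modules closed under isomorphisms, direct sums and direct summands is its own
additive closure. -/
theorem eq_addClosure (zero : ∀ M : FGModuleCat.{u} R, Subsingleton M → M ∈ C)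
    (summand : ∀ X Y : FGModuleCat.{u} R, IsSummand X Y → Y ∈ C → X ∈ C)
    (prod : ∀ X Y : FGModuleCat.{u} R, X ∈ C → Y ∈ C → FGModuleCat.of R (X × Y) ∈ C) :
    C = addClosure C := by
  refine Set.Subset.antisymm (fun M hM => addClosure_of_isSummand hM (IsSummand.refl M)) ?_
  intro M hM
  refine addClosure_induction (C := C) zero
    (fun M N e h => summand _ _ (IsSummand.of_equiv e.symm) h) ?_ hM
  rintro X N ⟨Y, hY, hXY⟩ _ hN
  exact prod _ _ (summand _ _ hXY hY) hN

end Add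

/-! ### The subgroups `⟨add M⟩` and the Igusa-Todorov function -/

section Phi

variable {R : Type u} [Ring R]

/-- The zero module is projective and has class zero; adding it as a second summand turns an
isomorphism into a defining relation. -/
theorem cls_congr {M N : FGModuleCat.{u} R} (e : M ≃ₗ[R] N) : cls M = cls N := by
  have h := cls_eq_add (M := M) (M' := N) (M'' := FGModuleCat.of R PUnit)
    (e.trans LinearEquiv.prodUnique.symm)
  rwa [cls_eq_zero (P := FGModuleCat.of R PUnit) Module.Projective.of_free, add_zero] at h

theorem cls_of_subsingleton (M : FGModuleCat.{u} R) [Subsingleton M] : cls M = 0 :=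
  cls_eq_zero Module.Projective.of_free

theorem K0_induction {motive : K0 R → Prop} (x : K0 R)
    (cls : ∀ M, motive (cls M)) (zero : motive 0) (add : ∀ x y, motive x → motive y → motive (x + y))
    (neg : ∀ x, motive x → motive (-x)) : motive x := by
  obtain ⟨x, rfl⟩ := QuotientAddGroup.mk_surjective x
  induction x using FreeAbelianGroup.induction_on with
  | zero => exact zero
  | of M => exact cls M
  | neg M _ => exact neg _ (cls M)
  | add x y hx hy => exact add _ _ hx hy

theorem K0_hom_ext {G : Type*} [AddCommGroup G] {f g : K0 R →+ G} (h : ∀ M, f (cls M) = g (cls M)) :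
    f = g := by
  refine DFunLike.ext _ _ fun x => ?_
  induction x using K0_induction with
  | cls M => exact h M
  | zero => simp
  | add x y hx hy => simp [hx, hy]
  | neg x hx => simp [hx]

/-- The classes of all direct summands of `M` lie in `⟨add M⟩`. -/
theorem cls_mem_addSubgroupOf [IsArtinianRing R] {N M : FGModuleCat.{u} R} (h : IsSummand N M) :
    cls N ∈ addSubgroupOf M := by
  obtain ⟨l, hl⟩ : ∃ l : ℕ, Module.length R N = l :=
    ⟨_, (ENat.natCast_toNat (Module.length_ne_top (R := R) (M := N))).symm⟩
  -- Only indecomposable summands are generators of `addSubgroupOf M`, so a decomposable N is split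
  -- into two nonzero summands, which have smaller length.
  induction l using Nat.strong_induction_on generalizing N with
  | _ l ih =>
    by_cases hN : IsIndecomposable N
    · exact AddSubgroup.subset_closure ⟨N, hN, h, rfl⟩
    · by_cases hs : Subsingleton N
      · rw [cls_of_subsingleton]
        exact zero_mem _
      · rw [not_subsingleton_iff_nontrivial] at hs
        simp only [IsIndecomposable, hs, true_and, not_forall, not_or] at hN
        obtain ⟨X, Y, ⟨e⟩, hX, hY⟩ := hN
        rw [not_subsingleton_iff_nontrivial] at hX hY
        have hlen : Module.length R X + Module.length R Y = l := by
          rw [← hl, e.length_eq, Module.length_prod]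
        have hX' := Module.length_pos_iff (R := R) (M := X) |>.mpr hX
        have hY' := Module.length_pos_iff (R := R) (M := Y) |>.mpr hY
        obtain ⟨a, ha⟩ : ∃ a : ℕ, Module.length R X = a :=
          ⟨_, (ENat.natCast_toNat (Module.length_ne_top (R := R) (M := X))).symm⟩
        obtain ⟨b, hb⟩ : ∃ b : ℕ, Module.length R Y = b :=
          ⟨_, (ENat.natCast_toNat (Module.length_ne_top (R := R) (M := Y))).symm⟩
        rw [ha] at hX'
        rw [hb] at hY'
        rw [ha, hb] at hlen
        norm_cast at hX' hY' hlen
        rw [cls_eq_add e]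
        exact add_mem (ih a (by omega) (IsSummand.trans ⟨Y, ⟨e⟩⟩ h) ha)
          (ih b (by omega) (IsSummand.trans ⟨X, ⟨e.trans (LinearEquiv.prodComm R X Y)⟩⟩ h) hb)

/-- A failure of injectivity at some m excludes k = 0 from the infimum, which is then at least 1. -/
theorem fittingIndex_eq_zero_iff {G : Type*} [AddCommGroup G] (f : G →+ G) (X : AddSubgroup G) :
    fittingIndex f X = 0 ↔ ∀ m : ℕ, Set.InjOn f (f^[m] '' (X : Set G)) := by
  constructor
  · intro h m
    by_contra hm
    have h1 : (1 : ℕ∞) ≤ fittingIndex f X := by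
      refine le_iInf₂ fun k hk => ?_
      rcases k with _ | k
      · exact absurd (hk m (Nat.zero_le m)) hm
      · exact_mod_cast Nat.succ_le_succ (Nat.zero_le k)
    rw [h] at h1
    exact absurd h1 (by simp)
  · intro h
    exact le_antisymm (iInf₂_le 0 fun m _ => h m) zero_le

variable [IsArtinianRing R]

theorem omegaBar_cls (M : FGModuleCat.{u} R) : omegaBar R (cls M) = cls (syzygy M) :=
  FreeAbelianGroup.lift_apply_of _ _

theorem phi_eq_zero_iff (M : FGModuleCat.{u} R) : phi M = 0 ↔
    ∀ m : ℕ, Set.InjOn (omegaBar R) ((omegaBar R)^[m] '' (addSubgroupOf M : Set (K0 R))) :=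
  fittingIndex_eq_zero_iff _ _

theorem phiDim_eq_zero_iff (D : Set (FGModuleCat.{u} R)) :
    phiDim D = 0 ↔ ∀ M ∈ D, phi M = 0 := by
  simp [phiDim]

variable {D : Set (FGModuleCat.{u} R)}

theorem IsZeroIT.of_subsingleton (hD : IsZeroIT D) (M : FGModuleCat.{u} R) [Subsingleton M] :
    M ∈ D := by
  rw [hD.add_eq]
  exact addClosure_of_subsingleton M

theorem IsZeroIT.prod (hD : IsZeroIT D) {M N : FGModuleCat.{u} R} (hM : M ∈ D) (hN : N ∈ D) :
    FGModuleCat.of R (M × N) ∈ D := by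
  rw [hD.add_eq] at hM hN ⊢
  exact addClosure_prod hM hN

theorem IsZeroIT.of_isSummand (hD : IsZeroIT D) {M N : FGModuleCat.{u} R} (h : IsSummand M N)
    (hN : N ∈ D) : M ∈ D := by
  rw [hD.add_eq]
  exact addClosure_of_isSummand hN h

theorem IsZeroIT.congr (hD : IsZeroIT D) {M N : FGModuleCat.{u} R} (e : M ≃ₗ[R] N) (hM : M ∈ D) :
    N ∈ D :=
  hD.of_isSummand (IsSummand.of_equiv e.symm) hM

theorem IsZeroIT.injOn (hD : IsZeroIT D) {M : FGModuleCat.{u} R} (hM : M ∈ D) (m : ℕ) :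
    Set.InjOn (omegaBar R) ((omegaBar R)^[m] '' (addSubgroupOf M : Set (K0 R))) :=
  (phi_eq_zero_iff M).mp ((phiDim_eq_zero_iff D).mp hD.phiDim_eq M hM) m

theorem iterate_syzygy_mem_addClosure (n : ℕ) {V M : FGModuleCat.{u} R}
    (hM : M ∈ addClosure {V}) : syzygy^[n] M ∈ addClosure {syzygy^[n] V} := by
  refine addClosure_induction (C := {V})
    (motive := fun M => syzygy^[n] M ∈ addClosure {syzygy^[n] V}) ?_ ?_ ?_ hM
  · intro M hM
    have := iterate_syzygy_subsingleton n M
    exact addClosure_of_subsingleton _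
  · intro M N e h
    obtain ⟨d⟩ := iterate_syzygy_congr n e
    exact addClosure_congr d h
  · rintro X N ⟨Y, rfl, Z, ⟨e⟩⟩ _ hN
    obtain ⟨d⟩ := iterate_syzygy_prod n X N
    refine addClosure_cons ⟨_, rfl, ?_⟩ hN d
    obtain ⟨d₁⟩ := iterate_syzygy_congr n (N := FGModuleCat.of R (X × Z)) e
    obtain ⟨d₂⟩ := iterate_syzygy_prod n X Z
    exact ⟨_, ⟨d₁.trans d₂⟩⟩

end Phi

/-! ### Additive functors between categories of finitely generated modules -/

/-- Additive functors between categories of finitely generated modules. -/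
structure ModFunctor (R S : Type u) [Ring R] [Ring S] where
  obj : FGModuleCat.{u} R → FGModuleCat.{u} S
  map : ∀ {M N : FGModuleCat.{u} R}, (M →ₗ[R] N) → (obj M →ₗ[S] obj N)
  map_id : ∀ M : FGModuleCat.{u} R, map (LinearMap.id : M →ₗ[R] M) = LinearMap.id
  map_comp : ∀ {L M N : FGModuleCat.{u} R} (g : M →ₗ[R] N) (f : L →ₗ[R] M),
    map (g.comp f) = (map g).comp (map f)
  map_add : ∀ {M N : FGModuleCat.{u} R} (f g : M →ₗ[R] N), map (f + g) = map f + map g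

namespace ModFunctor

section General

variable {R S : Type u} [Ring R] [Ring S] (F : ModFunctor R S)

theorem map_zero (M N : FGModuleCat.{u} R) : F.map (0 : M →ₗ[R] N) = 0 := by
  have h := F.map_add (0 : M →ₗ[R] N) 0
  rwa [add_zero, left_eq_add] at h

theorem map_map {L M N : FGModuleCat.{u} R} (g : M →ₗ[R] N) (f : L →ₗ[R] M) (x : F.obj L) :
    F.map g (F.map f x) = F.map (g.comp f) x := by
  rw [F.map_comp, LinearMap.comp_apply]

/-- The action of a functor on isomorphisms. -/
def mapEquiv {M N : FGModuleCat.{u} R} (e : M ≃ₗ[R] N) : F.obj M ≃ₗ[S] F.obj N :=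
  LinearEquiv.ofLinearMap (F.map e.toLinearMap) (F.map e.symm.toLinearMap)
    (by rw [← F.map_comp, LinearEquiv.comp_symm, F.map_id])
    (by rw [← F.map_comp, LinearEquiv.symm_comp, F.map_id])

/-- Additive functors preserve binary direct sums. -/
def prodEquiv (M N : FGModuleCat.{u} R) :
    F.obj (FGModuleCat.of R (M × N)) ≃ₗ[S] (F.obj M × F.obj N) := by
  let p₁ : FGModuleCat.of R (M × N) →ₗ[R] M := LinearMap.fst R M N
  let p₂ : FGModuleCat.of R (M × N) →ₗ[R] N := LinearMap.snd R M N
  let i₁ : M →ₗ[R] FGModuleCat.of R (M × N) := LinearMap.inl R M N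
  let i₂ : N →ₗ[R] FGModuleCat.of R (M × N) := LinearMap.inr R M N
  refine LinearEquiv.ofLinearMap ((F.map p₁).prod (F.map p₂)) ((F.map i₁).coprod (F.map i₂)) ?_ ?_
  · have h₁₁ : p₁.comp i₁ = LinearMap.id := rfl
    have h₁₂ : p₁.comp i₂ = 0 := rfl
    have h₂₁ : p₂.comp i₁ = 0 := rfl
    have h₂₂ : p₂.comp i₂ = LinearMap.id := rfl
    refine LinearMap.ext fun x => Prod.ext ?_ ?_
    · simp [F.map_map, h₁₁, h₁₂, F.map_id, F.map_zero]
    · simp [F.map_map, h₂₁, h₂₂, F.map_id, F.map_zero]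
  · have h : i₁.comp p₁ + i₂.comp p₂ = LinearMap.id :=
      LinearMap.ext fun x => Prod.ext (add_zero x.1) (zero_add x.2)
    refine LinearMap.ext fun x => ?_
    change F.map i₁ (F.map p₁ x) + F.map i₂ (F.map p₂ x) = x
    rw [F.map_map, F.map_map, ← LinearMap.add_apply, ← F.map_add, h, F.map_id, LinearMap.id_apply]

theorem obj_subsingleton (M : FGModuleCat.{u} R) [Subsingleton M] : Subsingleton (F.obj M) := by
  have h : (LinearMap.id : M →ₗ[R] M) = 0 := Subsingleton.elim _ _
  have h' := F.map_id M
  rw [h, F.map_zero] at h'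
  refine ⟨fun x y => ?_⟩
  have hx := LinearMap.congr_fun h' x
  have hy := LinearMap.congr_fun h' y
  exact hx.symm.trans hy

theorem isSummand_obj {M N : FGModuleCat.{u} R} (h : IsSummand M N) :
    IsSummand (F.obj M) (F.obj N) := by
  obtain ⟨X, ⟨e⟩⟩ := h
  exact ⟨F.obj X, ⟨(F.mapEquiv (N := FGModuleCat.of R (M × X)) e).trans (F.prodEquiv M X)⟩⟩

theorem obj_mem_addClosure {V M : FGModuleCat.{u} R} (h : M ∈ addClosure {V}) :
    F.obj M ∈ addClosure {F.obj V} := by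
  refine addClosure_induction (C := {V})
    (motive := fun M => F.obj M ∈ addClosure {F.obj V}) ?_ ?_ ?_ h
  · intro M hM
    have := F.obj_subsingleton M
    exact addClosure_of_subsingleton _
  · intro M N e h
    exact addClosure_congr (F.mapEquiv e) h
  · rintro X N ⟨Y, rfl, hX⟩ _ hN
    exact addClosure_cons ⟨_, rfl, F.isSummand_obj hX⟩ hN (F.prodEquiv X N)

/-- Exact functors. -/
structure IsExact : Prop where
  injective : ∀ {M N : FGModuleCat.{u} R} (f : M →ₗ[R] N), Function.Injective f →
    Function.Injective (F.map f)
  exact : ∀ {L M N : FGModuleCat.{u} R} (f : L →ₗ[R] M) (g : M →ₗ[R] N), Function.Exact f g →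
    Function.Exact (F.map f) (F.map g)
  surjective : ∀ {M N : FGModuleCat.{u} R} (f : M →ₗ[R] N), Function.Surjective f →
    Function.Surjective (F.map f)

/-- Functors preserving projective modules. -/
def PreservesProjective : Prop :=
  ∀ P : FGModuleCat.{u} R, Module.Projective R P → Module.Projective S (F.obj P)

/-- Functors preserving projective covers. -/
def PreservesCover : Prop :=
  ∀ ⦃P M : FGModuleCat.{u} R⦄ (f : P →ₗ[R] M), IsProjectiveCover f → IsProjectiveCover (F.map f)

variable {F}

/-- The homomorphism of groups `K₀` induced by a functor preserving projective modules. -/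
def K0map (hF : F.PreservesProjective) : K0 R →+ K0 S :=
  QuotientAddGroup.lift _ (FreeAbelianGroup.lift fun M => cls (F.obj M)) <| by
    rw [AddSubgroup.closure_le]
    rintro x (⟨M, M', M'', ⟨e⟩, rfl⟩ | ⟨P, hP, rfl⟩)
    · have h : cls (F.obj M) = cls (F.obj M') + cls (F.obj M'') :=
        cls_eq_add ((F.mapEquiv (N := FGModuleCat.of R (M' × M'')) e).trans (F.prodEquiv M' M''))
      simp [h]
    · simp [cls_eq_zero (hF P hP)]

theorem K0map_cls (hF : F.PreservesProjective) (M : FGModuleCat.{u} R) :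
    K0map hF (cls M) = cls (F.obj M) :=
  FreeAbelianGroup.lift_apply_of _ _

/-- The identity of a projective module is a projective cover, its kernel being zero. -/
theorem PreservesCover.preservesProjective [IsArtinianRing R] (hF : F.PreservesCover) :
    F.PreservesProjective := fun P hP =>
  (hF (LinearMap.id : P →ₗ[R] P) ⟨hP, Function.surjective_id, fun L hL => by
    simpa using hL⟩).1

/-- A functor need not preserve indecomposability, so the image of a generator is the class of a
possibly decomposable summand. This is why `cls_mem_addSubgroupOf` is stated for all summands. -/
theorem K0map_mem_addSubgroupOf [IsArtinianRing S] (hF : F.PreservesProjective) {M : FGModuleCat.{u} R}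
    {x : K0 R}
    (hx : x ∈ addSubgroupOf M) : K0map hF x ∈ addSubgroupOf (F.obj M) := by
  refine (AddSubgroup.closure_le ((addSubgroupOf (F.obj M)).comap (K0map hF))).mpr ?_ hx
  rintro _ ⟨N, -, hN, rfl⟩
  change K0map hF (cls N) ∈ addSubgroupOf (F.obj M)
  rw [K0map_cls]
  exact cls_mem_addSubgroupOf (F.isSummand_obj hN)

variable [IsArtinianRing R] [IsArtinianRing S]

/-- The functor turns the cover of M into a cover of its image, and by exactness the kernel of the
latter is the image of Ω(M). -/
theorem PreservesCover.nonempty_syzygy_equiv (hF : F.PreservesCover) (hE : F.IsExact)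
    (M : FGModuleCat.{u} R) : Nonempty (syzygy (F.obj M) ≃ₗ[S] F.obj (syzygy M)) := by
  obtain ⟨e⟩ := (hF _ (projCoverMap_spec M)).nonempty_syzygy_equiv
  let i : syzygy M →ₗ[R] projCover M := (LinearMap.ker (projCoverMap M)).subtype
  have hi : Function.Injective i := Subtype.val_injective
  have hex : Function.Exact i (projCoverMap M) := fun x =>
    ⟨fun hx => ⟨⟨x, hx⟩, rfl⟩, by rintro ⟨y, rfl⟩; exact y.2⟩
  have hex' := hE.exact i _ hex
  rw [LinearMap.exact_iff] at hex'
  exact ⟨e.trans ((LinearEquiv.ofEq _ _ hex').trans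
    (LinearEquiv.ofInjective (F.map i) (hE.injective i hi)).symm)⟩

theorem PreservesCover.nonempty_iterate_syzygy_equiv (hF : F.PreservesCover) (hE : F.IsExact)
    (n : ℕ) (M : FGModuleCat.{u} R) : Nonempty ((syzygy^[n] (F.obj M) : FGModuleCat.{u} S) ≃ₗ[S]
      F.obj (syzygy^[n] M)) := by
  induction n generalizing M with
  | zero => exact ⟨LinearEquiv.refl _ _⟩
  | succ n ih =>
    obtain ⟨e⟩ := hF.nonempty_syzygy_equiv hE M
    obtain ⟨e'⟩ := iterate_syzygy_congr n e
    obtain ⟨e''⟩ := ih (syzygy M)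
    exact ⟨e'.trans e''⟩

theorem PreservesCover.K0map_omegaBar (hF : F.PreservesCover) (hE : F.IsExact) (x : K0 R) :
    K0map hF.preservesProjective (omegaBar R x) = omegaBar S (K0map hF.preservesProjective x) := by
  refine DFunLike.congr_fun (f := (K0map hF.preservesProjective).comp (omegaBar R))
    (g := (omegaBar S).comp (K0map hF.preservesProjective)) (K0_hom_ext fun M => ?_) x
  obtain ⟨e⟩ := hF.nonempty_syzygy_equiv hE M
  rw [AddMonoidHom.comp_apply, AddMonoidHom.comp_apply, omegaBar_cls, K0map_cls, K0map_cls,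
    omegaBar_cls, cls_congr e]

theorem PreservesCover.K0map_iterate_omegaBar (hF : F.PreservesCover) (hE : F.IsExact) (m : ℕ)
    (x : K0 R) : K0map hF.preservesProjective ((omegaBar R)^[m] x) =
      (omegaBar S)^[m] (K0map hF.preservesProjective x) :=
  Function.Semiconj.iterate_right (hF.K0map_omegaBar hE) m x

end General

end ModFunctor

/-! ### Modules presented by add V and D -/

section Presentation

variable {R : Type u} [Ring R]

/-- A module `Z` admits an exact sequence `0 → V₁ ⊕ D₁ → V₀ ⊕ D₀ → Z → 0` with `V₀`, `V₁` in
`add V` and `D₀`, `D₁` in `D`. -/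
def IsLITPresented (V : FGModuleCat.{u} R) (D : Set (FGModuleCat.{u} R)) (Z : FGModuleCat.{u} R) :
    Prop :=
  ∃ V₁ ∈ addClosure {V}, ∃ V₀ ∈ addClosure {V}, ∃ D₁ ∈ D, ∃ D₀ ∈ D,
    ∃ (f : (V₁ × D₁) →ₗ[R] (V₀ × D₀)) (g : (V₀ × D₀) →ₗ[R] Z),
      Function.Injective f ∧ Function.Exact f g ∧ Function.Surjective g

variable {V : FGModuleCat.{u} R} {D : Set (FGModuleCat.{u} R)}

theorem IsLITPresented.congr {Z Z' : FGModuleCat.{u} R} (h : IsLITPresented V D Z)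
    (e : Z ≃ₗ[R] Z') : IsLITPresented V D Z' := by
  obtain ⟨V₁, hV₁, V₀, hV₀, D₁, hD₁, D₀, hD₀, f, g, hf, hfg, hg⟩ := h
  refine ⟨V₁, hV₁, V₀, hV₀, D₁, hD₁, D₀, hD₀, f, e.toLinearMap.comp g, hf, fun x => ?_,
    e.surjective.comp hg⟩
  rw [← hfg x]
  simp

theorem IsLITPresented.map {S : Type u} [Ring S] {F : ModFunctor R S} (hF : F.IsExact)
    {V' : FGModuleCat.{u} S} {D' : Set (FGModuleCat.{u} S)} (hV : IsSummand (F.obj V) V')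
    (hD : ∀ X ∈ D, F.obj X ∈ D') {Z : FGModuleCat.{u} R} (h : IsLITPresented V D Z) :
    IsLITPresented V' D' (F.obj Z) := by
  obtain ⟨V₁, hV₁, V₀, hV₀, D₁, hD₁, D₀, hD₀, f, g, hf, hfg, hg⟩ := h
  have hadd : ∀ X ∈ addClosure {V}, F.obj X ∈ addClosure {V'} := fun X hX =>
    addClosure_mono (by rintro _ rfl; exact ⟨V', rfl, hV⟩) (F.obj_mem_addClosure hX)
  let f' : FGModuleCat.of R (V₁ × D₁) →ₗ[R] FGModuleCat.of R (V₀ × D₀) := f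
  let g' : FGModuleCat.of R (V₀ × D₀) →ₗ[R] Z := g
  let e₁ := F.prodEquiv V₁ D₁
  let e₀ := F.prodEquiv V₀ D₀
  refine ⟨_, hadd V₁ hV₁, _, hadd V₀ hV₀, _, hD D₁ hD₁, _, hD D₀ hD₀,
    e₀.toLinearMap.comp ((F.map f').comp e₁.symm.toLinearMap),
    (F.map g').comp e₀.symm.toLinearMap,
    e₀.injective.comp ((hF.injective f' hf).comp e₁.symm.injective), fun x => ?_,
    (hF.surjective g' hg).comp e₀.symm.surjective⟩
  obtain ⟨x, rfl⟩ := e₀.surjective x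
  have := hF.exact f' g' hfg x
  simp only [LinearMap.comp_apply, LinearEquiv.coe_coe, LinearEquiv.symm_apply_apply, this,
    Set.mem_range, EmbeddingLike.apply_eq_iff_eq]
  constructor
  · rintro ⟨y, rfl⟩
    exact ⟨e₁ y, by simp⟩
  · rintro ⟨y, rfl⟩
    exact ⟨_, rfl⟩

/-- The interchange of factors in a direct sum of four modules. -/
def prodProdProdComm (V D W E : Type u) [AddCommGroup V] [Module R V] [AddCommGroup D] [Module R D]
    [AddCommGroup W] [Module R W] [AddCommGroup E] [Module R E] :
    ((V × W) × (D × E)) ≃ₗ[R] ((V × D) × (W × E)) where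
  toFun x := ((x.1.1, x.2.1), (x.1.2, x.2.2))
  map_add' _ _ := rfl
  map_smul' _ _ := rfl
  invFun x := ((x.1.1, x.2.1), (x.1.2, x.2.2))
  left_inv _ := rfl
  right_inv _ := rfl

theorem IsLITPresented.prod
    (hD : ∀ X Y : FGModuleCat.{u} R, X ∈ D → Y ∈ D → FGModuleCat.of R (X × Y) ∈ D)
    {Z Z' : FGModuleCat.{u} R} (h : IsLITPresented V D Z) (h' : IsLITPresented V D Z') :
    IsLITPresented V D (FGModuleCat.of R (Z × Z')) := by
  obtain ⟨V₁, hV₁, V₀, hV₀, D₁, hD₁, D₀, hD₀, f, g, hf, hfg, hg⟩ := h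
  obtain ⟨W₁, hW₁, W₀, hW₀, E₁, hE₁, E₀, hE₀, f', g', hf', hfg', hg'⟩ := h'
  let e₁ := prodProdProdComm (R := R) V₁ D₁ W₁ E₁
  let e₀ := prodProdProdComm (R := R) V₀ D₀ W₀ E₀
  refine ⟨_, addClosure_prod hV₁ hW₁, _, addClosure_prod hV₀ hW₀, _, hD _ _ hD₁ hE₁, _,
    hD _ _ hD₀ hE₀, e₀.symm.toLinearMap.comp ((f.prodMap f').comp e₁.toLinearMap),
    (g.prodMap g').comp e₀.toLinearMap,
    e₀.symm.injective.comp ((hf.prodMap hf').comp e₁.injective), ?_,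
    (hg.prodMap hg').comp e₀.surjective⟩
  rintro ⟨⟨v, w⟩, ⟨d, e⟩⟩
  constructor
  · intro hx
    obtain ⟨y, hy⟩ := (hfg (v, d)).mp (congrArg Prod.fst hx)
    obtain ⟨z, hz⟩ := (hfg' (w, e)).mp (congrArg Prod.snd hx)
    refine ⟨e₁.symm (y, z), e₀.injective (Prod.ext ?_ ?_)⟩
    · exact hy
    · exact hz
  · rintro ⟨y, hy⟩
    rw [← hy]
    exact Prod.ext (hfg.apply_apply_eq_zero _) (hfg'.apply_apply_eq_zero _)

theorem IsLITPresented.of_mem_addClosure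
    (hD : ∀ X : FGModuleCat.{u} R, Subsingleton X → X ∈ D) {Z : FGModuleCat.{u} R}
    (hZ : Z ∈ addClosure {V}) : IsLITPresented V D Z := by
  refine ⟨FGModuleCat.of R PUnit, addClosure_of_subsingleton _, Z, hZ, FGModuleCat.of R PUnit,
    hD _ inferInstance, FGModuleCat.of R PUnit, hD _ inferInstance, 0,
    LinearMap.fst R Z PUnit.{u + 1},
    fun x y _ => Subsingleton.elim _ _, fun x => ⟨fun hx => ⟨0, ?_⟩, ?_⟩,
    Prod.fst_surjective⟩
  · exact Prod.ext hx.symm rfl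
  · rintro ⟨y, rfl⟩
    rfl

end Presentation

/-! ### Products of rings -/

/-- The ring `A` as a direct factor of the ring `R`: a projection `p` and a section `s` of `p` such
that `s 1` is a central idempotent of `R` with `s (p r) = s 1 * r`. -/
structure RingFactor (A R : Type u) [Ring A] [Ring R] where
  p : R →+* A
  s : A →ₙ+* R
  p_s : ∀ a, p (s a) = a
  s_p_left : ∀ r, s (p r) = s 1 * r
  s_p_right : ∀ r, s (p r) = r * s 1

/-- Restriction of scalars: the underlying type. -/
def Restrict {A R : Type u} [Ring A] [Ring R] (_p : R →+* A) (X : Type u) : Type u := X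

section Restrict

variable {A R : Type u} [Ring A] [Ring R] (p : R →+* A) (X : Type u) [AddCommGroup X] [Module A X]

instance : AddCommGroup (Restrict p X) := inferInstanceAs (AddCommGroup X)

instance : Module R (Restrict p X) := Module.compHom X p

/-- The identity map from a module to its restriction of scalars. -/
def toRestrict : X ≃+ Restrict p X := AddEquiv.refl X

variable {X}

theorem smul_toRestrict (r : R) (x : X) : r • toRestrict p X x = toRestrict p X (p r • x) := rfl

theorem toRestrict_symm_smul (r : R) (x : Restrict p X) :
    (toRestrict p X).symm (r • x) = p r • (toRestrict p X).symm x := rfl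

end Restrict

namespace RingFactor

variable {A R : Type u} [Ring A] [Ring R] (c : RingFactor A R)

theorem p_surjective : Function.Surjective c.p := fun a => ⟨c.s a, c.p_s a⟩

theorem s_one_mul_s (a : A) : c.s 1 * c.s a = c.s a := by rw [← map_mul, one_mul]

theorem s_mul_s_one (a : A) : c.s a * c.s 1 = c.s a := by rw [← map_mul, mul_one]

section Corner

variable (Z : Type u) [AddCommGroup Z] [Module R Z]

/-- The direct factor of a module corresponding to a direct factor of the ring. -/
def Corner : Type u := {z : Z // c.s 1 • z = z}

instance : AddCommGroup (c.Corner Z) :=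
  inferInstanceAs (AddCommGroup
    ({ carrier := {z : Z | c.s 1 • z = z}
       add_mem' := fun {a b} (ha : c.s 1 • a = a) (hb : c.s 1 • b = b) => by
        change c.s 1 • (a + b) = a + b
        rw [smul_add, ha, hb]
       zero_mem' := smul_zero _
       neg_mem' := fun {a} (ha : c.s 1 • a = a) => by
        change c.s 1 • (-a) = -a
        rw [smul_neg, ha] } : AddSubgroup Z))

instance : Module A (c.Corner Z) where
  smul a z := ⟨c.s a • z.1, by rw [smul_smul, c.s_one_mul_s]⟩
  one_smul z := Subtype.ext z.2
  mul_smul a b z := Subtype.ext (by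
    change c.s (a * b) • z.1 = c.s a • c.s b • z.1
    rw [map_mul, mul_smul])
  smul_zero a := Subtype.ext (smul_zero (c.s a))
  smul_add a x y := Subtype.ext (smul_add (c.s a) x.1 y.1)
  add_smul a b x := Subtype.ext (by
    change c.s (a + b) • x.1 = c.s a • x.1 + c.s b • x.1
    rw [map_add, add_smul])
  zero_smul x := Subtype.ext (by
    change c.s 0 • x.1 = 0
    rw [_root_.map_zero, zero_smul])

variable {Z}

theorem Corner.add_val (x y : c.Corner Z) : (x + y).1 = x.1 + y.1 := rfl

theorem Corner.smul_val (a : A) (x : c.Corner Z) : (a • x).1 = c.s a • x.1 := rfl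

theorem s_p_smul (r : R) (z : c.Corner Z) : c.s (c.p r) • z.1 = r • z.1 := by
  rw [c.s_p_right, mul_smul, z.2]

variable (Z) in
/-- The projection of a module to a direct factor. -/
def toCorner : Z →ₗ[R] Restrict c.p (c.Corner Z) where
  toFun z := toRestrict c.p _ ⟨c.s 1 • z, by rw [smul_smul, c.s_one_mul_s]⟩
  map_add' x y := Subtype.ext (smul_add _ x y)
  map_smul' r x := Subtype.ext (by
    change c.s 1 • r • x = c.s (c.p r) • c.s 1 • x
    rw [smul_smul, smul_smul, c.s_mul_s_one, c.s_p_left])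

theorem toCorner_val (z : c.Corner Z) : c.toCorner Z z.1 = toRestrict c.p _ z :=
  Subtype.ext z.2

/-- The action of `Corner` on linear maps. -/
def mapCorner {Z W : Type u} [AddCommGroup Z] [Module R Z] [AddCommGroup W] [Module R W]
    (f : Z →ₗ[R] W) : c.Corner Z →ₗ[A] c.Corner W where
  toFun z := ⟨f z.1, by rw [← map_smul, z.2]⟩
  map_add' x y := Subtype.ext (map_add f x.1 y.1)
  map_smul' a x := Subtype.ext (map_smul f (c.s a) x.1)

instance [Module.Finite R Z] : Module.Finite A (c.Corner Z) := by
  have : RingHomSurjective c.p := ⟨c.p_surjective⟩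
  let f : Z →ₛₗ[c.p] c.Corner Z :=
    { toFun := fun z => (toRestrict c.p _).symm (c.toCorner Z z)
      map_add' := fun x y => by rw [map_add, map_add]
      map_smul' := fun r x => by rw [map_smul, toRestrict_symm_smul] }
  exact Module.Finite.of_surjective f fun z => ⟨z.1, by
    change (toRestrict c.p _).symm (c.toCorner Z z.1) = z
    rw [toCorner_val, AddEquiv.symm_apply_apply]⟩

end Corner

instance (X : Type u) [AddCommGroup X] [Module A X] [Module.Finite A X] :
    Module.Finite R (Restrict c.p X) := by
  obtain ⟨s, hs⟩ := Module.Finite.fg_top (R := A) (M := X)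
  refine ⟨⟨s.map (toRestrict c.p X).toEquiv.toEmbedding, ?_⟩⟩
  rw [eq_top_iff]
  intro x h
  clear h
  obtain ⟨x, rfl⟩ := (toRestrict c.p X).surjective x
  have hx : x ∈ Submodule.span A (s : Set X) := hs ▸ Submodule.mem_top
  induction hx using Submodule.span_induction with
  | mem x hx => exact Submodule.subset_span (by simpa using hx)
  | zero => simp
  | add x y _ _ hx hy => rw [map_add]; exact add_mem hx hy
  | smul a x _ hx =>
    have := Submodule.smul_mem _ (c.s a) hx
    rwa [smul_toRestrict, c.p_s] at this

/-- The functor `Z ↦ e Z`. -/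
def corner : ModFunctor R A where
  obj Z := FGModuleCat.of A (c.Corner Z)
  map f := c.mapCorner f
  map_id _ := rfl
  map_comp _ _ := rfl
  map_add _ _ := rfl

/-- Restriction of scalars along the projection to a direct factor. -/
def restrict : ModFunctor A R where
  obj X := FGModuleCat.of R (Restrict c.p X)
  map {X Y} f :=
    { toFun := fun x => toRestrict c.p Y (f ((toRestrict c.p X).symm x))
      map_add' := fun _ _ => map_add f _ _
      map_smul' := fun r _ => map_smul f (c.p r) _ }
  map_id _ := rfl
  map_comp _ _ := rfl
  map_add _ _ := rfl

theorem mapCorner_surjective {P M : Type u} [AddCommGroup P] [Module R P] [AddCommGroup M]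
    [Module R M] {f : P →ₗ[R] M} (hf : Function.Surjective f) :
    Function.Surjective (c.mapCorner f) := by
  intro z
  obtain ⟨y, hy⟩ := hf z.1
  refine ⟨⟨c.s 1 • y, by rw [smul_smul, c.s_one_mul_s]⟩, Subtype.ext ?_⟩
  change f (c.s 1 • y) = z.1
  rw [map_smul, hy, z.2]

theorem corner_isExact : c.corner.IsExact where
  injective f hf x y h := Subtype.ext (hf (congrArg Subtype.val h))
  exact f g h z := by
    constructor
    · intro hz
      obtain ⟨y, hy⟩ := (h z.1).mp (congrArg Subtype.val hz)
      refine ⟨⟨c.s 1 • y, by rw [smul_smul, c.s_one_mul_s]⟩, Subtype.ext ?_⟩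
      change f (c.s 1 • y) = z.1
      rw [map_smul, hy, z.2]
    · rintro ⟨y, rfl⟩
      exact Subtype.ext (h.apply_apply_eq_zero y.1)
  surjective _ hf := c.mapCorner_surjective hf

/-- Taking corners is left adjoint to restriction along `c.p`, which preserves surjections.
Concretely, a surjection onto the corner is viewed over R, `toCorner P` is lifted through it, and
the lift is restricted to the corner. -/
theorem corner_projective {P : Type u} [AddCommGroup P] [Module R P] [Module.Projective R P] :
    Module.Projective A (c.Corner P) := by
  refine Module.Projective.of_lifting_property'' fun g hg => ?_
  let g' : Restrict c.p (c.Corner P →₀ A) →ₗ[R] Restrict c.p (c.Corner P) :=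
    { toFun := fun x => toRestrict c.p _ (g ((toRestrict c.p _).symm x))
      map_add' := fun x y => map_add g _ _
      map_smul' := fun r x => map_smul g (c.p r) _ }
  obtain ⟨h, hh⟩ := Module.projective_lifting_property g' (c.toCorner P) hg
  refine ⟨
    { toFun := fun z => (toRestrict c.p _).symm (h z.1)
      map_add' := fun x y => by rw [Corner.add_val, map_add, map_add]
      map_smul' := fun a x => by
        rw [Corner.smul_val, map_smul, toRestrict_symm_smul, c.p_s]; rfl }, ?_⟩
  refine LinearMap.ext fun z => ?_
  have := LinearMap.congr_fun hh z.1
  rw [toCorner_val] at this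
  exact this

/-- A submodule L of the corner is tested through its preimage L' in P: if L spans the corner
together with the kernel of the induced map, then L' spans P together with ker f. -/
theorem mapCorner_isProjectiveCover {P M : Type u} [AddCommGroup P] [Module R P] [AddCommGroup M]
    [Module R M] {f : P →ₗ[R] M} (hf : IsProjectiveCover f) :
    IsProjectiveCover (c.mapCorner f) := by
  have := hf.1
  refine ⟨c.corner_projective, c.mapCorner_surjective hf.2.1, fun L hL => ?_⟩
  let L' : Submodule R P :=
    { carrier := {z | (toRestrict c.p _).symm (c.toCorner P z) ∈ L}
      add_mem' := fun {x y} hx hy => by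
        change (toRestrict c.p _).symm (c.toCorner P (x + y)) ∈ L
        rw [map_add, map_add]
        exact add_mem hx hy
      zero_mem' := by
        change (toRestrict c.p _).symm (c.toCorner P 0) ∈ L
        rw [_root_.map_zero, _root_.map_zero]
        exact zero_mem L
      smul_mem' := fun r x hx => by
        change (toRestrict c.p _).symm (c.toCorner P (r • x)) ∈ L
        rw [map_smul, toRestrict_symm_smul]
        exact L.smul_mem _ hx }
  have hL' : L' = ⊤ := by
    refine hf.2.2 L' (eq_top_iff.mpr fun z _ => ?_)
    have hz : (toRestrict c.p _).symm (c.toCorner P z) ∈ L ⊔ LinearMap.ker (c.mapCorner f) :=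
      hL ▸ Submodule.mem_top
    obtain ⟨l, hl, y, hy, hly⟩ := Submodule.mem_sup.mp hz
    have hly' : l.1 + y.1 = c.s 1 • z := congrArg Subtype.val hly
    refine Submodule.mem_sup.mpr ⟨z - y.1, ?_, y.1, congrArg Subtype.val hy, by abel⟩
    change (toRestrict c.p _).symm (c.toCorner P (z - y.1)) ∈ L
    have hzl : (toRestrict c.p _).symm (c.toCorner P (z - y.1)) = l := Subtype.ext ?_
    · rw [hzl]
      exact hl
    change c.s 1 • (z - y.1) = l.1
    rw [smul_sub, y.2, ← hly', add_sub_cancel_right]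
  refine eq_top_iff.mpr fun z _ => ?_
  have hz : z.1 ∈ L' := hL' ▸ Submodule.mem_top
  change (toRestrict c.p _).symm (c.toCorner P z.1) ∈ L at hz
  rwa [toCorner_val, AddEquiv.symm_apply_apply] at hz

theorem corner_preservesCover : c.corner.PreservesCover := fun _ _ _ hf =>
  c.mapCorner_isProjectiveCover hf

theorem restrict_isExact : c.restrict.IsExact where
  injective _ hf := hf
  exact _ _ h := h
  surjective _ hf := hf

/-- Restriction is also left adjoint to taking corners. A surjection onto the restricted module
stays surjective on corners; there the map d from P, which is projective over A, can be lifted. -/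
theorem restrict_projective {P : Type u} [AddCommGroup P] [Module A P] [Module.Projective A P] :
    Module.Projective R (Restrict c.p P) := by
  refine Module.Projective.of_lifting_property'' fun g hg => ?_
  let g' := c.mapCorner g
  let d : P →ₗ[A] c.Corner (Restrict c.p P) :=
    { toFun := fun x => ⟨toRestrict c.p _ x, by
        rw [smul_toRestrict, c.p_s, one_smul]⟩
      map_add' := fun x y => rfl
      map_smul' := fun a x => Subtype.ext (by
        change toRestrict c.p _ (a • x) = c.s a • toRestrict c.p _ x
        rw [smul_toRestrict, c.p_s]) }
  have hg' : Function.Surjective g' := c.mapCorner_surjective hg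
  obtain ⟨t, ht⟩ := Module.projective_lifting_property g' d hg'
  refine ⟨
    { toFun := fun x => (t ((toRestrict c.p _).symm x)).1
      map_add' := fun x y => by rw [map_add, map_add, Corner.add_val]
      map_smul' := fun r x => by
        rw [toRestrict_symm_smul, map_smul, Corner.smul_val, c.s_p_smul]; rfl }, ?_⟩
  refine LinearMap.ext fun x => ?_
  exact congrArg Subtype.val (LinearMap.congr_fun ht ((toRestrict c.p _).symm x))

theorem restrict_preservesProjective : c.restrict.PreservesProjective := fun P _ =>
  c.restrict_projective (P := P)

/-- Restriction followed by taking the direct factor is the identity. -/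
theorem nonempty_corner_restrict_equiv (X : FGModuleCat.{u} A) :
    Nonempty (c.corner.obj (c.restrict.obj X) ≃ₗ[A] X) := by
  let e : c.Corner (Restrict c.p X) ≃ₗ[A] X :=
    { toFun := fun z => (toRestrict c.p _).symm z.1
      map_add' := fun x y => rfl
      map_smul' := fun a x => by
        rw [Corner.smul_val, toRestrict_symm_smul, c.p_s]; rfl
      invFun := fun x => ⟨toRestrict c.p _ x, by rw [smul_toRestrict, c.p_s, one_smul]⟩
      left_inv := fun _ => rfl
      right_inv := fun _ => rfl }
  exact ⟨e⟩

section Complement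

variable {B : Type u} [Ring B] (d : RingFactor B R) (h : c.s 1 + d.s 1 = 1)

include h

theorem s_one_mul_s_one : c.s 1 * d.s 1 = 0 := by
  have := c.s_one_mul_s 1
  rw [← add_right_inj (c.s 1 * c.s 1), ← mul_add, h, mul_one, add_zero, this]

theorem corner_restrict_subsingleton (X : FGModuleCat.{u} B) :
    Subsingleton (c.corner.obj (d.restrict.obj X)) := by
  have hz : ∀ z : c.Corner (Restrict d.p X), z.1 = 0 := by
    intro z
    have h0 : d.p (c.s 1) = 0 := by
      have := congrArg d.p h
      rwa [map_add, d.p_s, map_one d.p, add_eq_right] at this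
    obtain ⟨x, hx⟩ := (toRestrict d.p X).surjective z.1
    have h1 := z.2
    rw [← hx, smul_toRestrict, h0, zero_smul, _root_.map_zero] at h1
    rw [← hx, ← h1]
  exact ⟨fun x y => Subtype.ext ((hz x).trans (hz y).symm)⟩

/-- A module over a product of two rings is the direct sum of its two direct factors. -/
theorem nonempty_prod_equiv (Z : FGModuleCat.{u} R) :
    Nonempty (Z ≃ₗ[R] (c.restrict.obj (c.corner.obj Z) × d.restrict.obj (d.corner.obj Z))) := by
  have hcd := c.s_one_mul_s_one d h
  have hdc := d.s_one_mul_s_one c ((add_comm _ _).trans h)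
  let f : Z →ₗ[R] (Restrict c.p (c.Corner Z) × Restrict d.p (d.Corner Z)) :=
    (c.toCorner Z).prod (d.toCorner Z)
  refine ⟨LinearEquiv.ofBijective f ⟨?_, ?_⟩⟩
  · rw [injective_iff_map_eq_zero]
    intro z hz
    have h1 : c.s 1 • z = 0 := congrArg Subtype.val (congrArg Prod.fst hz)
    have h2 : d.s 1 • z = 0 := congrArg Subtype.val (congrArg Prod.snd hz)
    rw [← one_smul R z, ← h, add_smul, h1, h2, add_zero]
  · rintro ⟨⟨x, hx⟩, ⟨y, hy⟩⟩
    refine ⟨x + y, Prod.ext (Subtype.ext ?_) (Subtype.ext ?_)⟩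
    · change c.s 1 • (x + y) = x
      rw [smul_add, hx, ← hy, smul_smul, hcd, zero_smul, add_zero]
    · change d.s 1 • (x + y) = y
      rw [smul_add, hy, ← hx, smul_smul, hdc, zero_smul, zero_add]

end Complement

end RingFactor

open ModFunctor

/-! ### The Lat-Igusa-Todorov property for a product of two rings -/

section

variable {A B R : Type u} [Ring A] [Ring B] [Ring R] (c : RingFactor A R) (d : RingFactor B R)
  (h : c.s 1 + d.s 1 = 1)

/-- The modules over a product of two rings whose direct factors lie in given classes. -/
def factorClass (DA : Set (FGModuleCat.{u} A)) (DB : Set (FGModuleCat.{u} B)) :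
    Set (FGModuleCat.{u} R) :=
  {Z | c.corner.obj Z ∈ DA ∧ d.corner.obj Z ∈ DB}

variable {DA : Set (FGModuleCat.{u} A)} {DB : Set (FGModuleCat.{u} B)}

include h

/-- With this identity the Igusa–Todorov case over the product ring becomes an instance of the
general one. -/
theorem factorClass_subsingleton : factorClass c d {M : FGModuleCat.{u} A | Subsingleton M}
    {M : FGModuleCat.{u} B | Subsingleton M} = {M : FGModuleCat.{u} R | Subsingleton M} := by
  ext M
  constructor
  · rintro ⟨hA, hB⟩
    obtain ⟨e⟩ := c.nonempty_prod_equiv d h M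
    have : Subsingleton (c.corner.obj M) := hA
    have : Subsingleton (d.corner.obj M) := hB
    have := c.restrict.obj_subsingleton (c.corner.obj M)
    have := d.restrict.obj_subsingleton (d.corner.obj M)
    exact e.toEquiv.subsingleton
  · intro (hM : Subsingleton M)
    exact ⟨c.corner.obj_subsingleton M, d.corner.obj_subsingleton M⟩

variable [IsArtinianRing A] [IsArtinianRing B] [IsArtinianRing R]

/-- Taking corners commutes with Ω and respects sums and summands, so each condition can be checked
on the two factors separately. -/
theorem factorClass_isZeroIT (hA : IsZeroIT DA) (hB : IsZeroIT DB) :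
    IsZeroIT (factorClass c d DA DB) where
  add_eq := by
    refine eq_addClosure ?_ ?_ ?_
    · intro M hM
      have := c.corner.obj_subsingleton M
      have := d.corner.obj_subsingleton M
      exact ⟨hA.of_subsingleton _, hB.of_subsingleton _⟩
    · intro X Y hXY hY
      exact ⟨hA.of_isSummand (c.corner.isSummand_obj hXY) hY.1,
        hB.of_isSummand (d.corner.isSummand_obj hXY) hY.2⟩
    · intro X Y hX hY
      exact ⟨hA.congr (M := FGModuleCat.of A (c.corner.obj X × c.corner.obj Y))
          (c.corner.prodEquiv X Y).symm (hA.prod hX.1 hY.1),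
        hB.congr (M := FGModuleCat.of B (d.corner.obj X × d.corner.obj Y))
          (d.corner.prodEquiv X Y).symm (hB.prod hX.2 hY.2)⟩
  syzygy_mem := by
    intro M hM
    obtain ⟨e⟩ := c.corner_preservesCover.nonempty_syzygy_equiv c.corner_isExact M
    obtain ⟨e'⟩ := d.corner_preservesCover.nonempty_syzygy_equiv d.corner_isExact M
    exact ⟨hA.congr e (hA.syzygy_mem _ hM.1), hB.congr e' (hB.syzygy_mem _ hM.2)⟩
  phiDim_eq := by
    rw [phiDim_eq_zero_iff]
    intro M hM
    rw [phi_eq_zero_iff]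
    have hc := c.corner_preservesCover
    have hd := d.corner_preservesCover
    -- an element of `K₀` is determined by its two components
    have key : ∀ x : K0 R, x = K0map c.restrict_preservesProjective
        (K0map hc.preservesProjective x) + K0map d.restrict_preservesProjective
        (K0map hd.preservesProjective x) := by
      intro x
      refine DFunLike.congr_fun (f := AddMonoidHom.id _)
        (g := (K0map c.restrict_preservesProjective).comp (K0map hc.preservesProjective) +
          (K0map d.restrict_preservesProjective).comp (K0map hd.preservesProjective))
        (K0_hom_ext fun Z => ?_) x
      obtain ⟨e⟩ := c.nonempty_prod_equiv d h Z
      simp only [AddMonoidHom.id_apply, AddMonoidHom.add_apply, AddMonoidHom.comp_apply, K0map_cls]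
      exact cls_eq_add e
    rintro m _ ⟨x, hx, rfl⟩ _ ⟨y, hy, rfl⟩ hxy
    rw [key ((omegaBar R)^[m] x), key ((omegaBar R)^[m] y)]
    congr 2
    -- The projection to K₀ of a factor commutes with Ω̄, so the equality `hxy` passes to that
    -- factor, where Ω̄ is injective on the image in question because φ vanishes on the given class.
    · have := congrArg (K0map hc.preservesProjective) hxy
      rw [hc.K0map_omegaBar c.corner_isExact, hc.K0map_omegaBar c.corner_isExact,
        hc.K0map_iterate_omegaBar c.corner_isExact,
        hc.K0map_iterate_omegaBar c.corner_isExact] at this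
      rw [hc.K0map_iterate_omegaBar c.corner_isExact, hc.K0map_iterate_omegaBar c.corner_isExact]
      exact hA.injOn hM.1 m ⟨_, K0map_mem_addSubgroupOf _ hx, rfl⟩
        ⟨_, K0map_mem_addSubgroupOf _ hy, rfl⟩ this
    · have := congrArg (K0map hd.preservesProjective) hxy
      rw [hd.K0map_omegaBar d.corner_isExact, hd.K0map_omegaBar d.corner_isExact,
        hd.K0map_iterate_omegaBar d.corner_isExact,
        hd.K0map_iterate_omegaBar d.corner_isExact] at this
      rw [hd.K0map_iterate_omegaBar d.corner_isExact, hd.K0map_iterate_omegaBar d.corner_isExact]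
      exact hB.injOn hM.2 m ⟨_, K0map_mem_addSubgroupOf _ hx, rfl⟩
        ⟨_, K0map_mem_addSubgroupOf _ hy, rfl⟩ this

/-- A finite product of rings inherits the Lat-Igusa-Todorov property from its factors. -/
theorem IsLITWith.of_factors {n : ℕ} {VA : FGModuleCat.{u} A} {VB : FGModuleCat.{u} B}
    (hA : IsLITWith n VA DA Set.univ) (hB : IsLITWith n VB DB Set.univ) :
    IsLITWith n (FGModuleCat.of R (c.restrict.obj VA × d.restrict.obj VB))
      (factorClass c d DA DB) Set.univ := by
  have hR := factorClass_isZeroIT c d h hA.1 hB.1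
  refine ⟨hR, fun M _ => ?_⟩
  let V := FGModuleCat.of R (c.restrict.obj VA × d.restrict.obj VB)
  have hMA : IsLITPresented V (factorClass c d DA DB)
      (c.restrict.obj (c.corner.obj (syzygy^[n] M))) := by
    obtain ⟨e⟩ := c.corner_preservesCover.nonempty_iterate_syzygy_equiv c.corner_isExact n M
    refine ((show IsLITPresented VA DA (syzygy^[n] (c.corner.obj M)) from hA.2 _ trivial).congr
      e).map c.restrict_isExact (IsSummand.fst _ (d.restrict.obj VB)) fun X hX => ?_
    obtain ⟨e'⟩ := c.nonempty_corner_restrict_equiv X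
    have := d.corner_restrict_subsingleton c ((add_comm _ _).trans h) X
    exact ⟨hA.1.congr e'.symm hX, hB.1.of_subsingleton _⟩
  have hMB : IsLITPresented V (factorClass c d DA DB)
      (d.restrict.obj (d.corner.obj (syzygy^[n] M))) := by
    obtain ⟨e⟩ := d.corner_preservesCover.nonempty_iterate_syzygy_equiv d.corner_isExact n M
    refine ((show IsLITPresented VB DB (syzygy^[n] (d.corner.obj M)) from hB.2 _ trivial).congr
      e).map d.restrict_isExact (IsSummand.snd (c.restrict.obj VA) _) fun X hX => ?_
    obtain ⟨e'⟩ := d.nonempty_corner_restrict_equiv X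
    have := c.corner_restrict_subsingleton d h X
    exact ⟨hA.1.of_subsingleton _, hB.1.congr e'.symm hX⟩
  obtain ⟨e⟩ := c.nonempty_prod_equiv d h (syzygy^[n] M)
  exact (hMA.prod (fun _ _ => hR.prod) hMB).congr (Z := FGModuleCat.of R
    (c.restrict.obj (c.corner.obj (syzygy^[n] M)) × d.restrict.obj (d.corner.obj (syzygy^[n] M))))
    e.symm

end

end IgusaTodorov

namespace IgusaTodorov

/-! ### Split extensions by a square-zero ideal -/

/-- A ring `C` which is a split extension of `R` by an ideal `E` with `E ^ 2 = 0` that is the direct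
sum of the right modules `ε i * R ≅ f i * R`, on which `R` acts from the left through characters
`χ i`. -/
structure SquareZeroData (k R C I : Type u) [Field k] [Ring R] [Algebra k R] [Ring C]
    [Fintype I] where
  π : C →+* R
  ι : R →+* C
  ε : I → C
  f : I → R
  χ : I → R →ₐ[k] k
  ρ : I → C →+ R
  π_ι : ∀ r, π (ι r) = r
  π_ε : ∀ i, π (ε i) = 0
  ρ_mul : ∀ i c c', ρ i (c * c') = ρ i c * π c' + algebraMap k R (χ i (π c)) * ρ i c'
  f_ρ : ∀ i c, f i * ρ i c = ρ i c
  ρ_ι : ∀ i r, ρ i (ι r) = 0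
  ρ_ε_self : ∀ i, ρ i (ε i) = f i
  ρ_ε_of_ne : ∀ i j, i ≠ j → ρ i (ε j) = 0
  decomp : ∀ c, c = ι (π c) + ∑ i, ε i * ι (ρ i c)

namespace SquareZeroData

variable {k R C I : Type u} [Field k] [Ring R] [Algebra k R] [Ring C] [Fintype I]
  (D : SquareZeroData k R C I)

/-- The action of `C` on the `i`-th summand of the ideal. -/
def σ (i : I) : C →+* R := (algebraMap k R).comp ((D.χ i).toRingHom.comp D.π)

theorem σ_apply (i : I) (c : C) : D.σ i c = algebraMap k R (D.χ i (D.π c)) := rfl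

theorem σ_comm (i : I) (c : C) (r : R) : D.σ i c * r = r * D.σ i c := Algebra.commutes _ _

theorem σ_ε (i j : I) : D.σ i (D.ε j) = 0 := by simp [σ_apply, D.π_ε]

theorem π_surjective : Function.Surjective D.π := fun r => ⟨D.ι r, D.π_ι r⟩

theorem eq_sum_of_π_eq_zero {c : C} (hc : D.π c = 0) : c = ∑ i, D.ε i * D.ι (D.ρ i c) := by
  have := D.decomp c
  rwa [hc, map_zero, zero_add] at this

theorem eq_zero {c : C} (hc : D.π c = 0) (hc' : ∀ i, D.ρ i c = 0) : c = 0 := by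
  rw [D.eq_sum_of_π_eq_zero hc]
  simp [hc']

/-- This is E² = 0: both terms in the product rule for ρ contain the image under π of an element of
E. -/
theorem mul_eq_zero {c c' : C} (hc : D.π c = 0) (hc' : D.π c' = 0) : c * c' = 0 := by
  refine D.eq_zero (by rw [map_mul, hc, zero_mul]) fun i => ?_
  rw [D.ρ_mul, hc, hc']
  simp

theorem f_mul_f (i : I) : D.f i * D.f i = D.f i := by
  have := D.f_ρ i (D.ε i)
  rwa [D.ρ_ε_self] at this

/-- Moving c to the right of `ε i` replaces it by the scalar given by the character, as one sees by
comparing coordinates. This is why C acts on each summand ε i ⊗ f i X of an induced module by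
scalars. -/
theorem mul_ε (c : C) (i : I) : c * D.ε i = D.ε i * D.ι (D.σ i c) := by
  rw [← sub_eq_zero]
  refine D.eq_zero (by simp [D.π_ε]) fun j => ?_
  rw [map_sub, D.ρ_mul, D.ρ_mul, D.π_ε, D.ρ_ι, D.π_ι]
  rcases eq_or_ne j i with rfl | h
  · rw [D.ρ_ε_self, ← D.σ_apply, D.σ_comm]
    simp
  · simp [D.ρ_ε_of_ne j i h]

theorem ε_mul_f (i : I) : D.ε i * D.ι (D.f i) = D.ε i := by
  rw [← sub_eq_zero]
  refine D.eq_zero (by simp [D.π_ε]) fun j => ?_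
  rw [map_sub, D.ρ_mul, D.ρ_ι, D.π_ι]
  rcases eq_or_ne j i with rfl | h
  · simp [D.ρ_ε_self, D.f_mul_f]
  · simp [D.ρ_ε_of_ne j i h]

/-! #### Induced modules -/

section Modules

variable (X : Type u) [AddCommGroup X] [Module R X]

/-- The summand `f i X` of a module. -/
def Fiber (i : I) : Type u := {x : X // D.f i • x = x}

instance (i : I) : AddCommGroup (D.Fiber X i) :=
  inferInstanceAs (AddCommGroup
    ({ carrier := {z : X | D.f i • z = z}
       add_mem' := fun {a b} (ha : D.f i • a = a) (hb : D.f i • b = b) => by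
        change D.f i • (a + b) = a + b
        rw [smul_add, ha, hb]
       zero_mem' := smul_zero _
       neg_mem' := fun {a} (ha : D.f i • a = a) => by
        change D.f i • (-a) = -a
        rw [smul_neg, ha] } : AddSubgroup X))

variable {X} in
/-- The projection of a module to `f i X`, precomposed with the multiplication by `r`. -/
def toFiber (i : I) {r : R} (hr : D.f i * r = r) (x : X) : D.Fiber X i :=
  ⟨r • x, by rw [smul_smul, hr]⟩

instance (i : I) : Module C (D.Fiber X i) where
  smul c y := ⟨D.σ i c • y.1, by rw [smul_smul, ← D.σ_comm, mul_smul, y.2]⟩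
  one_smul y := Subtype.ext (by
    change D.σ i 1 • y.1 = y.1
    rw [map_one, one_smul])
  mul_smul a b y := Subtype.ext (by
    change D.σ i (a * b) • y.1 = D.σ i a • D.σ i b • y.1
    rw [map_mul, mul_smul])
  smul_zero a := Subtype.ext (smul_zero (D.σ i a))
  smul_add a x y := Subtype.ext (smul_add (D.σ i a) x.1 y.1)
  add_smul a b x := Subtype.ext (by
    change D.σ i (a + b) • x.1 = D.σ i a • x.1 + D.σ i b • x.1
    rw [map_add, add_smul])
  zero_smul x := Subtype.ext (by
    change D.σ i 0 • x.1 = 0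
    rw [_root_.map_zero, zero_smul])

/-- The action factors through the surjective character τ from C to k, so the submodules are those
of a vector space. This is the origin of the semisimple summands in syzygies. -/
instance (i : I) : IsSemisimpleModule C (D.Fiber X i) := by
  let τ : C →+* k := (D.χ i).toRingHom.comp D.π
  have hτ : RingHomSurjective τ := ⟨fun a => ⟨D.ι (algebraMap k R a), by
    change D.χ i (D.π (D.ι (algebraMap k R a))) = a
    rw [D.π_ι, AlgHom.commutes]; rfl⟩⟩
  let : Module k (D.Fiber X i) := Module.compHom _ (D.ι.comp (algebraMap k R))
  let l : D.Fiber X i →ₛₗ[τ] D.Fiber X i :=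
    { AddMonoidHom.id _ with
      map_smul' := fun c y => Subtype.ext (by
        change D.σ i c • y.1 = D.σ i (D.ι (algebraMap k R (D.χ i (D.π c)))) • y.1
        rw [D.σ_apply, D.σ_apply, D.π_ι, AlgHom.commutes]; rfl) }
  rw [l.isSemisimpleModule_iff_of_bijective Function.bijective_id]
  infer_instance

/-- The induced module `C ⊗ X = X ⊕ ⨁ i, ε i ⊗ f i X`. -/
def Ind : Type u := X × (∀ i, D.Fiber X i)

instance : AddCommGroup (D.Ind X) := inferInstanceAs (AddCommGroup (X × (∀ i, D.Fiber X i)))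

instance : Module C (D.Ind X) where
  smul c z := (D.π c • z.1, fun i => c • z.2 i + D.toFiber i (D.f_ρ i c) z.1)
  one_smul z := by
    refine Prod.ext ?_ (funext fun i => Subtype.ext ?_)
    · change D.π 1 • z.1 = z.1
      rw [map_one, one_smul]
    · change D.σ i 1 • (z.2 i).1 + D.ρ i 1 • z.1 = (z.2 i).1
      rw [map_one, one_smul, ← map_one D.ι, D.ρ_ι, zero_smul, add_zero]
  mul_smul a b z := by
    refine Prod.ext ?_ (funext fun i => Subtype.ext ?_)
    · change D.π (a * b) • z.1 = D.π a • D.π b • z.1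
      rw [map_mul, mul_smul]
    · change D.σ i (a * b) • (z.2 i).1 + D.ρ i (a * b) • z.1 =
        D.σ i a • (D.σ i b • (z.2 i).1 + D.ρ i b • z.1) + D.ρ i a • D.π b • z.1
      rw [map_mul, D.ρ_mul, ← D.σ_apply]
      simp only [mul_smul, smul_add, add_smul]
      abel
  smul_zero a := by
    refine Prod.ext (smul_zero _) (funext fun i => Subtype.ext ?_)
    change D.σ i a • (0 : X) + D.ρ i a • (0 : X) = 0
    simp
  smul_add a x y := by
    refine Prod.ext (smul_add _ _ _) (funext fun i => Subtype.ext ?_)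
    change D.σ i a • ((x.2 i).1 + (y.2 i).1) + D.ρ i a • (x.1 + y.1) =
      (D.σ i a • (x.2 i).1 + D.ρ i a • x.1) + (D.σ i a • (y.2 i).1 + D.ρ i a • y.1)
    simp only [smul_add]
    abel
  add_smul a b z := by
    refine Prod.ext ?_ (funext fun i => Subtype.ext ?_)
    · change D.π (a + b) • z.1 = D.π a • z.1 + D.π b • z.1
      rw [map_add, add_smul]
    · change D.σ i (a + b) • (z.2 i).1 + D.ρ i (a + b) • z.1 =
        (D.σ i a • (z.2 i).1 + D.ρ i a • z.1) + (D.σ i b • (z.2 i).1 + D.ρ i b • z.1)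
      simp only [map_add, add_smul]
      abel
  zero_smul z := by
    refine Prod.ext ?_ (funext fun i => Subtype.ext ?_)
    · change D.π 0 • z.1 = 0
      rw [_root_.map_zero, zero_smul]
    · change D.σ i 0 • (z.2 i).1 + D.ρ i 0 • z.1 = 0
      rw [_root_.map_zero, _root_.map_zero, zero_smul, zero_smul, add_zero]

variable {X}

theorem Ind.ext {x y : D.Ind X} (h₁ : x.1 = y.1) (h₂ : ∀ i, (x.2 i).1 = (y.2 i).1) : x = y :=
  Prod.ext h₁ (funext fun i => Subtype.ext (h₂ i))

theorem Ind.add_fst (x y : D.Ind X) : (x + y).1 = x.1 + y.1 := rfl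

theorem Ind.add_snd (x y : D.Ind X) (i : I) : ((x + y).2 i).1 = (x.2 i).1 + (y.2 i).1 := rfl

theorem Ind.smul_fst (c : C) (x : D.Ind X) : (c • x).1 = D.π c • x.1 := rfl

theorem Ind.smul_snd (c : C) (x : D.Ind X) (i : I) :
    ((c • x).2 i).1 = D.σ i c • (x.2 i).1 + D.ρ i c • x.1 := rfl

variable (X) in
/-- The unit `X → C ⊗ X`. -/
def unit : X →ₛₗ[D.ι] D.Ind X where
  toFun x := (x, 0)
  map_add' x y := Prod.ext rfl (add_zero _).symm
  map_smul' r x := Ind.ext D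
    (by
      change r • x = D.π (D.ι r) • x
      rw [D.π_ι])
    fun i => by
      change (0 : X) = D.σ i (D.ι r) • (0 : X) + D.ρ i (D.ι r) • x
      rw [D.ρ_ι, smul_zero, zero_smul, add_zero]

theorem unit_fst (x : X) : (D.unit X x).1 = x := rfl

theorem unit_snd (x : X) (i : I) : ((D.unit X x).2 i).1 = 0 := rfl

variable (X) in
/-- The projection `C ⊗ X → X`. -/
def proj : D.Ind X →ₛₗ[D.π] X where
  toFun x := x.1
  map_add' _ _ := rfl
  map_smul' _ _ := rfl

theorem proj_apply (x : D.Ind X) : D.proj X x = x.1 := rfl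

theorem sum_fst (m : I → D.Ind X) : (∑ i, D.ε i • m i).1 = 0 := by
  rw [← proj_apply, map_sum]
  refine Finset.sum_eq_zero fun i _ => ?_
  rw [map_smulₛₗ, D.π_ε, zero_smul]

/-- The projection to the `i`-th summand. -/
def projSnd (i : I) : D.Ind X →+ X where
  toFun x := (x.2 i).1
  map_zero' := rfl
  map_add' _ _ := rfl

/-- Multiplication by `ε j` forgets the second component and puts `f j` times the first one into
slot j; the other `ε i` do not reach that slot. -/
theorem sum_snd (m : I → D.Ind X) (j : I) : ((∑ i, D.ε i • m i).2 j).1 = D.f j • (m j).1 := by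
  change D.projSnd j _ = _
  rw [map_sum, Finset.sum_eq_single j]
  · change ((D.ε j • m j).2 j).1 = _
    rw [Ind.smul_snd, D.σ_ε, zero_smul, zero_add, D.ρ_ε_self]
  · intro i _ hi
    change ((D.ε i • m i).2 j).1 = _
    rw [Ind.smul_snd, D.σ_ε, D.ρ_ε_of_ne j i hi.symm, zero_smul, zero_smul, zero_add]
  · simp

theorem eq_unit_add (x : D.Ind X) : x = D.unit X x.1 + ∑ i, D.ε i • D.unit X (x.2 i).1 := by
  refine Ind.ext D ?_ fun i => ?_
  · rw [Ind.add_fst, D.sum_fst, add_zero, unit_fst]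
  · rw [Ind.add_snd, D.sum_snd, unit_snd, zero_add, unit_fst, (x.2 i).2]

variable {M : Type u} [AddCommGroup M] [Module C M]

/-- The adjunction between induction and restriction. -/
def lift (g : X →ₛₗ[D.ι] M) : D.Ind X →ₗ[C] M where
  toFun x := g x.1 + ∑ i, D.ε i • g (x.2 i).1
  map_add' x y := by
    simp only [Ind.add_fst, Ind.add_snd, map_add, smul_add, Finset.sum_add_distrib]
    abel
  map_smul' c x := by
    simp only [Ind.smul_fst, Ind.smul_snd, map_add, smul_add, Finset.sum_add_distrib,
      map_smulₛₗ, RingHom.id_apply, Finset.smul_sum, smul_smul, D.mul_ε c]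
    -- Only the c acting on `g x.1` has to be decomposed. The occurrences inside σ are expanded too
    -- and are folded back by the next line.
    conv_rhs => rw [D.decomp c, add_smul, Finset.sum_smul]
    simp only [← D.decomp c]
    abel

theorem lift_apply (g : X →ₛₗ[D.ι] M) (x : D.Ind X) :
    D.lift g x = g x.1 + ∑ i, D.ε i • g (x.2 i).1 := rfl

theorem lift_unit (g : X →ₛₗ[D.ι] M) (x : X) : D.lift g (D.unit X x) = g x := by
  rw [lift_apply, unit_fst]
  simp [unit_snd]

theorem hom_ext {g h : D.Ind X →ₗ[C] M} (H : ∀ x, g (D.unit X x) = h (D.unit X x)) : g = h := by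
  refine LinearMap.ext fun x => ?_
  rw [D.eq_unit_add x]
  simp only [map_add, map_sum, map_smul, H]

instance [Module.Finite R X] : Module.Finite C (D.Ind X) := by
  classical
  obtain ⟨s, hs⟩ := Module.Finite.fg_top (R := R) (M := X)
  refine ⟨⟨s.image (D.unit X), ?_⟩⟩
  have key : ∀ x : X, D.unit X x ∈ Submodule.span C ((s.image (D.unit X) : Finset _) : Set _) := by
    intro x
    have hx : x ∈ Submodule.span R (s : Set X) := hs ▸ Submodule.mem_top
    induction hx using Submodule.span_induction with
    | mem x hx => exact Submodule.subset_span (by simpa using ⟨x, hx, rfl⟩)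
    | zero => simp
    | add x y _ _ hx hy => rw [map_add]; exact add_mem hx hy
    | smul a x _ hx => rw [map_smulₛₗ]; exact Submodule.smul_mem _ _ hx
  refine eq_top_iff.mpr fun x _ => ?_
  rw [D.eq_unit_add x]
  exact add_mem (key _) (sum_mem fun i _ => Submodule.smul_mem _ _ (key _))

/-- Induction on linear maps. -/
def mapInd {Y : Type u} [AddCommGroup Y] [Module R Y] (g : X →ₗ[R] Y) :
    D.Ind X →ₗ[C] D.Ind Y where
  toFun x := (g x.1, fun i => ⟨g (x.2 i).1, by rw [← map_smul, (x.2 i).2]⟩)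
  map_add' x y := Ind.ext D (map_add g _ _) fun i => map_add g _ _
  map_smul' c x := Ind.ext D (map_smul g _ _) fun i => by
    change g (D.σ i c • (x.2 i).1 + D.ρ i c • x.1) = D.σ i c • g (x.2 i).1 + D.ρ i c • g x.1
    rw [map_add, map_smul, map_smul]

theorem mapInd_surjective {Y : Type u} [AddCommGroup Y] [Module R Y] {g : X →ₗ[R] Y}
    (hg : Function.Surjective g) : Function.Surjective (D.mapInd g) := by
  intro y
  obtain ⟨x, hx⟩ := hg y.1
  choose z hz using fun i => hg (y.2 i).1
  refine ⟨(x, fun i => D.toFiber i (D.f_mul_f i) (z i)), Ind.ext D hx fun i => ?_⟩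
  change g (D.f i • z i) = (y.2 i).1
  rw [map_smul, hz, (y.2 i).2]

/-- By `lift` and `hom_ext`, induction is left adjoint to restriction along ι, which preserves
surjections. -/
theorem Ind.projective {P : Type u} [AddCommGroup P] [Module R P] [Module.Projective R P] :
    Module.Projective C (D.Ind P) := by
  refine Module.Projective.of_lifting_property'' fun g hg => ?_
  let g' : Restrict D.ι (D.Ind P →₀ C) →ₗ[R] Restrict D.ι (D.Ind P) :=
    { toFun := fun x => toRestrict D.ι _ (g ((toRestrict D.ι _).symm x))
      map_add' := fun _ _ => map_add g _ _
      map_smul' := fun r _ => map_smul g (D.ι r) _ }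
  let η : P →ₗ[R] Restrict D.ι (D.Ind P) :=
    { toFun := fun x => toRestrict D.ι _ (D.unit P x)
      map_add' := fun _ _ => map_add (D.unit P) _ _
      map_smul' := fun r _ => map_smulₛₗ (D.unit P) r _ }
  obtain ⟨h, hh⟩ := Module.projective_lifting_property g' η hg
  let h' : P →ₛₗ[D.ι] (D.Ind P →₀ C) :=
    { toFun := fun x => (toRestrict D.ι _).symm (h x)
      map_add' := fun _ _ => map_add h _ _
      map_smul' := fun r _ => map_smul h r _ }
  refine ⟨D.lift h', D.hom_ext fun x => ?_⟩
  rw [LinearMap.comp_apply, lift_unit]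
  exact LinearMap.congr_fun hh x

theorem mapInd_isProjectiveCover {P Y : Type u} [AddCommGroup P] [Module R P] [AddCommGroup Y]
    [Module R Y] {g : P →ₗ[R] Y} (hg : IsProjectiveCover g) :
    IsProjectiveCover (D.mapInd g) := by
  have := hg.1
  refine ⟨Ind.projective D, D.mapInd_surjective hg.2.1, fun L hL => ?_⟩
  -- The first components of elements of L form a submodule which spans P together with ker g, hence
  -- is all of P.
  have hL' : ∀ x, ∃ z ∈ L, z.1 = x := by
    let L' : Submodule R P :=
      { carrier := {x | ∃ z ∈ L, z.1 = x}
        add_mem' := by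
          rintro _ _ ⟨z, hz, rfl⟩ ⟨w, hw, rfl⟩
          exact ⟨z + w, add_mem hz hw, rfl⟩
        zero_mem' := ⟨0, zero_mem L, rfl⟩
        smul_mem' := by
          rintro r _ ⟨z, hz, rfl⟩
          exact ⟨D.ι r • z, L.smul_mem _ hz, by rw [Ind.smul_fst, D.π_ι]⟩ }
    have : L' = ⊤ := by
      refine hg.2.2 L' (eq_top_iff.mpr fun x _ => ?_)
      have hx : D.unit P x ∈ L ⊔ LinearMap.ker (D.mapInd g) := hL ▸ Submodule.mem_top
      obtain ⟨z, hz, w, hw, hzw⟩ := Submodule.mem_sup.mp hx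
      exact Submodule.mem_sup.mpr ⟨z.1, ⟨z, hz, rfl⟩, w.1, congrArg Prod.fst hw,
        congrArg Prod.fst hzw⟩
    intro x
    exact (this ▸ Submodule.mem_top : x ∈ L')
  choose z hz hzx using hL'
  have hsum : ∀ y : I → P, ∑ i, D.ε i • z (y i) ∈ L := fun y =>
    sum_mem fun i _ => L.smul_mem _ (hz _)
  refine eq_top_iff.mpr fun x _ => ?_
  -- Since `ε i` sees only first components, prescribing those of elements of L suffices to correct
  -- every second component inside L.
  have hx : x = z x.1 + ∑ i, D.ε i • z ((x.2 i).1 - ((z x.1).2 i).1) := by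
    refine Ind.ext D ?_ fun i => ?_
    · rw [Ind.add_fst, D.sum_fst, add_zero, hzx]
    · rw [Ind.add_snd, D.sum_snd, hzx, smul_sub, (x.2 i).2, ((z x.1).2 i).2]
      abel
  rw [hx]
  exact add_mem (hz _) (hsum _)

/-! #### The restriction of modules to the quotient ring -/

variable (M) in
/-- The submodule `E M`, where `E` is the kernel of `C → R`. -/
def rad : Submodule C M where
  carrier := {x | ∃ m : I → M, x = ∑ i, D.ε i • m i}
  add_mem' := by
    rintro _ _ ⟨m, rfl⟩ ⟨m', rfl⟩
    exact ⟨m + m', by simp [smul_add, Finset.sum_add_distrib]⟩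
  zero_mem' := ⟨0, by simp⟩
  smul_mem' := by
    rintro c _ ⟨m, rfl⟩
    exact ⟨fun i => D.ι (D.σ i c) • m i, by simp only [Finset.smul_sum, smul_smul, D.mul_ε c]⟩

theorem smul_mem_rad {c : C} (hc : D.π c = 0) (m : M) : c • m ∈ D.rad M :=
  ⟨fun i => D.ι (D.ρ i c) • m, by
    conv_lhs => rw [D.eq_sum_of_π_eq_zero hc]
    simp only [Finset.sum_smul, mul_smul]⟩

theorem smul_rad {c : C} (hc : D.π c = 0) {m : M} (hm : m ∈ D.rad M) : c • m = 0 := by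
  obtain ⟨m, rfl⟩ := hm
  rw [Finset.smul_sum]
  refine Finset.sum_eq_zero fun i _ => ?_
  rw [smul_smul, D.mul_eq_zero hc (D.π_ε i), zero_smul]

theorem map_mem_rad {N : Type u} [AddCommGroup N] [Module C N] (g : M →ₗ[C] N) {m : M}
    (hm : m ∈ D.rad M) : g m ∈ D.rad N := by
  obtain ⟨m, rfl⟩ := hm
  exact ⟨fun i => g (m i), by simp⟩

variable (M) in
/-- The largest quotient of a `C`-module on which `C` acts through `R`. -/
def Top : Type u := M ⧸ D.rad M

instance : AddCommGroup (D.Top M) := inferInstanceAs (AddCommGroup (M ⧸ D.rad M))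

instance : Module R (D.Top M) :=
  let _ : Module C (D.Top M) := inferInstanceAs (Module C (M ⧸ D.rad M))
  Module.compHom _ D.ι

variable (M) in
/-- The projection to the largest quotient on which `C` acts through `R`. -/
def toTop : M →ₛₗ[D.π] D.Top M where
  toFun := (D.rad M).mkQ
  map_add' := map_add _
  map_smul' c m := by
    change (D.rad M).mkQ (c • m) = (D.rad M).mkQ (D.ι (D.π c) • m)
    rw [← sub_eq_zero, ← map_sub, ← sub_smul]
    simp only [Submodule.mkQ_apply, Submodule.Quotient.mk_eq_zero]
    exact D.smul_mem_rad (by rw [map_sub, D.π_ι, sub_self]) m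

theorem toTop_surjective : Function.Surjective (D.toTop M) := Submodule.mkQ_surjective _

theorem toTop_eq_zero {m : M} : D.toTop M m = 0 ↔ m ∈ D.rad M := Submodule.Quotient.mk_eq_zero _

instance [Module.Finite C M] : Module.Finite R (D.Top M) := by
  have : RingHomSurjective D.π := ⟨D.π_surjective⟩
  exact Module.Finite.of_surjective (D.toTop M) D.toTop_surjective

/-- The universal property of the largest quotient on which `C` acts through `R`. -/
def desc (g : M →ₛₗ[D.π] X) : D.Top M →ₗ[R] X :=
  let g' : M ⧸ D.rad M →+ X := QuotientAddGroup.lift (D.rad M).toAddSubgroup g.toAddMonoidHom (by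
    rintro _ ⟨m, rfl⟩
    change g _ = 0
    rw [map_sum]
    refine Finset.sum_eq_zero fun i _ => ?_
    rw [map_smulₛₗ, D.π_ε, zero_smul])
  { toFun := g'
    map_add' := g'.map_add
    map_smul' := fun r x => by
      obtain ⟨m, rfl⟩ := D.toTop_surjective x
      change g (D.ι r • m) = r • g m
      rw [map_smulₛₗ, D.π_ι] }

theorem top_hom_ext {g h : D.Top M →ₗ[R] X} (H : ∀ m, g (D.toTop M m) = h (D.toTop M m)) :
    g = h := by
  refine LinearMap.ext fun x => ?_
  obtain ⟨m, rfl⟩ := D.toTop_surjective x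
  exact H m

/-- The action of `Top` on linear maps. -/
def mapTop {N : Type u} [AddCommGroup N] [Module C N] (g : M →ₗ[C] N) : D.Top M →ₗ[R] D.Top N :=
  D.desc
    { toFun := fun m => D.toTop N (g m)
      map_add' := fun x y => by rw [map_add, map_add]
      map_smul' := fun c x => by rw [map_smul, map_smulₛₗ] }

theorem mapTop_toTop {N : Type u} [AddCommGroup N] [Module C N] (g : M →ₗ[C] N) (m : M) :
    D.mapTop g (D.toTop M m) = D.toTop N (g m) := rfl

/-- By `desc` and `top_hom_ext`, this quotient is left adjoint to restriction along π, which
preserves surjections. -/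
theorem Top.projective {P : Type u} [AddCommGroup P] [Module C P] [Module.Projective C P] :
    Module.Projective R (D.Top P) := by
  refine Module.Projective.of_lifting_property'' fun g hg => ?_
  let g' : Restrict D.π (D.Top P →₀ R) →ₗ[C] Restrict D.π (D.Top P) :=
    { toFun := fun x => toRestrict D.π _ (g ((toRestrict D.π _).symm x))
      map_add' := fun _ _ => map_add g _ _
      map_smul' := fun c _ => map_smul g (D.π c) _ }
  let q : P →ₗ[C] Restrict D.π (D.Top P) :=
    { toFun := fun x => toRestrict D.π _ (D.toTop P x)
      map_add' := fun _ _ => map_add (D.toTop P) _ _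
      map_smul' := fun c _ => map_smulₛₗ (D.toTop P) c _ }
  obtain ⟨h, hh⟩ := Module.projective_lifting_property g' q hg
  let h' : P →ₛₗ[D.π] (D.Top P →₀ R) :=
    { toFun := fun x => (toRestrict D.π _).symm (h x)
      map_add' := fun _ _ => map_add h _ _
      map_smul' := fun c _ => map_smul h c _ }
  refine ⟨D.desc h', D.top_hom_ext fun x => ?_⟩
  exact LinearMap.congr_fun hh x

variable (X) in
/-- The quotient `R ⊗ C ⊗ X` is `X`. -/
def topIndEquiv : D.Top (D.Ind X) ≃ₗ[R] X :=
  LinearEquiv.ofLinearMap (D.desc (D.proj X))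
    { toFun := fun x => D.toTop _ (D.unit X x)
      map_add' := fun x y => by rw [map_add, map_add]
      map_smul' := fun r x => by rw [map_smulₛₗ, map_smulₛₗ, D.π_ι]; rfl }
    (LinearMap.ext fun x => rfl)
    (D.top_hom_ext fun m => by
      change D.toTop _ (D.unit X m.1) = D.toTop _ m
      conv_rhs => rw [D.eq_unit_add m, map_add]
      rw [left_eq_add, toTop_eq_zero]
      exact ⟨_, rfl⟩)

theorem topIndEquiv_toTop (x : D.Ind X) : D.topIndEquiv X (D.toTop _ x) = x.1 := rfl

theorem toTop_unit_topIndEquiv (q : D.Top (D.Ind X)) :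
    D.toTop _ (D.unit X (D.topIndEquiv X q)) = q := (D.topIndEquiv X).symm_apply_apply q

variable (M) in
/-- A criterion for a module to be isomorphic to the module induced by its quotient. -/
def IsInduced : Prop :=
  (∃ s : D.Top M →ₛₗ[D.ι] M, ∀ q, D.toTop M (s q) = q) ∧
    ∀ m : I → M, ∑ i, D.ε i • m i = 0 → ∀ i, D.ι (D.f i) • m i ∈ D.rad M

variable (X) in
theorem isInduced_ind : D.IsInduced (D.Ind X) := by
  refine ⟨⟨{ toFun := fun q => D.unit X (D.topIndEquiv X q)
             map_add' := fun x y => by rw [map_add, map_add]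
             map_smul' := fun r x => by rw [map_smul, map_smulₛₗ] }, D.toTop_unit_topIndEquiv⟩, ?_⟩
  intro m hm i
  rw [← toTop_eq_zero, ← (D.topIndEquiv X).map_eq_zero_iff, topIndEquiv_toTop, Ind.smul_fst, D.π_ι,
    ← D.sum_snd, hm]
  rfl

/-- This explains the form of `IsInduced`: a section of `toTop` and an injectivity condition both
pass to retracts directly, so summands of induced modules are seen to be induced without any
uniqueness of decompositions. -/
theorem IsInduced.of_retract {N : Type u} [AddCommGroup N] [Module C N] (hM : D.IsInduced M)
    (i : N →ₗ[C] M) (p : M →ₗ[C] N) (h : ∀ x, p (i x) = x) : D.IsInduced N := by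
  obtain ⟨⟨s, hs⟩, hM⟩ := hM
  refine ⟨⟨{ toFun := fun q => p (s (D.mapTop i q))
             map_add' := fun x y => by simp only [map_add]
             map_smul' := fun r x => by rw [map_smul, map_smulₛₗ, map_smul] }, ?_⟩, ?_⟩
  · intro q
    change D.toTop N (p (s (D.mapTop i q))) = q
    rw [← mapTop_toTop, hs]
    obtain ⟨x, rfl⟩ := D.toTop_surjective q
    rw [mapTop_toTop, mapTop_toTop, h]
  · intro m hm j
    have := D.map_mem_rad p (hM (fun l => i (m l)) (by
      simp only [← map_smul, ← map_sum, hm, map_zero]) j)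
    rwa [map_smul, h] at this

/-- The isomorphism is `lift s`. It is surjective because M is s(M / E M) + E M and, as E² = 0, the
product ε i • y depends only on y modulo E M. Applying `toTop` shows that an element of the kernel
has zero first component; the second condition of `IsInduced` then kills the others. -/
theorem IsInduced.nonempty_equiv (hM : D.IsInduced M) : Nonempty (D.Ind (D.Top M) ≃ₗ[C] M) := by
  obtain ⟨⟨s, hs⟩, hM⟩ := hM
  refine ⟨LinearEquiv.ofBijective (D.lift s) ⟨?_, fun m => ?_⟩⟩
  · rw [injective_iff_map_eq_zero]
    intro x hx
    rw [lift_apply] at hx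
    have h1 : x.1 = 0 := by
      have := congrArg (D.toTop M) hx
      rwa [map_add, hs, map_zero, (D.toTop_eq_zero).mpr ⟨_, rfl⟩, add_zero] at this
    rw [h1, map_zero, zero_add] at hx
    refine Ind.ext D h1 fun i => ?_
    have := hM _ hx i
    rwa [← map_smulₛₗ, (x.2 i).2, ← toTop_eq_zero, hs] at this
  · have h1 : m - s (D.toTop M m) ∈ D.rad M := by
      rw [← toTop_eq_zero, map_sub, hs, sub_self]
    obtain ⟨y, hy⟩ := h1
    refine ⟨(D.toTop M m, fun i => D.toFiber i (D.f_mul_f i) (D.toTop M (y i))), ?_⟩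
    change s (D.toTop M m) + ∑ i, D.ε i • s (D.f i • D.toTop M (y i)) = m
    rw [← eq_sub_iff_add_eq', hy]
    refine Finset.sum_congr rfl fun i _ => ?_
    rw [map_smulₛₗ, smul_smul, D.ε_mul_f, ← sub_eq_zero, ← smul_sub]
    refine D.smul_rad (D.π_ε i) ?_
    rw [← toTop_eq_zero, map_sub, hs, sub_self]

end Modules

end SquareZeroData

/-! ### Semisimple modules -/

section Semisimple

variable {C : Type u} [Ring C] [IsArtinianRing C]

/-- The semisimple quotient `C / J` of an Artinian ring, as a module. -/
def semisimpleQuotient (C : Type u) [Ring C] : FGModuleCat.{u} C :=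
  FGModuleCat.of C (C ⧸ Module.jacobson C C)

/-- A nonzero element of S gives a surjection from C onto S. It kills the Jacobson radical, and the
induced surjection from the semisimple module C / J splits. -/
theorem isSummand_of_isSimpleModule (S : FGModuleCat.{u} C) [IsSimpleModule C S] :
    IsSummand S (semisimpleQuotient C) := by
  have : IsSemisimpleModule C (C ⧸ Module.jacobson C C) :=
    (IsArtinian.isSemisimpleModule_iff_jacobson C _).mpr (Module.jacobson_quotient_jacobson C C)
  have : Nontrivial S := IsSimpleModule.nontrivial C S
  obtain ⟨x, hx⟩ := exists_ne (0 : S)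
  let g : C →ₗ[C] S := LinearMap.toSpanSingleton C S x
  have hg : Function.Surjective g := IsSimpleModule.toSpanSingleton_surjective C hx
  have hker : Module.jacobson C C ≤ LinearMap.ker g := by
    apply IsSemisimpleModule.jacobson_le_ker
  let g' : (C ⧸ Module.jacobson C C) →ₗ[C] S := (Module.jacobson C C).liftQ g hker
  have hg' : Function.Surjective g' := fun y => by
    obtain ⟨c, rfl⟩ := hg y
    exact ⟨Submodule.Quotient.mk c, rfl⟩
  obtain ⟨h, hh⟩ := IsSemisimpleModule.lifting_property g' hg' LinearMap.id
  exact IsSummand.of_retract (M := semisimpleQuotient C) h g' (LinearMap.congr_fun hh)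

theorem mem_addClosure_of_isSemisimpleModule (S : FGModuleCat.{u} C) [IsSemisimpleModule C S] :
    S ∈ addClosure {semisimpleQuotient C} := by
  obtain ⟨n, T, e, hT⟩ := IsSemisimpleModule.exists_linearEquiv_fin_dfinsupp C S
  refine ⟨n, fun i => FGModuleCat.of C (T i), fun i => ⟨_, rfl, ?_⟩,
    ⟨e.trans (DFinsupp.linearEquivFunOnFintype (R := C))⟩⟩
  have : IsSimpleModule C (FGModuleCat.of C (T i)) := hT i
  exact isSummand_of_isSimpleModule _

end Semisimple

/-! ### Syzygies and 0-Igusa–Todorov subcategories over a square-zero extension -/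

namespace SquareZeroData

variable {k R C I : Type u} [Field k] [Ring R] [Algebra k R] [Ring C] [Fintype I]
  (D : SquareZeroData k R C I)

/-- Submodules of induced modules are direct sums of an induced and a semisimple module. -/
theorem exists_equiv_ind_prod [IsArtinianRing R] [IsArtinianRing C] {Y : Type u} [AddCommGroup Y]
    [Module R Y] [Module.Finite R Y] (N : FGModuleCat.{u} C) (j : N →ₗ[C] D.Ind Y)
    (hj : Function.Injective j) :
    ∃ (X : FGModuleCat.{u} R) (S : FGModuleCat.{u} C), IsSemisimpleModule C S ∧
      Nonempty (N ≃ₗ[C] (D.Ind X × S)) := by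
  -- the submodule of elements that vanish in `Y`
  let L : Submodule C N :=
    { carrier := {n | (j n).1 = 0}
      add_mem' := fun {a b} (ha : (j a).1 = 0) (hb : (j b).1 = 0) => by
        change (j (a + b)).1 = 0
        rw [map_add, Ind.add_fst, ha, hb, add_zero]
      zero_mem' := by
        change (j 0).1 = 0
        rw [map_zero]; rfl
      smul_mem' := fun c a (ha : (j a).1 = 0) => by
        change (j (c • a)).1 = 0
        rw [map_smul, Ind.smul_fst, ha, smul_zero] }
  have hL : ∀ n, n ∈ L ↔ (j n).1 = 0 := fun _ => Iff.rfl
  let κ : L →ₗ[C] (∀ i, D.Fiber Y i) :=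
    { toFun := fun l => (j l).2
      map_add' := fun a b => by rw [Submodule.coe_add, map_add]; rfl
      map_smul' := fun c a => funext fun i => Subtype.ext (by
        rw [Submodule.coe_smul, map_smul, Ind.smul_snd, (hL _).mp a.2, smul_zero, add_zero]; rfl) }
  have hκ : Function.Injective κ := fun a b hab => Subtype.ext (hj (Prod.ext
    (((hL _).mp a.2).trans ((hL _).mp b.2).symm) hab))
  have hss : IsSemisimpleModule C L := .of_injective κ hκ
  -- The retraction r is defined on all second components, not only on those coming from L, so n ↦
  -- `r (j n).2` is a projection of the whole of N onto L.
  obtain ⟨r, hr⟩ := IsSemisimpleModule.extension_property κ hκ LinearMap.id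
  have hr' : ∀ l, r (κ l) = l := LinearMap.congr_fun hr
  have hrl : ∀ n (hn : n ∈ L), r (j n).2 = ⟨n, hn⟩ := fun n hn => hr' ⟨n, hn⟩
  -- a complement of this submodule over the smaller ring
  let X : Submodule R (Restrict D.ι N) :=
    { carrier := {n | r (j ((toRestrict D.ι N).symm n)).2 = 0}
      add_mem' := fun {a b} ha hb => by
        change r (j ((toRestrict D.ι N).symm (a + b))).2 = 0
        rw [map_add, map_add]
        change r ((j ((toRestrict D.ι N).symm a)).2 + (j ((toRestrict D.ι N).symm b)).2) = 0
        rw [map_add, ha, hb, add_zero]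
      zero_mem' := by
        change r (j 0).2 = 0
        rw [map_zero]
        exact map_zero r
      smul_mem' := fun s a ha => by
        change r (j (D.ι s • (toRestrict D.ι N).symm a)).2 = 0
        -- Elements of ι R act on the second component alone, because ρ vanishes on them. Other
        -- elements of C also bring in the first component, so X is only an R-submodule.
        have : (j (D.ι s • (toRestrict D.ι N).symm a)).2 =
            D.ι s • (j ((toRestrict D.ι N).symm a)).2 := funext fun i => Subtype.ext (by
          rw [map_smul, Ind.smul_snd, D.ρ_ι, zero_smul, add_zero]; rfl)
        rw [this, map_smul]
        exact (congrArg (D.ι s • ·) ha).trans (smul_zero _) }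
  let g : X →ₛₗ[D.ι] N :=
    { toFun := fun x => (toRestrict D.ι N).symm x.1
      map_add' := fun _ _ => rfl
      map_smul' := fun _ _ => rfl }
  have hgX : ∀ x, r (j (g x)).2 = 0 := fun x => x.2
  have hg0 : ∀ x, (j (g x)).1 = 0 → x = 0 := by
    intro x hx
    have h1 := hrl (g x) hx
    rw [hgX] at h1
    exact Subtype.ext (congrArg Subtype.val h1).symm
  let p : X →ₗ[R] Y :=
    { toFun := fun x => (j (g x)).1
      map_add' := fun a b => by rw [map_add, map_add]; rfl
      map_smul' := fun s a => by rw [map_smulₛₗ, map_smul, Ind.smul_fst, D.π_ι]; rfl }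
  have hp : Function.Injective p := (injective_iff_map_eq_zero p).mpr hg0
  have hXfin : Module.Finite R X := Module.Finite.of_injective p hp
  -- The first component of `j (D.lift g x)` is `p x.1`. Once this vanishes, so does `x.1`, and the
  -- remaining components are f i • p (x.2 i) = p (x.2 i); the injectivity of p finishes.
  have hlift : Function.Injective (D.lift g) := by
    rw [injective_iff_map_eq_zero]
    intro x hx
    have hx' := congrArg j hx
    rw [lift_apply, map_add, map_sum, map_zero] at hx'
    simp only [map_smul] at hx'
    have h1 : x.1 = 0 := by
      refine hg0 _ ?_
      have := congrArg Prod.fst hx'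
      change (j (g x.1)).1 + (∑ i, D.ε i • j (g (x.2 i).1)).1 = 0 at this
      rwa [D.sum_fst, add_zero] at this
    refine Ind.ext D h1 fun i => hg0 _ ?_
    rw [h1, map_zero, map_zero, zero_add] at hx'
    have := congrArg (fun z => (z.2 i).1) hx'
    change ((∑ i, D.ε i • j (g (x.2 i).1)).2 i).1 = 0 at this
    rw [D.sum_snd] at this
    have h2 : p (D.f i • (x.2 i).1) = 0 := by rw [map_smul]; exact this
    rw [(x.2 i).2] at h2
    exact h2
  -- The image of Ind X may meet L, so S is chosen as a complement of the intersection inside the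
  -- semisimple module L.
  obtain ⟨S, hS⟩ := exists_isCompl ((LinearMap.range (D.lift g)).comap L.subtype)
  let Φ : (D.Ind X × S) →ₗ[C] N := (D.lift g).coprod (L.subtype.comp S.subtype)
  refine ⟨FGModuleCat.of R X, FGModuleCat.of C S, inferInstanceAs (IsSemisimpleModule C S),
    ⟨(LinearEquiv.ofBijective Φ ⟨?_, fun n => ?_⟩).symm⟩⟩
  · rw [injective_iff_map_eq_zero]
    rintro ⟨x, s⟩ hxs
    have hxs' : D.lift g x + s.1.1 = 0 := hxs
    have h1 : s.1 ∈ (LinearMap.range (D.lift g)).comap L.subtype :=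
      ⟨-x, by rw [map_neg]; exact neg_eq_of_add_eq_zero_right hxs'⟩
    have h2 : s.1 = 0 := (Submodule.disjoint_def.mp hS.disjoint) _ h1 s.2
    rw [h2] at hxs'
    have h3 : D.lift g x = 0 := by simpa using hxs'
    exact Prod.ext ((injective_iff_map_eq_zero _).mp hlift _ h3) (Subtype.ext h2)
  · have hl : r (j n).2 ∈ (LinearMap.range (D.lift g)).comap L.subtype ⊔ S :=
      hS.codisjoint.eq_top ▸ Submodule.mem_top
    obtain ⟨a, ⟨x, hx⟩, s, hs, has⟩ := Submodule.mem_sup.mp hl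
    -- Subtracting from n its projection to L leaves an element of X, and L itself is spanned by S
    -- and its intersection with the image of `lift g`.
    have hmem : r (j (n - (r (j n).2).1)).2 = 0 := by
      have h1 : (j (n - (r (j n).2).1)).2 = (j n).2 - (j (r (j n).2).1).2 := by
        rw [map_sub]; rfl
      rw [h1, map_sub, hrl _ (r (j n).2).2, sub_self]
    let y : X := ⟨toRestrict D.ι N (n - (r (j n).2).1), hmem⟩
    refine ⟨(D.unit X y + x, ⟨s, hs⟩), ?_⟩
    change D.lift g (D.unit X y + x) + s.1 = n
    rw [map_add, lift_unit, hx, add_assoc]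
    change (n - (r (j n).2).1) + (a + s : L).1 = n
    rw [has, sub_add_cancel]

/-- Every finitely generated module is a quotient of an induced module. -/
theorem exists_lift_surjective (P : FGModuleCat.{u} C) :
    ∃ (Y : FGModuleCat.{u} R) (g : D.Ind Y →ₗ[C] P), Function.Surjective g := by
  obtain ⟨m, h, hh⟩ := Module.Finite.exists_fin' C P
  let q : (Fin m → R) →ₛₗ[D.ι] P :=
    { toFun := fun v => h fun i => D.ι (v i)
      map_add' := fun v w => by
        rw [← map_add]
        congr 1
        funext i
        exact map_add D.ι _ _
      map_smul' := fun r v => by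
        rw [← map_smul]
        congr 1
        funext i
        exact map_mul D.ι _ _ }
  refine ⟨FGModuleCat.of R (Fin m → R), D.lift q, ?_⟩
  rw [← LinearMap.range_eq_top, eq_top_iff, ← LinearMap.range_eq_top.mpr hh,
    LinearMap.range_eq_map, ← (Pi.basisFun C (Fin m)).span_eq, Submodule.map_span,
    Submodule.span_le]
  rintro _ ⟨_, ⟨i, rfl⟩, rfl⟩
  refine ⟨D.unit _ (Pi.single i 1), ?_⟩
  rw [lift_unit]
  change h (fun l => D.ι ((Pi.single i 1 : Fin m → R) l)) = _
  congr 1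
  funext l
  rw [Pi.basisFun_apply]
  rcases eq_or_ne l i with rfl | hl
  · simp
  · simp [hl]

/-- Syzygies are direct sums of an induced and a semisimple module. -/
theorem exists_syzygy_equiv [IsArtinianRing R] [IsArtinianRing C] (M : FGModuleCat.{u} C) :
    ∃ (X : FGModuleCat.{u} R) (S : FGModuleCat.{u} C), IsSemisimpleModule C S ∧
      Nonempty (syzygy M ≃ₗ[C] (D.Ind X × S)) := by
  obtain ⟨Y, g, hg⟩ := D.exists_lift_surjective (projCover M)
  have := (projCoverMap_spec M).1
  -- The projective module P(M) is a retract of Ind Y, so its submodule Ω(M) embeds into an induced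
  -- module.
  obtain ⟨s, hs⟩ := Module.projective_lifting_property g LinearMap.id hg
  have hs' : ∀ x, g (s x) = x := LinearMap.congr_fun hs
  exact D.exists_equiv_ind_prod (syzygy M) (s.comp (LinearMap.ker (projCoverMap M)).subtype)
    ((Function.LeftInverse.injective hs').comp Subtype.val_injective)

/-! #### Induction and restriction as functors -/

/-- The functor `X ↦ C ⊗ X`. -/
def ind : ModFunctor R C where
  obj X := FGModuleCat.of C (D.Ind X)
  map g := D.mapInd g
  map_id _ := rfl
  map_comp _ _ := rfl
  map_add _ _ := rfl

/-- The functor `M ↦ M / E M`. -/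
def top : ModFunctor C R where
  obj M := FGModuleCat.of R (D.Top M)
  map g := D.mapTop g
  map_id _ := D.top_hom_ext fun _ => rfl
  map_comp _ _ := D.top_hom_ext fun _ => rfl
  map_add _ _ := D.top_hom_ext fun _ => map_add (D.toTop _) _ _

/-- The functors X ↦ f i X are exact since `f i` is idempotent: a preimage of an element of the
fiber is moved into the fiber by multiplying it with `f i`. -/
theorem ind_isExact : D.ind.IsExact where
  injective g hg x y h := Ind.ext D (hg (congrArg Prod.fst h)) fun i =>
    hg (congrArg (fun z => (z.2 i).1) h)
  exact g h hgh x := by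
    constructor
    · intro hx
      obtain ⟨y, hy⟩ := (hgh x.1).mp (congrArg Prod.fst hx)
      choose z hz using fun i => (hgh (x.2 i).1).mp (congrArg (fun z => (z.2 i).1) hx)
      refine ⟨(y, fun i => D.toFiber i (D.f_mul_f i) (z i)), Ind.ext D hy fun i => ?_⟩
      change g (D.f i • z i) = (x.2 i).1
      rw [map_smul, hz, (x.2 i).2]
    · rintro ⟨y, rfl⟩
      exact Ind.ext D (hgh.apply_apply_eq_zero _) fun i => hgh.apply_apply_eq_zero _
  surjective _ hg := D.mapInd_surjective hg

theorem ind_preservesCover : D.ind.PreservesCover := fun _ _ _ hg => D.mapInd_isProjectiveCover hg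

theorem ind_preservesProjective : D.ind.PreservesProjective := fun P _ =>
  Ind.projective D (P := P)

theorem top_preservesProjective : D.top.PreservesProjective := fun P _ =>
  Top.projective D (P := P)

open ModFunctor

theorem K0map_top_ind (x : K0 R) :
    K0map D.top_preservesProjective (K0map D.ind_preservesProjective x) = x := by
  refine DFunLike.congr_fun
    (f := (K0map D.top_preservesProjective).comp (K0map D.ind_preservesProjective))
    (g := AddMonoidHom.id _) (K0_hom_ext fun X => ?_) x
  rw [AddMonoidHom.comp_apply, K0map_cls, K0map_cls]
  exact cls_congr (D.topIndEquiv X)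

/-- The induced modules coming from a given class. -/
def indClass (E : Set (FGModuleCat.{u} R)) : Set (FGModuleCat.{u} C) :=
  {M | D.IsInduced M ∧ D.top.obj M ∈ E}

theorem indClass_subsingleton :
    D.indClass {M : FGModuleCat.{u} R | Subsingleton M} =
      {M : FGModuleCat.{u} C | Subsingleton M} := by
  ext M
  constructor
  · rintro ⟨h, hM⟩
    obtain ⟨e⟩ := h.nonempty_equiv
    have : Subsingleton (D.top.obj M) := hM
    have : Subsingleton (D.Ind (D.Top M)) := D.ind.obj_subsingleton (D.top.obj M)
    exact e.symm.toEquiv.subsingleton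
  · intro (hM : Subsingleton M)
    refine ⟨⟨⟨0, fun q => ?_⟩, fun m _ i => ?_⟩, D.top.obj_subsingleton M⟩
    · have := D.top.obj_subsingleton M
      exact Subsingleton.elim (α := D.top.obj M) _ _
    · rw [Subsingleton.elim (D.ι (D.f i) • m i) 0]
      exact zero_mem _

variable {D} in
theorem IsInduced.congr {M N : FGModuleCat.{u} C} (hM : D.IsInduced M) (e : M ≃ₗ[C] N) :
    D.IsInduced N :=
  hM.of_retract D e.symm.toLinearMap e.toLinearMap fun x => by simp

variable [IsArtinianRing R] {E : Set (FGModuleCat.{u} R)}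

theorem ind_mem_indClass (hE : IsZeroIT E) {X : FGModuleCat.{u} R} (hX : X ∈ E) :
    D.ind.obj X ∈ D.indClass E :=
  ⟨D.isInduced_ind X, hE.congr (D.topIndEquiv X).symm hX⟩

theorem mem_indClass_congr (hE : IsZeroIT E) {M N : FGModuleCat.{u} C} (e : M ≃ₗ[C] N)
    (hM : M ∈ D.indClass E) : N ∈ D.indClass E :=
  ⟨hM.1.congr e, hE.congr (D.top.mapEquiv e) hM.2⟩

variable [IsArtinianRing C]

/-- Induction commutes with Ω and is inverse to `top` on induced modules, so all conditions are
transported from E. For φ, injectivity of Ω̄ is transported along the injective map induced on K₀.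
-/
theorem indClass_isZeroIT (hE : IsZeroIT E) : IsZeroIT (D.indClass E) where
  add_eq := by
    refine eq_addClosure ?_ ?_ ?_
    · intro M hM
      have hM' : M ∈ {M : FGModuleCat.{u} C | Subsingleton M} := hM
      rw [← D.indClass_subsingleton] at hM'
      have : Subsingleton (D.top.obj M) := hM'.2
      exact ⟨hM'.1, hE.of_subsingleton _⟩
    · intro X Y hXY hY
      obtain ⟨i, p, hip⟩ := hXY.exists_retract
      exact ⟨hY.1.of_retract D i p hip, hE.of_isSummand (D.top.isSummand_obj hXY) hY.2⟩
    · intro X Y hX hY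
      obtain ⟨e₁⟩ := hX.1.nonempty_equiv
      obtain ⟨e₂⟩ := hY.1.nonempty_equiv
      let d := D.ind.prodEquiv (D.top.obj X) (D.top.obj Y)
      refine D.mem_indClass_congr hE (N := FGModuleCat.of C (X × Y)) (d.trans (e₁.prodCongr e₂))
        (D.ind_mem_indClass hE (hE.prod hX.2 hY.2))
  syzygy_mem := by
    intro M hM
    obtain ⟨e⟩ := hM.1.nonempty_equiv
    obtain ⟨d⟩ := syzygy_congr (M := D.ind.obj (D.top.obj M)) e
    obtain ⟨d'⟩ := D.ind_preservesCover.nonempty_syzygy_equiv D.ind_isExact (D.top.obj M)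
    exact D.mem_indClass_congr hE (d'.symm.trans d)
      (D.ind_mem_indClass hE (hE.syzygy_mem _ hM.2))
  phiDim_eq := by
    rw [phiDim_eq_zero_iff]
    intro M hM
    rw [phi_eq_zero_iff]
    have hc := D.ind_preservesCover
    let Φ := K0map hc.preservesProjective
    let Ψ := K0map D.top_preservesProjective
    have hΨΦ : ∀ x, Ψ (Φ x) = x := D.K0map_top_ind
    -- Summands of the induced module M are induced, hence recovered from their quotients.
    have key : ∀ x ∈ addSubgroupOf M, Φ (Ψ x) = x := by
      intro x hx
      refine (AddSubgroup.closure_le ((Φ.comp Ψ).eqLocus (AddMonoidHom.id _))).mpr ?_ hx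
      rintro _ ⟨N, -, hN, rfl⟩
      change Φ (Ψ (cls N)) = cls N
      obtain ⟨i, p, hip⟩ := hN.exists_retract
      obtain ⟨e⟩ := (hM.1.of_retract D i p hip).nonempty_equiv
      rw [K0map_cls, K0map_cls]
      exact cls_congr (M := D.ind.obj (D.top.obj N)) e
    have hiter : ∀ m, ∀ x ∈ addSubgroupOf M,
        (omegaBar C)^[m] x = Φ ((omegaBar R)^[m] (Ψ x)) := by
      intro m x hx
      rw [hc.K0map_iterate_omegaBar D.ind_isExact]
      exact congrArg _ (key x hx).symm
    rintro m _ ⟨x, hx, rfl⟩ _ ⟨y, hy, rfl⟩ hxy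
    rw [hiter m x hx, hiter m y hy] at hxy ⊢
    congr 1
    refine hE.injOn hM.2 m ⟨_, K0map_mem_addSubgroupOf _ hx, rfl⟩
      ⟨_, K0map_mem_addSubgroupOf _ hy, rfl⟩ ?_
    have h1 := hc.K0map_omegaBar D.ind_isExact ((omegaBar R)^[m] (Ψ x))
    have h2 := hc.K0map_omegaBar D.ind_isExact ((omegaBar R)^[m] (Ψ y))
    -- Here Ψ serves only to cancel Φ; no compatibility of `top` with Ω is needed.
    have := congrArg Ψ ((h1.trans hxy).trans h2.symm)
    rwa [hΨΦ, hΨΦ] at this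

/-- A split extension by a square-zero ideal as above is `(n + 1)`-LIT if `R` is `n`-LIT. -/
theorem isLITWith {n : ℕ} {V : FGModuleCat.{u} R} (hV : IsLITWith n V E Set.univ) :
    IsLITWith (n + 1)
      (FGModuleCat.of C (D.ind.obj V × (syzygy^[n] (semisimpleQuotient C) : FGModuleCat.{u} C)))
      (D.indClass E) Set.univ := by
  have hE := hV.1
  have hC := D.indClass_isZeroIT hE
  refine ⟨hC, fun M _ => ?_⟩
  -- One syzygy is spent to reach the form Ind X ⊕ S; the remaining n are applied to each summand.
  obtain ⟨X, S, hS, ⟨e⟩⟩ := D.exists_syzygy_equiv M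
  obtain ⟨e₁⟩ := iterate_syzygy_congr n (N := FGModuleCat.of C (D.ind.obj X × S)) e
  obtain ⟨e₂⟩ := iterate_syzygy_prod n (D.ind.obj X) S
  obtain ⟨e₃⟩ := D.ind_preservesCover.nonempty_iterate_syzygy_equiv D.ind_isExact n X
  let W := FGModuleCat.of C (D.ind.obj V × (syzygy^[n] (semisimpleQuotient C) : FGModuleCat.{u} C))
  have h₁ : IsLITPresented W (D.indClass E) (syzygy^[n] (D.ind.obj X)) :=
    IsLITPresented.congr (IsLITPresented.map D.ind_isExact (IsSummand.fst _ _)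
      (fun _ hX => D.ind_mem_indClass hE hX)
      (show IsLITPresented V E (syzygy^[n] X) from hV.2 X trivial)) e₃.symm
  -- S lies in add (C/J), so its n-th syzygy lies in add W and needs only a presentation with zero
  -- kernel.
  have h₂ : IsLITPresented W (D.indClass E) (syzygy^[n] S) := by
    refine IsLITPresented.of_mem_addClosure (fun Z _ => hC.of_subsingleton Z) ?_
    refine addClosure_mono ?_
      (iterate_syzygy_mem_addClosure n (mem_addClosure_of_isSemisimpleModule S))
    rintro _ rfl
    exact ⟨W, rfl, IsSummand.snd _ _⟩
  exact IsLITPresented.congr (h₁.prod (fun _ _ => hC.prod) h₂) (e₁.trans e₂).symm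

end SquareZeroData

end IgusaTodorov

/-! ### Homomorphisms from path algebras -/

namespace PathAlgebra

variable {k : Type u} [Field k] {V : Type u} [Quiver.{u} V]

theorem ofPath_cons {a b c : V} (p : Quiver.Path a b) (e : b ⟶ c) :
    (ofPath (p.cons e) : PathAlgebra k V) = ofPath p * ofArrow e := by
  rw [ofArrow, ofPath_mul_ofPath]
  rfl

theorem smul_mul' (c : k) (x y : PathAlgebra k V) : c • x * y = c • (x * y) := by
  simp [mul_def]

/-- An additive property that holds for multiples of trivial paths and is preserved by
multiplication with arrows holds for all elements. -/
theorem induction_arrows {motive : PathAlgebra k V → Prop} (x : PathAlgebra k V)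
    (zero : motive 0) (add : ∀ x y, motive x → motive y → motive (x + y))
    (vertex : ∀ (c : k) (v : V), motive (c • ofPath (Quiver.Path.nil : Quiver.Path v v)))
    (arrow : ∀ (x : PathAlgebra k V) (v w : V) (e : v ⟶ w), motive x → motive (x * ofArrow e)) :
    motive x := by
  induction x using induction_paths with
  | zero => exact zero
  | add x y hx hy => exact add x y hx hy
  | path c a b p =>
    induction p with
    | nil => exact vertex c a
    | cons p e ih =>
      rw [ofPath_cons, ← smul_mul']
      exact arrow _ _ _ e ih

/-- Images of vertices and arrows in an algebra which define a homomorphism from the path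
algebra. -/
structure LiftData (V T : Type u) [Quiver.{u} V] [Fintype V] [Ring T] where
  vertex : V → T
  arrow : ∀ {v w : V}, (v ⟶ w) → T
  vertex_mul_self : ∀ v, vertex v * vertex v = vertex v
  vertex_mul_of_ne : ∀ v w, v ≠ w → vertex v * vertex w = 0
  sum_vertex : ∑ v, vertex v = 1
  vertex_mul_arrow : ∀ {v w : V} (e : v ⟶ w), vertex v * arrow e = arrow e
  arrow_mul_vertex : ∀ {v w : V} (e : v ⟶ w), arrow e * vertex w = arrow e

namespace LiftData

variable [Fintype V] {T : Type u} [Ring T] [Algebra k T] (d : LiftData V T)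

/-- The image of a path. -/
def path {a : V} : ∀ {b : V}, Quiver.Path a b → T
  | _, Quiver.Path.nil => d.vertex a
  | _, Quiver.Path.cons p e => path p * d.arrow e

theorem vertex_mul_path {a b : V} (p : Quiver.Path a b) : d.vertex a * d.path p = d.path p := by
  induction p with
  | nil => exact d.vertex_mul_self a
  | cons p e ih =>
    change d.vertex a * (d.path p * d.arrow e) = d.path p * d.arrow e
    rw [← mul_assoc, ih]

theorem path_mul_vertex {a b : V} (p : Quiver.Path a b) : d.path p * d.vertex b = d.path p := by
  cases p with
  | nil => exact d.vertex_mul_self a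
  | cons p e =>
    change d.path p * d.arrow e * _ = d.path p * d.arrow e
    rw [mul_assoc, d.arrow_mul_vertex]

theorem path_comp {a b c : V} (p : Quiver.Path a b) (q : Quiver.Path b c) :
    d.path (p.comp q) = d.path p * d.path q := by
  induction q with
  | nil => exact (d.path_mul_vertex p).symm
  | cons q e ih =>
    change d.path (p.comp q) * d.arrow e = d.path p * (d.path q * d.arrow e)
    rw [ih, mul_assoc]

theorem path_mul_path_of_ne {a b c e : V} (p : Quiver.Path a b) (q : Quiver.Path c e)
    (h : c ≠ b) : d.path p * d.path q = 0 := by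
  rw [← d.path_mul_vertex p, ← d.vertex_mul_path q, mul_assoc, ← mul_assoc (d.vertex b),
    d.vertex_mul_of_ne _ _ h.symm, zero_mul, mul_zero]

/-- The linear extension of the images of paths. -/
def liftLin : PathAlgebra k V →ₗ[k] T :=
  Finsupp.linearCombination k fun p : QuiverPath V => d.path p.2.2

theorem liftLin_ofPath {a b : V} (p : Quiver.Path a b) :
    d.liftLin (ofPath p : PathAlgebra k V) = d.path p :=
  (Finsupp.linearCombination_single k (1 : k) (⟨a, b, p⟩ : QuiverPath V)).trans (one_smul _ _)

/-- The homomorphism from the path algebra. -/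
def lift : PathAlgebra k V →ₐ[k] T :=
  AlgHom.ofLinearMap d.liftLin
    (by
      rw [one_def, map_sum, ← d.sum_vertex]
      exact Finset.sum_congr rfl fun v _ => d.liftLin_ofPath _)
    (fun x y => by
      induction x using induction_paths with
      | zero => simp
      | add x x' hx hx' => rw [add_mul, map_add, hx, hx', map_add, add_mul]
      | path c a b p =>
        rw [smul_mul', map_smul, map_smul, smul_mul_assoc]
        congr 1
        induction y using induction_paths with
        | zero => simp
        | add y y' hy hy' => rw [mul_add, map_add, hy, hy', map_add, mul_add]
        | path c' a' b' p' =>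
          rw [mul_smul_comm, map_smul, map_smul, mul_smul_comm]
          congr 1
          rw [liftLin_ofPath, liftLin_ofPath]
          by_cases h : a' = b
          · subst h
            rw [ofPath_mul_ofPath, liftLin_ofPath, path_comp]
          · rw [ofPath_mul_ofPath_of_ne _ _ h, map_zero, path_mul_path_of_ne _ _ _ h])

theorem lift_vertex (v : V) :
    d.lift (ofPath (Quiver.Path.nil : Quiver.Path v v) : PathAlgebra k V) = d.vertex v :=
  d.liftLin_ofPath _

theorem lift_arrow {v w : V} (e : v ⟶ w) :
    d.lift (ofArrow e : PathAlgebra k V) = d.arrow e := by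
  refine (d.liftLin_ofPath e.toPath).trans ?_
  change d.vertex v * d.arrow e = d.arrow e
  exact d.vertex_mul_arrow e

end LiftData

theorem map_ofPath {W : Type u} [Quiver.{u} W] (F : V ⥤q W) {a b : V} (p : Quiver.Path a b) :
    map F (ofPath p : PathAlgebra k V) = ofPath (F.mapPath p) :=
  (Finsupp.linearCombination_single k (1 : k) (⟨a, b, p⟩ : QuiverPath V)).trans (one_smul _ _)

/-- The morphism of path algebras induced by a morphism of quivers is multiplicative if the latter
is injective on vertices. -/
def mapHom {W : Type u} [Quiver.{u} W] (F : V ⥤q W) (hF : Function.Injective F.obj) :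
    PathAlgebra k V →ₙ+* PathAlgebra k W :=
  { (map F).toAddMonoidHom with
    map_zero' := map_zero (map F)
    map_mul' := fun x y => by
      change map F (x * y) = map F x * map F y
      induction x using induction_paths with
      | zero => simp
      | add x x' hx hx' => rw [add_mul, map_add, hx, hx', map_add, add_mul]
      | path c a b p =>
        rw [smul_mul', map_smul, map_smul, smul_mul']
        congr 1
        induction y using induction_paths with
        | zero => simp
        | add y y' hy hy' => rw [mul_add, map_add, hy, hy', map_add, mul_add]
        | path c' a' b' p' =>
          have h : ∀ {U : Type u} [Quiver.{u} U] (x y : PathAlgebra k U),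
              x * (c' • y) = c' • (x * y) := by
            intro U _ x y
            simp [mul_def]
          rw [h, map_smul, map_smul, h]
          congr 1
          rw [map_ofPath, map_ofPath]
          by_cases h : a' = b
          · subst h
            rw [ofPath_mul_ofPath, map_ofPath, Prefunctor.mapPath_comp, ofPath_mul_ofPath]
          · rw [ofPath_mul_ofPath_of_ne _ _ h, map_zero,
              ofPath_mul_ofPath_of_ne _ _ fun h' => h (hF h')] }

theorem mapHom_apply {W : Type u} [Quiver.{u} W] (F : V ⥤q W) (hF : Function.Injective F.obj)
    (x : PathAlgebra k V) : mapHom F hF x = map F x := rfl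

theorem map_vertex {W : Type u} [Quiver.{u} W] (F : V ⥤q W) (v : V) :
    map F (ofPath (Quiver.Path.nil : Quiver.Path v v) : PathAlgebra k V) =
      ofPath (Quiver.Path.nil : Quiver.Path (F.obj v) (F.obj v)) :=
  map_ofPath F _

theorem map_arrow {W : Type u} [Quiver.{u} W] (F : V ⥤q W) {v w : V} (e : v ⟶ w) :
    map F (ofArrow e : PathAlgebra k V) = ofArrow (F.map e) := by
  rw [ofArrow, map_ofPath, Prefunctor.mapPath_toPath]
  rfl

end PathAlgebra

/-- Homomorphisms of non-unital rings descend to quotients by two-sided ideals. -/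
def TwoSidedIdeal.liftNonUnital {R S : Type u} [Ring R] [Ring S] (I : TwoSidedIdeal R)
    (φ : R →ₙ+* S) (h : ∀ x ∈ I, φ x = 0) : I.ringCon.Quotient →ₙ+* S where
  toFun := Quotient.lift φ fun a b hab => by
    rw [← sub_eq_zero, ← map_sub]
    exact h _ ((TwoSidedIdeal.rel_iff I a b).mp hab)
  map_mul' := by
    rintro ⟨a⟩ ⟨b⟩
    exact map_mul φ a b
  map_zero' := map_zero φ
  map_add' := by
    rintro ⟨a⟩ ⟨b⟩
    exact map_add φ a b

namespace IgusaTodorov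

/-! ### The extension of an algebra by twisted copies of itself -/

/-- The `k`-algebra `R ⊕ R ^ I` with `R ^ I` an ideal of square zero, on which `R` acts from the
left through characters. -/
def TwistedExt {k R I : Type u} [Field k] [Ring R] [Algebra k R] (_χ : I → R →ₐ[k] k) : Type u :=
  R × (I → R)

namespace TwistedExt

variable {k R I : Type u} [Field k] [Ring R] [Algebra k R] (χ : I → R →ₐ[k] k)

instance : AddCommGroup (TwistedExt χ) := inferInstanceAs (AddCommGroup (R × (I → R)))

instance : Module k (TwistedExt χ) := inferInstanceAs (Module k (R × (I → R)))

instance : Mul (TwistedExt χ) :=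
  ⟨fun x y => (x.1 * y.1, fun i => x.2 i * y.1 + χ i x.1 • y.2 i)⟩

instance : One (TwistedExt χ) := ⟨(1, 0)⟩

variable {χ}

theorem ext {x y : TwistedExt χ} (h₁ : x.1 = y.1) (h₂ : ∀ i, x.2 i = y.2 i) : x = y :=
  Prod.ext h₁ (funext h₂)

theorem mul_fst (x y : TwistedExt χ) : (x * y).1 = x.1 * y.1 := rfl

theorem mul_snd (x y : TwistedExt χ) (i : I) :
    (x * y).2 i = x.2 i * y.1 + χ i x.1 • y.2 i := rfl

theorem add_fst (x y : TwistedExt χ) : (x + y).1 = x.1 + y.1 := rfl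

theorem add_snd (x y : TwistedExt χ) (i : I) : (x + y).2 i = x.2 i + y.2 i := rfl

theorem smul_fst (c : k) (x : TwistedExt χ) : (c • x).1 = c • x.1 := rfl

theorem smul_snd (c : k) (x : TwistedExt χ) (i : I) : (c • x).2 i = c • x.2 i := rfl

theorem zero_fst : (0 : TwistedExt χ).1 = 0 := rfl

theorem zero_snd (i : I) : (0 : TwistedExt χ).2 i = 0 := rfl

theorem one_fst : (1 : TwistedExt χ).1 = 1 := rfl

theorem one_snd (i : I) : (1 : TwistedExt χ).2 i = 0 := rfl

instance : Ring (TwistedExt χ) :=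
  { (inferInstance : AddCommGroup (TwistedExt χ)), (inferInstance : Mul (TwistedExt χ)),
    (inferInstance : One (TwistedExt χ)) with
    left_distrib := fun x y z => ext (mul_add _ _ _) fun i => by
      simp only [mul_snd, add_fst, add_snd, mul_add, smul_add]
      abel
    right_distrib := fun x y z => ext (add_mul _ _ _) fun i => by
      simp only [mul_snd, add_fst, add_snd, add_mul, map_add, add_smul]
      abel
    zero_mul := fun x => ext (zero_mul _) fun i => by
      simp [mul_snd, zero_fst, zero_snd]
    mul_zero := fun x => ext (mul_zero _) fun i => by
      simp [mul_snd, zero_fst, zero_snd]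
    mul_assoc := fun x y z => ext (mul_assoc _ _ _) fun i => by
      simp only [mul_snd, mul_fst, add_mul, smul_add, map_mul, mul_smul, mul_assoc, smul_mul_assoc]
      abel
    one_mul := fun x => ext (one_mul _) fun i => by
      simp [mul_snd, one_fst, one_snd]
    mul_one := fun x => ext (mul_one _) fun i => by
      simp [mul_snd, one_fst, one_snd] }

instance : Algebra k (TwistedExt χ) :=
  Algebra.ofModule
    (fun c x y => ext (smul_mul_assoc _ _ _) fun i => by
      simp only [mul_snd, smul_fst, smul_snd, map_smul, smul_add, smul_mul_assoc, smul_assoc])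
    (fun c x y => ext (mul_smul_comm _ _ _) fun i => by
      simp only [mul_snd, smul_fst, smul_snd, smul_add, mul_smul_comm]
      rw [smul_comm])

variable (χ) in
/-- The inclusion of the subalgebra `R`. -/
def inl : R →+* TwistedExt χ where
  toFun r := (r, 0)
  map_one' := rfl
  map_zero' := rfl
  map_add' _ _ := ext rfl fun _ => (add_zero _).symm
  map_mul' r s := ext rfl fun i => by
    change (0 : R) = 0 * s + χ i r • (0 : R)
    rw [zero_mul, smul_zero, add_zero]

variable (χ) in
/-- The elements of the ideal. -/
def inr (y : I → R) : TwistedExt χ := (0, y)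

theorem inl_fst (r : R) : (inl χ r).1 = r := rfl

theorem inl_snd (r : R) (i : I) : (inl χ r).2 i = 0 := rfl

theorem inr_fst (y : I → R) : (inr χ y).1 = 0 := rfl

theorem inr_mul_inr (y z : I → R) : inr χ y * inr χ z = 0 :=
  ext (mul_zero _) fun i => by
    rw [mul_snd, inr_fst, inr_fst, mul_zero, map_zero, zero_smul, add_zero, zero_snd]

variable (χ) in
/-- The projection to `R`. -/
def fstHom : TwistedExt χ →+* R where
  toFun x := x.1
  map_one' := rfl
  map_zero' := rfl
  map_add' _ _ := rfl
  map_mul' _ _ := rfl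

end TwistedExt

end IgusaTodorov

open PathAlgebra IgusaTodorov

/-! ### Generators and vertex characters of bound quiver algebras -/

namespace BoundQuiverAlgebra

variable {k : Type u} [Field k] {V : Type u} [Quiver.{u} V] [Fintype V]
  (I : TwoSidedIdeal (PathAlgebra k V))

/-- The quotient map from the path algebra to a bound quiver algebra. -/
def mk : PathAlgebra k V →ₐ[k] BoundQuiverAlgebra I := I.ringCon.mkₐ k

theorem mk_surjective : Function.Surjective (mk I) := RingCon.mkₐ_surjective _

theorem mk_eq_zero {x : PathAlgebra k V} (hx : x ∈ I) : mk I x = 0 :=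
  (RingCon.eq I.ringCon).mpr ((TwoSidedIdeal.mem_iff I x).mp hx)

/-- Homomorphisms of algebras from bound quiver algebras. -/
def lift {T : Type u} [Ring T] [Algebra k T] (φ : PathAlgebra k V →ₐ[k] T)
    (h : ∀ x ∈ I, φ x = 0) : BoundQuiverAlgebra I →ₐ[k] T :=
  I.ringCon.liftₐ φ fun x y hxy => by
    change φ x = φ y
    rw [← sub_eq_zero, ← map_sub]
    exact h _ ((TwoSidedIdeal.rel_iff I x y).mp hxy)

/-- The class of a trivial path. -/
def vertex (v : V) : BoundQuiverAlgebra I := mk I (ofPath (Quiver.Path.nil : Quiver.Path v v))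

/-- The class of an arrow. -/
def arrow {v w : V} (e : v ⟶ w) : BoundQuiverAlgebra I := mk I (ofArrow e)

theorem vertex_mul_self (v : V) : vertex I v * vertex I v = vertex I v := by
  rw [vertex, ← map_mul, ofPath_mul_ofPath]
  rfl

theorem vertex_mul_of_ne {v w : V} (h : v ≠ w) : vertex I v * vertex I w = 0 := by
  rw [vertex, vertex, ← map_mul, ofPath_mul_ofPath_of_ne _ _ h.symm, map_zero]

theorem sum_vertex : ∑ v, vertex I v = 1 := by
  rw [← map_one (mk I), one_def, map_sum]
  rfl

theorem vertex_mul_arrow {v w : V} (e : v ⟶ w) : vertex I v * arrow I e = arrow I e := by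
  rw [vertex, arrow, ← map_mul, ofArrow, ofPath_mul_ofPath, Quiver.Path.nil_comp]

theorem arrow_mul_vertex {v w : V} (e : v ⟶ w) : arrow I e * vertex I w = arrow I e := by
  rw [vertex, arrow, ← map_mul, ofArrow, ofPath_mul_ofPath, Quiver.Path.comp_nil]

/-- An additive property that holds for multiples of vertices and is preserved by multiplication
with arrows holds for all elements. -/
theorem induction_arrows {motive : BoundQuiverAlgebra I → Prop} (x : BoundQuiverAlgebra I)
    (zero : motive 0) (add : ∀ x y, motive x → motive y → motive (x + y))
    (vertex : ∀ (c : k) (v : V), motive (c • vertex I v))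
    (mul_arrow : ∀ x (v w : V) (e : v ⟶ w), motive x → motive (x * arrow I e)) : motive x := by
  obtain ⟨x, rfl⟩ := mk_surjective I x
  induction x using PathAlgebra.induction_arrows with
  | zero => rwa [map_zero]
  | add x y hx hy => rw [map_add]; exact add _ _ hx hy
  | vertex c v => rw [map_smul]; exact vertex c v
  | arrow x v w e hx => rw [map_mul]; exact mul_arrow _ v w e hx

open Classical in
/-- The character of the path algebra attached to a vertex. -/
def characterData (k : Type u) [Field k] {V : Type u} [Quiver.{u} V] [Fintype V] (v : V) :
    LiftData V k where
  vertex w := if w = v then 1 else 0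
  arrow _ := 0
  vertex_mul_self w := by simp
  vertex_mul_of_ne w w' h := by
    by_cases h' : w = v
    · simp [← h', h.symm]
    · simp [h']
  sum_vertex := by simp
  vertex_mul_arrow e := by simp
  arrow_mul_vertex e := by simp

variable {I} (hI : I ≤ arrowIdealPow k V 2)

include hI in
-- A path of length at least 2 ends with an arrow, and arrows are sent to zero. The inclusion I ⊆ J²
-- is what makes the vertex characters descend to the quotient.
theorem characterData_lift_eq_zero (v : V) (x : PathAlgebra k V) (hx : x ∈ I) :
    (characterData k v).lift x = 0 := by
  have h : arrowIdealPow k V 2 ≤ TwoSidedIdeal.ker (characterData k v).lift := by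
    rw [arrowIdealPow, TwoSidedIdeal.span_le]
    rintro _ ⟨a, b, p, hp, rfl⟩
    change _ ∈ TwoSidedIdeal.ker _
    rw [TwoSidedIdeal.mem_ker]
    cases p with
    | nil => simp at hp
    | cons p e => rw [ofPath_cons, map_mul, LiftData.lift_arrow]; exact mul_zero _
  exact (TwoSidedIdeal.mem_ker _).mp (h (hI hx))

/-- The character of a bound quiver algebra attached to a vertex. -/
def character (v : V) : BoundQuiverAlgebra I →ₐ[k] k :=
  lift I (characterData k v).lift (characterData_lift_eq_zero hI v)

theorem character_vertex_self (v : V) : character hI v (vertex I v) = 1 :=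
  (LiftData.lift_vertex _ v).trans (if_pos rfl)

theorem character_vertex_of_ne {v w : V} (h : w ≠ v) : character hI v (vertex I w) = 0 :=
  (LiftData.lift_vertex _ w).trans (if_neg h)

theorem character_arrow (u : V) {v w : V} (e : v ⟶ w) : character hI u (arrow I e) = 0 :=
  LiftData.lift_arrow _ e

end BoundQuiverAlgebra

/-! ### From the glued algebra to an explicit split extension -/

namespace GluedQuiver

variable {k : Type u} [Field k] {VA VB : Type u} [Fintype VA] [Fintype VB] [Quiver.{u} VA]
  [Quiver.{u} VB] (J : VA → VB → Type u) (K : VB → VA → Type u)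

/-- The arrows added in a glued quiver. -/
abbrev AddedArrow : Type u := (Σ (a : VA) (b : VB), J a b) ⊕ (Σ (b : VB) (a : VA), K b a)

variable {J K} in
/-- The source of an added arrow. -/
def src : AddedArrow J K → GluedQuiver J K
  | Sum.inl x => inA J K x.1
  | Sum.inr x => inB J K x.1

variable {J K} in
/-- The target of an added arrow. -/
def tgt : AddedArrow J K → GluedQuiver J K
  | Sum.inl x => inB J K x.2.1
  | Sum.inr x => inA J K x.2.1

variable {J K} in
/-- An added arrow, as an arrow of the glued quiver. -/
def added : ∀ i : AddedArrow J K, src i ⟶ tgt i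
  | Sum.inl x => arrowAB K x.2.2
  | Sum.inr x => arrowBA J x.2.2

variable (IA : TwoSidedIdeal (PathAlgebra k VA)) (IB : TwoSidedIdeal (PathAlgebra k VB))

/-- The product of the algebras of the two quivers. -/
abbrev Base : Type u := BoundQuiverAlgebra IA × BoundQuiverAlgebra IB

open BoundQuiverAlgebra (mk vertex arrow character)

variable {J K} in
/-- The idempotent of the product algebra attached to a vertex of the glued quiver. -/
def baseVertex : GluedQuiver J K → Base IA IB
  | Sum.inl a => (vertex IA a, 0)
  | Sum.inr b => (0, vertex IB b)

variable {IA IB} (hA : IA ≤ arrowIdealPow k VA 2) (hB : IB ≤ arrowIdealPow k VB 2)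

variable {J K} in
/-- The character of the product algebra attached to a vertex of the glued quiver. -/
def baseCharacter : GluedQuiver J K → (Base IA IB →ₐ[k] k)
  | Sum.inl a => (character hA a).comp (AlgHom.fst k _ _)
  | Sum.inr b => (character hB b).comp (AlgHom.snd k _ _)

variable {J K}

theorem baseVertex_mul_self (v : GluedQuiver J K) :
    baseVertex IA IB v * baseVertex IA IB v = baseVertex IA IB v := by
  rcases v with a | b
  · exact Prod.ext (BoundQuiverAlgebra.vertex_mul_self IA a) (mul_zero _)
  · exact Prod.ext (mul_zero _) (BoundQuiverAlgebra.vertex_mul_self IB b)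

theorem baseVertex_mul_of_ne {v w : GluedQuiver J K} (h : v ≠ w) :
    baseVertex IA IB v * baseVertex IA IB w = 0 := by
  rcases v with a | b <;> rcases w with a' | b'
  · exact Prod.ext (BoundQuiverAlgebra.vertex_mul_of_ne IA fun h' => h (congrArg Sum.inl h'))
      (mul_zero _)
  · exact Prod.ext (mul_zero _) (zero_mul _)
  · exact Prod.ext (zero_mul _) (mul_zero _)
  · exact Prod.ext (mul_zero _)
      (BoundQuiverAlgebra.vertex_mul_of_ne IB fun h' => h (congrArg Sum.inr h'))

theorem sum_baseVertex : ∑ v : GluedQuiver J K, baseVertex IA IB v = 1 := by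
  refine (Fintype.sum_sum_type (fun v : VA ⊕ VB => baseVertex (J := J) (K := K) IA IB v)).trans ?_
  have h₁ : ∑ a : VA, baseVertex (J := J) (K := K) IA IB (Sum.inl a) = (1, 0) := by
    refine Prod.ext ?_ ?_
    · rw [Prod.fst_sum]
      exact BoundQuiverAlgebra.sum_vertex IA
    · rw [Prod.snd_sum]
      exact Finset.sum_const_zero
  have h₂ : ∑ b : VB, baseVertex (J := J) (K := K) IA IB (Sum.inr b) = (0, 1) := by
    refine Prod.ext ?_ ?_
    · rw [Prod.fst_sum]
      exact Finset.sum_const_zero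
    · rw [Prod.snd_sum]
      exact BoundQuiverAlgebra.sum_vertex IB
  rw [h₁, h₂]
  exact Prod.ext (add_zero _) (zero_add _)

theorem baseCharacter_vertex_self (v : GluedQuiver J K) :
    baseCharacter hA hB v (baseVertex IA IB v) = 1 := by
  rcases v with a | b
  · exact BoundQuiverAlgebra.character_vertex_self hA a
  · exact BoundQuiverAlgebra.character_vertex_self hB b

/-- The characters through which the product algebra acts on the added arrows. -/
def addedCharacter (i : AddedArrow J K) : Base IA IB →ₐ[k] k := baseCharacter hA hB (src i)

/-- The split extension of the product algebra attached to the added arrows. -/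
abbrev Ext : Type u := TwistedExt (addedCharacter (J := J) (K := K) hA hB)

open Classical in
/-- The element of the split extension corresponding to an added arrow. -/
def extArrow (i : AddedArrow J K) : Ext (J := J) (K := K) hA hB :=
  TwistedExt.inr _ (Pi.single i (baseVertex IA IB (tgt i)))

theorem extArrow_fst (i : AddedArrow J K) : (extArrow hA hB i).1 = 0 := rfl

theorem extArrow_snd_self (i : AddedArrow J K) :
    (extArrow hA hB i).2 i = baseVertex IA IB (tgt i) := by
  classical
  exact Pi.single_eq_same i _

theorem extArrow_snd_of_ne {i j : AddedArrow J K} (h : j ≠ i) : (extArrow hA hB i).2 j = 0 := by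
  classical
  exact Pi.single_eq_of_ne h _

theorem inl_mul_extArrow (r : Base IA IB) (i : AddedArrow J K) :
    TwistedExt.inl _ r * extArrow hA hB i = addedCharacter hA hB i r • extArrow hA hB i := by
  refine TwistedExt.ext ?_ fun j => ?_
  · rw [TwistedExt.mul_fst, TwistedExt.smul_fst, extArrow_fst, mul_zero, smul_zero]
  · rw [TwistedExt.mul_snd, TwistedExt.smul_snd, TwistedExt.inl_snd, TwistedExt.inl_fst, zero_mul,
      zero_add]
    rcases eq_or_ne j i with rfl | h
    · rfl
    · rw [extArrow_snd_of_ne hA hB h, smul_zero, smul_zero]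

theorem extArrow_mul_vertex (i : AddedArrow J K) :
    extArrow hA hB i * TwistedExt.inl _ (baseVertex IA IB (tgt i)) = extArrow hA hB i := by
  refine TwistedExt.ext ?_ fun j => ?_
  · rw [TwistedExt.mul_fst, extArrow_fst, zero_mul]
  · rw [TwistedExt.mul_snd, TwistedExt.inl_snd, smul_zero, add_zero, TwistedExt.inl_fst]
    rcases eq_or_ne j i with rfl | h
    · rw [extArrow_snd_self, baseVertex_mul_self]
    · rw [extArrow_snd_of_ne hA hB h, zero_mul]

theorem vertex_mul_extArrow (i : AddedArrow J K) :
    TwistedExt.inl _ (baseVertex IA IB (src i)) * extArrow hA hB i = extArrow hA hB i := by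
  rw [inl_mul_extArrow, addedCharacter, baseCharacter_vertex_self, one_smul]

theorem extArrow_mul_extArrow (i j : AddedArrow J K) :
    extArrow hA hB i * extArrow hA hB j = 0 := TwistedExt.inr_mul_inr _ _

/-- The images of the arrows of the glued quiver in the split extension. -/
def extArrowOf : ∀ {v w : GluedQuiver J K}, (v ⟶ w) → Ext (J := J) (K := K) hA hB
  | Sum.inl _, Sum.inl _, e => TwistedExt.inl _ (arrow IA e, 0)
  | Sum.inl a, Sum.inr b, e => extArrow hA hB (Sum.inl ⟨a, b, e⟩)
  | Sum.inr b, Sum.inl a, e => extArrow hA hB (Sum.inr ⟨b, a, e⟩)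
  | Sum.inr _, Sum.inr _, e => TwistedExt.inl _ (0, arrow IB e)

/-- The homomorphism from the path algebra of the glued quiver to the split extension. -/
def extData : LiftData (GluedQuiver J K) (Ext (J := J) (K := K) hA hB) where
  vertex v := TwistedExt.inl _ (baseVertex IA IB v)
  arrow e := extArrowOf hA hB e
  vertex_mul_self v := by rw [← map_mul, baseVertex_mul_self]
  vertex_mul_of_ne v w h := by rw [← map_mul, baseVertex_mul_of_ne h, map_zero]
  sum_vertex := by rw [← map_sum, sum_baseVertex, map_one]
  vertex_mul_arrow {v w} e := by
    rcases v with a | b <;> rcases w with a' | b'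
    · change TwistedExt.inl _ (vertex IA a, 0) * TwistedExt.inl _ (arrow IA e, 0) = _
      rw [← map_mul, Prod.mk_mul_mk, BoundQuiverAlgebra.vertex_mul_arrow IA e, mul_zero]
      rfl
    · exact vertex_mul_extArrow hA hB (Sum.inl ⟨a, b', e⟩)
    · exact vertex_mul_extArrow hA hB (Sum.inr ⟨b, a', e⟩)
    · change TwistedExt.inl _ (0, vertex IB b) * TwistedExt.inl _ (0, arrow IB e) = _
      rw [← map_mul, Prod.mk_mul_mk, BoundQuiverAlgebra.vertex_mul_arrow IB e, mul_zero]
      rfl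
  arrow_mul_vertex {v w} e := by
    rcases v with a | b <;> rcases w with a' | b'
    · change TwistedExt.inl _ (arrow IA e, 0) * TwistedExt.inl _ (vertex IA a', 0) = _
      rw [← map_mul, Prod.mk_mul_mk, BoundQuiverAlgebra.arrow_mul_vertex IA e, mul_zero]
      rfl
    · exact extArrow_mul_vertex hA hB (Sum.inl ⟨a, b', e⟩)
    · exact extArrow_mul_vertex hA hB (Sum.inr ⟨b, a', e⟩)
    · change TwistedExt.inl _ (0, arrow IB e) * TwistedExt.inl _ (0, vertex IB b') = _
      rw [← map_mul, Prod.mk_mul_mk, BoundQuiverAlgebra.arrow_mul_vertex IB e, mul_zero]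
      rfl

theorem extData_lift_inclA (x : PathAlgebra k VA) :
    (extData (J := J) (K := K) hA hB).lift (PathAlgebra.map (inclA J K) x) =
      TwistedExt.inl _ (mk IA x, 0) := by
  have hz : TwistedExt.inl (addedCharacter (J := J) (K := K) hA hB) (0, 0) = 0 := map_zero _
  have hinj : Function.Injective (inclA J K).obj := Sum.inl_injective
  induction x using PathAlgebra.induction_arrows with
  | zero => rw [map_zero, map_zero, map_zero, hz]
  | add x y hx hy => rw [map_add, map_add, hx, hy, ← map_add, Prod.mk_add_mk, map_add, add_zero]
  | vertex c v =>
    rw [map_smul, map_smul, map_vertex, LiftData.lift_vertex]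
    refine TwistedExt.ext (Prod.ext ?_ ?_) fun i => ?_
    · exact (map_smul (mk IA) c _).symm
    · exact smul_zero c
    · exact smul_zero c
  | arrow x v w e hx =>
    rw [← mapHom_apply _ hinj, map_mul, mapHom_apply, mapHom_apply, map_mul, hx, map_arrow,
      LiftData.lift_arrow, map_mul]
    change _ * TwistedExt.inl _ (arrow IA e, 0) = _
    rw [← map_mul, Prod.mk_mul_mk, mul_zero]
    rfl

theorem extData_lift_inclB (x : PathAlgebra k VB) :
    (extData (J := J) (K := K) hA hB).lift (PathAlgebra.map (inclB J K) x) =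
      TwistedExt.inl _ (0, mk IB x) := by
  have hz : TwistedExt.inl (addedCharacter (J := J) (K := K) hA hB) (0, 0) = 0 := map_zero _
  have hinj : Function.Injective (inclB J K).obj := Sum.inr_injective
  induction x using PathAlgebra.induction_arrows with
  | zero => rw [map_zero, map_zero, map_zero, hz]
  | add x y hx hy => rw [map_add, map_add, hx, hy, ← map_add, Prod.mk_add_mk, map_add, add_zero]
  | vertex c v =>
    rw [map_smul, map_smul, map_vertex, LiftData.lift_vertex]
    refine TwistedExt.ext (Prod.ext ?_ ?_) fun i => ?_
    · exact smul_zero c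
    · exact (map_smul (mk IB) c _).symm
    · exact smul_zero c
  | arrow x v w e hx =>
    rw [← mapHom_apply _ hinj, map_mul, mapHom_apply, mapHom_apply, map_mul, hx, map_arrow,
      LiftData.lift_arrow, map_mul]
    change _ * TwistedExt.inl _ (0, arrow IB e) = _
    rw [← map_mul, Prod.mk_mul_mk, mul_zero]
    rfl

/-- An arrow of Q_A or Q_B followed by an added arrow dies because the character at the source kills
arrows; two added arrows multiply to zero because the ideal has square zero. -/
theorem extData_lift_eq_zero (x : PathAlgebra k (GluedQuiver J K))
    (hx : x ∈ gluedIdeal J K IA IB) : (extData (J := J) (K := K) hA hB).lift x = 0 := by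
  have h : gluedIdeal J K IA IB ≤ TwoSidedIdeal.ker (extData (J := J) (K := K) hA hB).lift := by
    rw [gluedIdeal, TwoSidedIdeal.span_le]
    rintro _ (((((⟨y, hy, rfl⟩ | ⟨y, hy, rfl⟩) | ⟨a, a', b, e, j, rfl⟩) | ⟨b, b', a, e, l, rfl⟩) |
      ⟨a, a', b, j, l, rfl⟩) | ⟨b, b', a, l, j, rfl⟩) <;>
    refine (TwoSidedIdeal.mem_ker _).mpr ?_
    · rw [extData_lift_inclA, BoundQuiverAlgebra.mk_eq_zero IA hy]
      exact map_zero _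
    · rw [extData_lift_inclB, BoundQuiverAlgebra.mk_eq_zero IB hy]
      exact map_zero _
    · rw [map_mul, LiftData.lift_arrow, LiftData.lift_arrow]
      refine (inl_mul_extArrow hA hB (arrow IA e, 0) (Sum.inl ⟨a', b, j⟩)).trans ?_
      rw [show addedCharacter hA hB (Sum.inl ⟨a', b, j⟩ : AddedArrow J K) (arrow IA e, 0) = 0 from
        BoundQuiverAlgebra.character_arrow hA a' e, zero_smul]
    · rw [map_mul, LiftData.lift_arrow, LiftData.lift_arrow]
      refine (inl_mul_extArrow hA hB (0, arrow IB e) (Sum.inr ⟨b', a, l⟩)).trans ?_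
      rw [show addedCharacter hA hB (Sum.inr ⟨b', a, l⟩ : AddedArrow J K) (0, arrow IB e) = 0 from
        BoundQuiverAlgebra.character_arrow hB b' e, zero_smul]
    · rw [map_mul, LiftData.lift_arrow, LiftData.lift_arrow]
      exact extArrow_mul_extArrow hA hB (Sum.inl ⟨a, b, j⟩) (Sum.inr ⟨b, a', l⟩)
    · rw [map_mul, LiftData.lift_arrow, LiftData.lift_arrow]
      exact extArrow_mul_extArrow hA hB (Sum.inr ⟨b, a, l⟩) (Sum.inl ⟨a, b', j⟩)
  exact (TwoSidedIdeal.mem_ker _).mp (h hx)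

/-- The homomorphism from the glued algebra to the split extension. -/
def toExt : BoundQuiverAlgebra (gluedIdeal J K IA IB) →ₐ[k] Ext (J := J) (K := K) hA hB :=
  BoundQuiverAlgebra.lift _ (extData hA hB).lift (extData_lift_eq_zero hA hB)

end GluedQuiver

/-! ### Non-unital homomorphisms of bound quiver algebras -/

namespace BoundQuiverAlgebra

variable {k : Type u} [Field k] {V : Type u} [Quiver.{u} V] [Fintype V]
  (I : TwoSidedIdeal (PathAlgebra k V))

theorem arrow_mul_arrow_of_ne {a b c d : V} (e : a ⟶ b) (e' : c ⟶ d) (h : b ≠ c) :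
    arrow I e * arrow I e' = 0 := by
  rw [← arrow_mul_vertex, ← vertex_mul_arrow I e', mul_assoc, ← mul_assoc (vertex I b),
    vertex_mul_of_ne I h, zero_mul, mul_zero]

theorem vertex_mul_arrow_of_ne {b c d : V} (e' : c ⟶ d) (h : b ≠ c) :
    vertex I b * arrow I e' = 0 := by
  rw [← vertex_mul_arrow I e', ← mul_assoc, vertex_mul_of_ne I h, zero_mul]

/-- A morphism of quivers which is injective on vertices and maps an ideal to another one induces
a homomorphism of bound quiver algebras, which need not preserve the identity. -/
def mapHom {W : Type u} [Quiver.{u} W] [Fintype W] (I' : TwoSidedIdeal (PathAlgebra k W))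
    (F : V ⥤q W) (hF : Function.Injective F.obj) (h : ∀ x ∈ I, PathAlgebra.map F x ∈ I') :
    BoundQuiverAlgebra I →ₙ+* BoundQuiverAlgebra I' :=
  I.liftNonUnital ((mk I' : PathAlgebra k W →ₙ+* BoundQuiverAlgebra I').comp
    (PathAlgebra.mapHom F hF)) fun x hx => mk_eq_zero I' (h x hx)

section

variable {W : Type u} [Quiver.{u} W] [Fintype W] (I' : TwoSidedIdeal (PathAlgebra k W))
    (F : V ⥤q W) (hF : Function.Injective F.obj) (h : ∀ x ∈ I, PathAlgebra.map F x ∈ I')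

theorem mapHom_mk (x : PathAlgebra k V) :
    mapHom I I' F hF h (mk I x) = mk I' (PathAlgebra.map F x) := rfl

theorem mapHom_vertex (v : V) : mapHom I I' F hF h (vertex I v) = vertex I' (F.obj v) := by
  rw [vertex, mapHom_mk, map_vertex]
  rfl

theorem mapHom_arrow {v w : V} (e : v ⟶ w) :
    mapHom I I' F hF h (arrow I e) = arrow I' (F.map e) := by
  rw [arrow, mapHom_mk, map_arrow]
  rfl

theorem mapHom_smul (c : k) (x : BoundQuiverAlgebra I) :
    mapHom I I' F hF h (c • x) = c • mapHom I I' F hF h x := by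
  obtain ⟨x, rfl⟩ := mk_surjective I x
  rw [← map_smul, mapHom_mk, mapHom_mk, map_smul, map_smul]

theorem mapHom_one : mapHom I I' F hF h 1 = ∑ v, vertex I' (F.obj v) := by
  rw [← sum_vertex I, map_sum]
  exact Finset.sum_congr rfl fun v _ => mapHom_vertex I I' F hF h v

/-- If all arrows in the image of a morphism of quivers annihilate an arrow from the left, then the
image of the algebra acts on this arrow through a character. -/
theorem mapHom_mul_arrow (hI : I ≤ arrowIdealPow k V 2) (v : V) {w : W} (e : F.obj v ⟶ w)
    (he : ∀ (u : V) (d : u ⟶ v), arrow I' (F.map d) * arrow I' e = 0)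
    (x : BoundQuiverAlgebra I) :
    mapHom I I' F hF h x * arrow I' e = character hI v x • arrow I' e := by
  induction x using induction_arrows with
  | zero => rw [map_zero, map_zero, zero_mul, zero_smul]
  | add x y hx hy => rw [map_add, map_add, add_mul, hx, hy, add_smul]
  | vertex c u =>
    rw [mapHom_smul, map_smul, mapHom_vertex, smul_mul_assoc, smul_assoc]
    congr 1
    by_cases huv : u = v
    · subst huv
      rw [character_vertex_self, one_smul, vertex_mul_arrow]
    · rw [character_vertex_of_ne hI huv, zero_smul,
        vertex_mul_arrow_of_ne I' e fun h' => huv (hF h')]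
  | mul_arrow x a b d hx =>
    rw [map_mul, map_mul, character_arrow, mul_zero, zero_smul, mapHom_arrow, mul_assoc]
    by_cases hb : b = v
    · subst hb
      rw [he, mul_zero]
    · rw [arrow_mul_arrow_of_ne I' _ _ fun h' => hb (hF h'), mul_zero]

end

end BoundQuiverAlgebra

/-! ### The glued algebra as a square-zero extension of A × B -/

namespace GluedQuiver

open BoundQuiverAlgebra (mk vertex arrow character)

section

variable {VA VB : Type u} [Quiver.{u} VA] [Quiver.{u} VB] (J : VA → VB → Type u)
  (K : VB → VA → Type u)

theorem inclA_injective : Function.Injective (inclA J K).obj := Sum.inl_injective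

theorem inclB_injective : Function.Injective (inclB J K).obj := Sum.inr_injective

end

variable {k : Type u} [Field k] {VA VB : Type u} [Fintype VA] [Fintype VB] [Quiver.{u} VA]
  [Quiver.{u} VB] (J : VA → VB → Type u) (K : VB → VA → Type u)
  (IA : TwoSidedIdeal (PathAlgebra k VA)) (IB : TwoSidedIdeal (PathAlgebra k VB))

/-- The glued algebra. -/
abbrev Glued : Type u := BoundQuiverAlgebra (gluedIdeal J K IA IB)

theorem map_inclA_mem (x : PathAlgebra k VA) (hx : x ∈ IA) :
    PathAlgebra.map (inclA J K) x ∈ gluedIdeal J K IA IB :=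
  TwoSidedIdeal.subset_span (Or.inl (Or.inl (Or.inl (Or.inl (Or.inl ⟨x, hx, rfl⟩)))))

theorem map_inclB_mem (x : PathAlgebra k VB) (hx : x ∈ IB) :
    PathAlgebra.map (inclB J K) x ∈ gluedIdeal J K IA IB :=
  TwoSidedIdeal.subset_span (Or.inl (Or.inl (Or.inl (Or.inl (Or.inr ⟨x, hx, rfl⟩)))))

/-- The inclusion of the algebra of the first quiver. -/
def homA : BoundQuiverAlgebra IA →ₙ+* Glued J K IA IB :=
  BoundQuiverAlgebra.mapHom IA _ (inclA J K) (inclA_injective J K) (map_inclA_mem J K IA IB)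

/-- The inclusion of the algebra of the second quiver. -/
def homB : BoundQuiverAlgebra IB →ₙ+* Glued J K IA IB :=
  BoundQuiverAlgebra.mapHom IB _ (inclB J K) (inclB_injective J K) (map_inclB_mem J K IA IB)

theorem homA_one_add_homB_one : homA J K IA IB 1 + homB J K IA IB 1 = 1 := by
  rw [homA, homB, BoundQuiverAlgebra.mapHom_one, BoundQuiverAlgebra.mapHom_one,
    ← BoundQuiverAlgebra.sum_vertex]
  exact (Fintype.sum_sum_type (fun v : VA ⊕ VB => vertex (gluedIdeal J K IA IB) v)).symm

/-- Two idempotents with sum 1 are orthogonal. This makes the sum of the non-unital maps `homA` and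
`homB` a ring homomorphism. -/
theorem homA_mul_homB (x : BoundQuiverAlgebra IA) (y : BoundQuiverAlgebra IB) :
    homA J K IA IB x * homB J K IA IB y = 0 := by
  have h : homA J K IA IB 1 * homB J K IA IB 1 = 0 := by
    rw [← add_right_inj (homA J K IA IB 1 * homA J K IA IB 1), ← mul_add,
      homA_one_add_homB_one, ← map_mul, mul_one, mul_one, add_zero]
  rw [← mul_one x, ← one_mul y, map_mul, map_mul, mul_assoc, ← mul_assoc (homA J K IA IB 1), h,
    zero_mul, mul_zero]

theorem homB_mul_homA (x : BoundQuiverAlgebra IA) (y : BoundQuiverAlgebra IB) :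
    homB J K IA IB y * homA J K IA IB x = 0 := by
  have h : homB J K IA IB 1 * homA J K IA IB 1 = 0 := by
    rw [← add_left_inj (homA J K IA IB 1 * homA J K IA IB 1), ← add_mul,
      add_comm (homB J K IA IB 1), homA_one_add_homB_one, ← map_mul, mul_one, one_mul, zero_add]
  rw [← mul_one y, ← one_mul x, map_mul, map_mul, mul_assoc, ← mul_assoc (homB J K IA IB 1), h,
    zero_mul, mul_zero]

/-- The inclusion of the product algebra. -/
def baseHom : Base IA IB →+* Glued J K IA IB where
  toFun r := homA J K IA IB r.1 + homB J K IA IB r.2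
  map_one' := homA_one_add_homB_one J K IA IB
  map_zero' := by rw [Prod.fst_zero, Prod.snd_zero, map_zero, map_zero, add_zero]
  map_add' r s := by
    rw [Prod.fst_add, Prod.snd_add, map_add, map_add]
    abel
  map_mul' r s := by
    rw [Prod.fst_mul, Prod.snd_mul, map_mul, map_mul, add_mul, mul_add, mul_add, homA_mul_homB,
      homB_mul_homA, add_zero, zero_add]

variable {J K IA IB}

theorem baseHom_apply (r : Base IA IB) :
    baseHom J K IA IB r = homA J K IA IB r.1 + homB J K IA IB r.2 := rfl

theorem baseHom_smul (c : k) (r : Base IA IB) :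
    baseHom J K IA IB (c • r) = c • baseHom J K IA IB r := by
  rw [baseHom_apply, baseHom_apply, smul_add]
  congr 1
  · exact BoundQuiverAlgebra.mapHom_smul IA _ _ _ _ c r.1
  · exact BoundQuiverAlgebra.mapHom_smul IB _ _ _ _ c r.2

theorem baseHom_vertex (v : GluedQuiver J K) :
    baseHom J K IA IB (baseVertex IA IB v) = vertex (gluedIdeal J K IA IB) v := by
  rcases v with a | b
  · change homA J K IA IB (vertex IA a) + homB J K IA IB 0 = _
    rw [map_zero, add_zero]
    exact BoundQuiverAlgebra.mapHom_vertex IA _ _ _ _ a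
  · change homA J K IA IB 0 + homB J K IA IB (vertex IB b) = _
    rw [map_zero, zero_add]
    exact BoundQuiverAlgebra.mapHom_vertex IB _ _ _ _ b

/-- The class of an added arrow. -/
def addedArrow (i : AddedArrow J K) : Glued J K IA IB := arrow _ (added i)

/-- Either the arrows do not compose, or one goes from Q_A to Q_B and the other back, and the
product is a generator of the ideal. -/
theorem addedArrow_mul_addedArrow (i j : AddedArrow J K) :
    (addedArrow i * addedArrow j : Glued J K IA IB) = 0 := by
  by_cases h : tgt i = src j
  · rcases i with ⟨a, b, x⟩ | ⟨b, a, x⟩ <;> rcases j with ⟨a', b', y⟩ | ⟨b', a', y⟩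
    · exact absurd h Sum.inr_ne_inl
    · obtain rfl : b = b' := Sum.inr_injective h
      refine (map_mul (mk (gluedIdeal J K IA IB)) _ _).symm.trans
        (BoundQuiverAlgebra.mk_eq_zero _ (TwoSidedIdeal.subset_span (Or.inl (Or.inr ?_))))
      exact ⟨a, a', b, x, y, rfl⟩
    · obtain rfl : a = a' := Sum.inl_injective h
      refine (map_mul (mk (gluedIdeal J K IA IB)) _ _).symm.trans
        (BoundQuiverAlgebra.mk_eq_zero _ (TwoSidedIdeal.subset_span (Or.inr ?_)))
      exact ⟨b, b', a, x, y, rfl⟩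
    · exact absurd h Sum.inl_ne_inr
  · exact BoundQuiverAlgebra.arrow_mul_arrow_of_ne _ _ _ h

theorem addedArrow_mul_baseVertex (i : AddedArrow J K) :
    (addedArrow i * baseHom J K IA IB (baseVertex IA IB (tgt i)) : Glued J K IA IB) =
      addedArrow i := by
  rw [baseHom_vertex]
  exact BoundQuiverAlgebra.arrow_mul_vertex _ _

variable (hA : IA ≤ arrowIdealPow k VA 2) (hB : IB ≤ arrowIdealPow k VB 2)

/-- The factor containing the source acts by `mapHom_mul_arrow`. Its identity fixes the arrow, so
the complementary idempotent, and with it the other factor, annihilates the arrow. -/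
theorem baseHom_mul_addedArrow (r : Base IA IB) (i : AddedArrow J K) :
    baseHom J K IA IB r * addedArrow i = addedCharacter hA hB i r • addedArrow i := by
  have hsum := homA_one_add_homB_one J K IA IB
  rcases i with ⟨a, b, x⟩ | ⟨b, a, x⟩
  · have h : ∀ y, homA J K IA IB y * addedArrow (Sum.inl ⟨a, b, x⟩) =
        character hA a y • addedArrow (Sum.inl ⟨a, b, x⟩) :=
      BoundQuiverAlgebra.mapHom_mul_arrow IA _ (inclA J K) _ _ hA a (arrowAB K x) fun u d => by
        refine (map_mul (mk (gluedIdeal J K IA IB)) _ _).symm.trans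
          (BoundQuiverAlgebra.mk_eq_zero _ (TwoSidedIdeal.subset_span
            (Or.inl (Or.inl (Or.inl (Or.inr ?_))))))
        exact ⟨u, a, b, d, x, rfl⟩
    have h0 : homB J K IA IB 1 * addedArrow (Sum.inl ⟨a, b, x⟩) = 0 := by
      rw [← eq_sub_iff_add_eq'] at hsum
      rw [hsum, sub_mul, h, map_one, one_smul, one_mul, sub_self]
    rw [baseHom_apply, add_mul, h, ← mul_one r.2, map_mul, mul_assoc, h0, mul_zero, add_zero]
    rfl
  · have h : ∀ y, homB J K IA IB y * addedArrow (Sum.inr ⟨b, a, x⟩) =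
        character hB b y • addedArrow (Sum.inr ⟨b, a, x⟩) :=
      BoundQuiverAlgebra.mapHom_mul_arrow IB _ (inclB J K) _ _ hB b (arrowBA J x) fun u d => by
        refine (map_mul (mk (gluedIdeal J K IA IB)) _ _).symm.trans
          (BoundQuiverAlgebra.mk_eq_zero _ (TwoSidedIdeal.subset_span
            (Or.inl (Or.inl (Or.inr ?_)))))
        exact ⟨u, b, a, d, x, rfl⟩
    have h0 : homA J K IA IB 1 * addedArrow (Sum.inr ⟨b, a, x⟩) = 0 := by
      rw [← eq_sub_iff_add_eq] at hsum
      rw [hsum, sub_mul, h, map_one, one_smul, one_mul, sub_self]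
    rw [baseHom_apply, add_mul, h, ← mul_one r.1, map_mul, mul_assoc, h0, mul_zero, zero_add]
    rfl

theorem toExt_baseHom (r : Base IA IB) :
    toExt hA hB (baseHom J K IA IB r) = TwistedExt.inl _ r := by
  obtain ⟨a, b⟩ := r
  obtain ⟨x, rfl⟩ := BoundQuiverAlgebra.mk_surjective IA a
  obtain ⟨y, rfl⟩ := BoundQuiverAlgebra.mk_surjective IB b
  rw [baseHom_apply, map_add]
  refine (congrArg₂ (· + ·) (extData_lift_inclA hA hB x) (extData_lift_inclB hA hB y)).trans ?_
  rw [← map_add, Prod.mk_add_mk, add_zero, zero_add]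

theorem toExt_addedArrow (i : AddedArrow J K) :
    toExt hA hB (addedArrow i : Glued J K IA IB) = extArrow hA hB i := by
  refine (LiftData.lift_arrow _ (added i)).trans ?_
  rcases i with ⟨a, b, x⟩ | ⟨b, a, x⟩ <;> rfl

theorem toExt_addedArrow_mul_self (i : AddedArrow J K) (r : Base IA IB) :
    (toExt hA hB (addedArrow i * baseHom J K IA IB r)).2 i = baseVertex IA IB (tgt i) * r := by
  rw [map_mul, toExt_baseHom, toExt_addedArrow, TwistedExt.mul_snd, TwistedExt.inl_fst,
    TwistedExt.inl_snd, smul_zero, add_zero, extArrow_snd_self]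

theorem toExt_addedArrow_mul_of_ne {i j : AddedArrow J K} (h : j ≠ i) (r : Base IA IB) :
    (toExt hA hB (addedArrow i * baseHom J K IA IB r)).2 j = 0 := by
  rw [map_mul, toExt_baseHom, toExt_addedArrow, TwistedExt.mul_snd, TwistedExt.inl_fst,
    TwistedExt.inl_snd, smul_zero, add_zero, extArrow_snd_of_ne hA hB h, zero_mul]

variable [Fintype (AddedArrow J K)]

/-- The map from the split extension to the glued algebra. -/
def ofExt : Ext (J := J) (K := K) hA hB →+ Glued J K IA IB where
  toFun x := baseHom J K IA IB x.1 + ∑ i, addedArrow i * baseHom J K IA IB (x.2 i)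
  map_zero' := by
    simp only [TwistedExt.zero_fst, TwistedExt.zero_snd, map_zero, mul_zero,
      Finset.sum_const_zero, add_zero]
  map_add' x y := by
    simp only [TwistedExt.add_fst, TwistedExt.add_snd, map_add, mul_add, Finset.sum_add_distrib]
    abel

theorem ofExt_apply (x : Ext (J := J) (K := K) hA hB) : ofExt hA hB x =
    baseHom J K IA IB x.1 + ∑ i, addedArrow i * baseHom J K IA IB (x.2 i) := rfl

theorem ofExt_inl (r : Base IA IB) :
    ofExt hA hB (TwistedExt.inl _ r) = baseHom J K IA IB r := by
  rw [ofExt_apply, TwistedExt.inl_fst, add_eq_left]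
  refine Finset.sum_eq_zero fun i _ => ?_
  rw [TwistedExt.inl_snd, map_zero, mul_zero]

theorem ofExt_mul_inl (x : Ext (J := J) (K := K) hA hB) (r : Base IA IB) :
    ofExt hA hB (x * TwistedExt.inl _ r) = ofExt hA hB x * baseHom J K IA IB r := by
  rw [ofExt_apply, ofExt_apply, add_mul, Finset.sum_mul, TwistedExt.mul_fst, TwistedExt.inl_fst,
    map_mul]
  congr 1
  refine Finset.sum_congr rfl fun i _ => ?_
  rw [TwistedExt.mul_snd, TwistedExt.inl_fst, TwistedExt.inl_snd, smul_zero, add_zero, map_mul,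
    mul_assoc]

/-- On both sides only the component of x in R survives, and it acts by its character; the
components in the ideal die because products of added arrows vanish. -/
theorem ofExt_mul_extArrow (x : Ext (J := J) (K := K) hA hB) (i : AddedArrow J K) :
    ofExt hA hB (x * extArrow hA hB i) = ofExt hA hB x * addedArrow i := by
  rw [ofExt_apply, ofExt_apply, add_mul, Finset.sum_mul, TwistedExt.mul_fst, extArrow_fst,
    mul_zero, map_zero, zero_add, baseHom_mul_addedArrow hA hB, Finset.sum_eq_single i]
  · rw [Finset.sum_eq_zero, add_zero]
    · rw [TwistedExt.mul_snd, extArrow_fst, mul_zero, zero_add, extArrow_snd_self, baseHom_smul,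
        mul_smul_comm, addedArrow_mul_baseVertex]
    · intro j _
      rw [mul_assoc, baseHom_mul_addedArrow hA hB, mul_smul_comm, addedArrow_mul_addedArrow,
        smul_zero]
  · intro j _ hj
    rw [TwistedExt.mul_snd, extArrow_fst, mul_zero, zero_add, extArrow_snd_of_ne hA hB hj,
      smul_zero, map_zero, mul_zero]
  · simp

/-- It suffices to know that `ofExt` respects right multiplication by the images of arrows, each
arrow being either added or from the base. Full multiplicativity of `ofExt` is not needed. -/
theorem ofExt_toExt (c : Glued J K IA IB) : ofExt hA hB (toExt hA hB c) = c := by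
  induction c using BoundQuiverAlgebra.induction_arrows with
  | zero => rw [map_zero, map_zero]
  | add x y hx hy => rw [map_add, map_add, hx, hy]
  | vertex c v => rw [← baseHom_vertex, ← baseHom_smul, toExt_baseHom, ofExt_inl]
  | mul_arrow x v w e hx =>
    rw [map_mul]
    have hbase : ∀ r, arrow _ e = baseHom J K IA IB r →
        ofExt hA hB (toExt hA hB x * toExt hA hB (arrow _ e)) = x * arrow _ e := by
      intro r hr
      rw [hr, toExt_baseHom, ofExt_mul_inl, hx]
    have hadd : ∀ i, arrow _ e = (addedArrow i : Glued J K IA IB) →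
        ofExt hA hB (toExt hA hB x * toExt hA hB (arrow _ e)) = x * arrow _ e := by
      intro i hi
      rw [hi, toExt_addedArrow, ofExt_mul_extArrow, hx]
    rcases v with a | b <;> rcases w with a' | b'
    · refine hbase (BoundQuiverAlgebra.arrow IA e, 0) ?_
      rw [baseHom_apply, map_zero, add_zero]
      exact (BoundQuiverAlgebra.mapHom_arrow IA _ (inclA J K) _ _ e).symm
    · exact hadd (Sum.inl ⟨a, b', e⟩) rfl
    · exact hadd (Sum.inr ⟨b, a', e⟩) rfl
    · refine hbase (0, BoundQuiverAlgebra.arrow IB e) ?_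
      rw [baseHom_apply, map_zero, zero_add]
      exact (BoundQuiverAlgebra.mapHom_arrow IB _ (inclB J K) _ _ e).symm

/-- The glued algebra is a split extension of the product algebra by a square-zero ideal. -/
def squareZeroData :
    SquareZeroData k (Base IA IB) (Glued J K IA IB) (AddedArrow J K) where
  π := (TwistedExt.fstHom _).comp (toExt hA hB).toRingHom
  ι := baseHom J K IA IB
  ε := addedArrow
  f i := baseVertex IA IB (tgt i)
  χ := addedCharacter hA hB
  ρ i :=
    { toFun := fun c => (toExt hA hB c).2 i
      map_zero' := by rw [map_zero]; rfl
      map_add' := fun x y => by rw [map_add]; rfl }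
  π_ι r := congrArg Prod.fst (toExt_baseHom hA hB r)
  π_ε i := congrArg Prod.fst (toExt_addedArrow hA hB i)
  ρ_mul i c c' := by
    change (toExt hA hB (c * c')).2 i = _
    rw [map_mul, TwistedExt.mul_snd, Algebra.smul_def]
    rfl
  f_ρ i c := by
    change baseVertex IA IB (tgt i) * (toExt hA hB c).2 i = (toExt hA hB c).2 i
    -- The explicit extension has a full copy of R in each slot. Going to the glued algebra and back
    -- multiplies slot i by the idempotent of the target, while `ofExt_toExt` says that elements of
    -- the image of `toExt` do not change.
    have h : ∀ x : Ext (J := J) (K := K) hA hB,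
        (toExt hA hB (ofExt hA hB x)).2 i = baseVertex IA IB (tgt i) * x.2 i := by
      intro x
      let p : Ext (J := J) (K := K) hA hB →+ Base IA IB :=
        { toFun := fun y => y.2 i
          map_zero' := rfl
          map_add' := fun _ _ => rfl }
      change p (toExt hA hB (ofExt hA hB x)) = _
      rw [ofExt_apply, map_add, map_add, map_sum, map_sum, Finset.sum_eq_single i]
      · change (toExt hA hB (baseHom J K IA IB x.1)).2 i +
          (toExt hA hB (addedArrow i * baseHom J K IA IB (x.2 i))).2 i = _
        rw [toExt_baseHom, TwistedExt.inl_snd, zero_add, toExt_addedArrow_mul_self]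
      · intro j _ hj
        exact toExt_addedArrow_mul_of_ne hA hB hj.symm _
      · simp
    rw [← h, ofExt_toExt]
  ρ_ι i r := congrArg (fun x => x.2 i) (toExt_baseHom hA hB r)
  ρ_ε_self i := (congrArg (fun x => x.2 i) (toExt_addedArrow hA hB i)).trans
    (extArrow_snd_self hA hB i)
  ρ_ε_of_ne i j h := (congrArg (fun x => x.2 i) (toExt_addedArrow hA hB j)).trans
    (extArrow_snd_of_ne hA hB h)
  decomp c := (ofExt_toExt hA hB c).symm

end GluedQuiver

/-! ### The two factors of a product ring -/

namespace IgusaTodorov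

/-- The first factor of a product of two rings. -/
def RingFactor.fst (A B : Type u) [Ring A] [Ring B] : RingFactor A (A × B) where
  p := RingHom.fst A B
  s :=
    { toFun := fun a => (a, 0)
      map_zero' := rfl
      map_add' := fun _ _ => Prod.ext rfl (add_zero _).symm
      map_mul' := fun _ _ => Prod.ext rfl (mul_zero _).symm }
  p_s _ := rfl
  s_p_left _ := Prod.ext (one_mul _).symm (zero_mul _).symm
  s_p_right _ := Prod.ext (mul_one _).symm (mul_zero _).symm

/-- The second factor of a product of two rings. -/
def RingFactor.snd (A B : Type u) [Ring A] [Ring B] : RingFactor B (A × B) where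
  p := RingHom.snd A B
  s :=
    { toFun := fun b => (0, b)
      map_zero' := rfl
      map_add' := fun _ _ => Prod.ext (add_zero _).symm rfl
      map_mul' := fun _ _ => Prod.ext (mul_zero _).symm rfl }
  p_s _ := rfl
  s_p_left _ := Prod.ext (zero_mul _).symm (one_mul _).symm
  s_p_right _ := Prod.ext (mul_zero _).symm (mul_one _).symm

theorem RingFactor.fst_add_snd (A B : Type u) [Ring A] [Ring B] :
    (RingFactor.fst A B).s 1 + (RingFactor.snd A B).s 1 = 1 :=
  Prod.ext (add_zero _) (zero_add _)

end IgusaTodorov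

end

/-! ### The proposition -/

theorem proposition3p6 {k : Type u} [Field k]
    {VA VB : Type u} [Fintype VA] [Fintype VB] [Quiver.{u} VA] [Quiver.{u} VB]
    [∀ a a' : VA, Finite (a ⟶ a')] [∀ b b' : VB, Finite (b ⟶ b')]
    (J : VA → VB → Type u) (K : VB → VA → Type u)
    [∀ a b, Finite (J a b)] [∀ b a, Finite (K b a)]
    (IA : TwoSidedIdeal (PathAlgebra k VA)) (IB : TwoSidedIdeal (PathAlgebra k VB))
    (IC : TwoSidedIdeal (PathAlgebra k (GluedQuiver J K)))
    (hIA : PathAlgebra.IsAdmissible IA) (hIB : PathAlgebra.IsAdmissible IB)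
    (H3 : GluedQuiver.gluedIdeal J K IA IB = IC)
    [Module.Finite k (BoundQuiverAlgebra IA)] [Module.Finite k (BoundQuiverAlgebra IB)]
    [Module.Finite k (BoundQuiverAlgebra IC)] (n : ℕ) :
    (IgusaTodorov.IsIgusaTodorovOp n (BoundQuiverAlgebra IA) →
      IgusaTodorov.IsIgusaTodorovOp n (BoundQuiverAlgebra IB) →
      IgusaTodorov.IsIgusaTodorovOp (n + 1) (BoundQuiverAlgebra IC)) ∧
    (IgusaTodorov.IsLITOp n (BoundQuiverAlgebra IA) →
      IgusaTodorov.IsLITOp n (BoundQuiverAlgebra IB) →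
      IgusaTodorov.IsLITOp (n + 1) (BoundQuiverAlgebra IC)) := by
  subst H3
  -- Finiteness of the quiver enters here: the ideal of added arrows is a finite direct sum.
  have : Fintype (GluedQuiver.AddedArrow J K) := Fintype.ofFinite _
  let S := GluedQuiver.squareZeroData (J := J) (K := K) hIA.1 hIB.1
  let c := IgusaTodorov.RingFactor.fst (BoundQuiverAlgebra IA) (BoundQuiverAlgebra IB)
  let d := IgusaTodorov.RingFactor.snd (BoundQuiverAlgebra IA) (BoundQuiverAlgebra IB)
  have h : c.s 1 + d.s 1 = 1 := IgusaTodorov.RingFactor.fst_add_snd _ _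
  constructor
  · rintro ⟨VA, hVA⟩ ⟨VB, hVB⟩
    have hC := S.isLITWith (IgusaTodorov.IsLITWith.of_factors c d h hVA hVB)
    -- The class D produced from zero modules over A and B consists again of zero modules.
    rw [IgusaTodorov.factorClass_subsingleton c d h, S.indClass_subsingleton] at hC
    exact ⟨_, hC⟩
  · rintro ⟨VA, DA, hVA⟩ ⟨VB, DB, hVB⟩
    exact ⟨_, _, S.isLITWith (IgusaTodorov.IsLITWith.of_factors c d h hVA hVB)⟩
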